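/- Let $G$ be the group of smooth maps $A:\mathbb R^p\to SO(3)$ equal to $\mathrm{Id}$ outside a compact set, with pointwise product, let $SE(p)=\{(U,a)\}$ act on $\mathbb R^p$ by $x\mapsto Ux+a$ and on $G$ by $\theta_h(A)=A\circ h^{-1}$, and let $\tilde G=G\rtimes_\theta SE(p)$ act on $T^*G=\{(\psi,\nu)\}$ (trivialized by right translation; $\psi\in G$, $\nu:\mathbb R^p\to\mathbb R^3\cong\mathfrak{so}(3)$ smooth) by $(A,h)\cdot(\psi,\nu)=((\psi\circ h^{-1})A^{-1},\nu\circ h^{-1})$, with momentum map $$J^{\tilde G}_{(\xi,(\Omega,\dot a))}(\psi,\nu)=\int\nu\cdot\tfrac{d}{d\epsilon}\Big|_{0}\psi\big(e^{-\epsilon\Omega}(x-\epsilon\dot a)\big)e^{-\epsilon\xi(x)}\psi(x)^{-1}\,dx ,$$ whose restriction to $\mathfrak g$ is $J^G(\psi,\nu)=-\psi^{-1}\nu$. Fix a smooth $\mu:\mathbb R^p\to S^2\subset\mathbb R^3$, constant outside a compact set, and put $G_\mu=\{A\in G: A\mu=\mu\}$, $H_\mu=\{g\in\tilde G: g\,(J^G)^{-1}(\mu)\subseteq(J^G)^{-1}(\mu)\}$,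 with Lie algebra $\mathfrak h_\mu$. 1. (Residual group.) $H_\mu=\{(A,h): A(x)\mu(h^{-1}x)=\mu(x)\ \forall x\}$; $G_\mu=G\cap H_\mu$ is normal in $H_\mu$, and the projection to $SE(p)$ induces an isomorphism $\bar H_\mu=H_\mu/G_\mu\cong SE(p)$. The map $(\psi,-\psi\mu)\mapsto n=-\psi\mu$ identifies $P_\mu=(J^G)^{-1}(\mu)/G_\mu$ with a set of unit fields, on which $\bar H_\mu$ acts by $h\cdot n=n\circ h^{-1}$. An element $(\xi,(\Omega,\dot a))$ lies in $\mathfrak h_\mu$ iff $\xi\times\mu=\nabla_{\Omega x+\dot a}\mu$; in particular $(\mu\times\nabla_{\Omega x+\dot a}\mu,(\Omega,\dot a))\in\mathfrak h_\mu$. 2. (Cocycle.) Let $p\ge2$, let $\langle\hat\mu,(\xi,(\Omega,\dot a))\rangle=\int\mu\cdot\xi$, and give $P_\mu$ the Lie–Poisson bracket $\{F,K\}(n)=\int n\cdot\big(\frac{\delta F}{\delta n}\times\frac{\delta K}{\delta n}\big)$. Then $J^{\tilde G}|_{\mathfrak h_\mu}-\hat\mu$ on $(J^G)^{-1}(\mu)$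 descends to a unique map $J:P_\mu\to\mathfrak{se}(p)^*$, and $J_{(\Omega,\dot a)}$ generates the action $n\mapsto-\nabla_{\Omega x+\dot a}n$ (under $\dot n=-n\times\delta J_{(\Omega,\dot a)}/\delta n$). The cocycle $\sigma(h)=J(hn)-\mathrm{CoAd}_hJ(n)$ does not depend on $n\in P_\mu$, and its derivative $\Sigma(v,w)=\frac{d}{d\epsilon}\big|_0\langle\sigma(\gamma(\epsilon)),v\rangle$, for any curve $\gamma$ in $SE(p)$ with $\gamma(0)=1$, $\dot\gamma(0)=w$, is $$\Sigma\big((\Omega_1,\dot a_1),(\Omega_2,\dot a_2)\big)=-\int\mu\cdot\big(\nabla_{\Omega_1x+\dot a_1}\mu\times\nabla_{\Omega_2x+\dot a_2}\mu\big).$$ Moreover $\{J_v,J_w\}=J_{[v,w]}+\Sigma(v,w)$ on $P_\mu$. 3. (Symmetric $\mu$.) Call $\mu$ spherically symmetric if for each $U\in SO(p)$ there is $R\in SO(3)$ with $\mu(Ux)=R\mu(x)$ for all $x$ (for instance if $\mu$ depends on $|x|$ only). For $p\ge2$ and such $\mu$, $\Sigma((\Omega_1,\dot a_1),(\Omega_2,\dot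 a_2))=-\int\mu\cdot(\nabla_{\dot a_1}\mu\times\nabla_{\dot a_2}\mu)$; for $p=2$ this equals $-4\pi\,\omega_0(\dot a_1,\dot a_2)\deg\mu$, where $\omega_0(a,b)=a_1b_2-a_2b_1$ and $\deg n=\frac1{4\pi}\int n\cdot(\partial_xn\times\partial_yn)$. 4. (Papanicolaou–Tomaras momentum.) For $p\ge2$ let $P_i(n)=\frac1{p-1}\int n\cdot\big(\partial_in\times x^j\partial_jn\big)$ and, for $\Omega\in\mathfrak{so}(p)$, $L_\Omega(n)=\frac1p\int n\cdot\big(\nabla_{\Omega x}n\times x^j\partial_jn\big)$. Then for all $n\in P_\mu$, $J_{(\Omega,\dot a)}(n)=L_\Omega(n)+\dot a^iP_i(n)+L_\Omega(\mu)+\dot a^iP_i(\mu)$. If $\mu$ is spherically symmetric, then $J_{(0,\mathbf e_i)}=P_i$ on $P_\mu$; if $\mu$ depends on $|x|$ only, then $J_{(\Omega,\dot a)}=L_\Omega+\dot a^iP_i$ on $P_\mu$. For $p=2$ and every $\mu$ as above, all $n\in P_\mu$ satisfy $\deg n=-\deg\mu$ and $$\{P_x,P_y\}(n)=4\pi\deg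 n .$$ -/

import Mathlib

open MeasureTheory
open scoped Matrix ContDiff

namespace LandauLifshitz

noncomputable section

/-! ### Spaces

`ℝ^p` and `ℝ³` are `Fin p → ℝ` and `Fin 3 → ℝ`. Only their topology, smooth structure and
Lebesgue measure are used (never the norm of the function space); the Euclidean inner product
is `⬝ᵥ`, the cross product is `⨯₃`. -/

/-- `ℝ^p`. -/
abbrev Pt (p : ℕ) : Type := Fin p → ℝ

/-- `ℝ³`, also identified with `so(3)` through `hat`. -/
abbrev R3 : Type := Fin 3 → ℝ

/-- The rotation group `SO(q)`. -/
abbrev SO (q : ℕ) : Type := Matrix.specialOrthogonalGroup (Fin q) ℝ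

/-- The Lie algebra `so(q)` of skew-symmetric matrices. -/
abbrev so (q : ℕ) : Type := LieAlgebra.Orthogonal.so (Fin q) ℝ

/-- The matrix of `w ↦ v × w`. -/
def hat (v : R3) : Matrix (Fin 3) (Fin 3) ℝ :=
  !![0, -v 2, v 1; v 2, 0, -v 0; -v 1, v 0, 0]

/-- The inverse of `hat` on skew-symmetric matrices. -/
def vee (M : Matrix (Fin 3) (Fin 3) ℝ) : R3 := ![M 2 1, M 0 2, M 1 0]

lemma SO.inv_apply {q : ℕ} (A : SO q) (i j : Fin q) : (A⁻¹).1 i j = A.1 j i := rfl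

lemma SO.mul_val {q : ℕ} (A B : SO q) : (A * B).1 = A.1 * B.1 := rfl

lemma SO.one_val {q : ℕ} : (1 : SO q).1 = 1 := rfl

lemma SO.mul_mulVec {q : ℕ} (A B : SO q) (v : Fin q → ℝ) :
    (A * B).1 *ᵥ v = A.1 *ᵥ (B.1 *ᵥ v) := by
  rw [SO.mul_val, Matrix.mulVec_mulVec]

lemma SO.inv_mulVec_mulVec {q : ℕ} (A : SO q) (v : Fin q → ℝ) :
    (A⁻¹).1 *ᵥ (A.1 *ᵥ v) = v := by
  rw [← SO.mul_mulVec, inv_mul_cancel, SO.one_val, Matrix.one_mulVec]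

lemma SO.mulVec_inv_mulVec {q : ℕ} (A : SO q) (v : Fin q → ℝ) :
    A.1 *ᵥ ((A⁻¹).1 *ᵥ v) = v := by
  rw [← SO.mul_mulVec, mul_inv_cancel, SO.one_val, Matrix.one_mulVec]

/-! ### The Euclidean group and its Lie algebra -/

/-- The Euclidean group `SE(p)`; the element `(U, a)` is the motion `x ↦ U x + a`. -/
@[ext]
structure SE (p : ℕ) where
  rot : SO p
  trans : Pt p

namespace SE

variable {p : ℕ}

instance : One (SE p) := ⟨⟨1, 0⟩⟩
instance : Mul (SE p) := ⟨fun g h => ⟨g.rot * h.rot, g.rot.1 *ᵥ h.trans + g.trans⟩⟩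
instance : Inv (SE p) := ⟨fun g => ⟨g.rot⁻¹, -((g.rot⁻¹).1 *ᵥ g.trans)⟩⟩

lemma one_rot : (1 : SE p).rot = 1 := rfl
lemma one_trans : (1 : SE p).trans = 0 := rfl
lemma mul_rot (g h : SE p) : (g * h).rot = g.rot * h.rot := rfl
lemma mul_trans (g h : SE p) : (g * h).trans = g.rot.1 *ᵥ h.trans + g.trans := rfl
lemma inv_rot (g : SE p) : (g⁻¹).rot = g.rot⁻¹ := rfl
lemma inv_trans (g : SE p) : (g⁻¹).trans = -((g.rot⁻¹).1 *ᵥ g.trans) := rfl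

instance : Group (SE p) where
  mul_assoc f g h := by
    ext1
    · simp only [mul_rot, mul_assoc]
    · simp only [mul_rot, mul_trans, SO.mul_mulVec, Matrix.mulVec_add, add_assoc]
  one_mul g := by
    ext1
    · simp only [mul_rot, one_rot, one_mul]
    · simp only [mul_trans, one_rot, one_trans, SO.one_val, Matrix.one_mulVec, add_zero]
  mul_one g := by
    ext1
    · simp only [mul_rot, one_rot, mul_one]
    · simp only [mul_trans, one_trans, Matrix.mulVec_zero, zero_add]
  inv_mul_cancel g := by
    ext1
    · simp only [mul_rot, inv_rot, inv_mul_cancel, one_rot]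
    · simp only [mul_trans, inv_rot, inv_trans, one_trans, add_neg_cancel]

instance : MulAction (SE p) (Pt p) where
  smul h x := h.rot.1 *ᵥ x + h.trans
  one_smul x := by
    change (1 : SE p).rot.1 *ᵥ x + (1 : SE p).trans = x
    simp only [one_rot, one_trans, SO.one_val, Matrix.one_mulVec, add_zero]
  mul_smul g h x := by
    change (g * h).rot.1 *ᵥ x + (g * h).trans =
      g.rot.1 *ᵥ (h.rot.1 *ᵥ x + h.trans) + g.trans
    simp only [mul_rot, mul_trans, SO.mul_mulVec, Matrix.mulVec_add, add_assoc]

lemma smul_def (h : SE p) (x : Pt p) : h • x = h.rot.1 *ᵥ x + h.trans := rfl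

lemma contDiff_smul (h : SE p) : ContDiff ℝ ∞ (fun x : Pt p => h • x) := by
  simp only [smul_def]
  exact (Matrix.mulVecLin h.rot.1).toContinuousLinearMap.contDiff.add contDiff_const

end SE

/-- The Lie algebra `se(p) = so(p) × ℝ^p`. -/
abbrev se (p : ℕ) : Type := so p × Pt p

/-- The Lie bracket of `se(p)`. -/
def seBracket {p : ℕ} (v w : se p) : se p :=
  (⁅v.1, w.1⁆, v.1.1 *ᵥ w.2 - w.1.1 *ᵥ v.2)

lemma conj_mem_so {p : ℕ} (U : SO p) (M : so p) :
    U.1 * M.1 * (U⁻¹).1 ∈ LieAlgebra.Orthogonal.so (Fin p) ℝ := by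
  have hM := (LieAlgebra.Orthogonal.mem_so (Fin p) ℝ M.1).1 M.2
  have h1 : ((U⁻¹).1)ᵀ = U.1 := rfl
  have h2 : (U.1)ᵀ = (U⁻¹).1 := rfl
  rw [LieAlgebra.Orthogonal.mem_so, Matrix.transpose_mul, Matrix.transpose_mul, hM, h1, h2,
    Matrix.neg_mul, Matrix.mul_neg, Matrix.mul_assoc]

/-- The adjoint action of `SE(p)` on `se(p)`. -/
def seAd {p : ℕ} (h : SE p) (v : se p) : se p :=
  (⟨h.rot.1 * v.1.1 * (h.rot⁻¹).1, conj_mem_so h.rot v.1⟩,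
    h.rot.1 *ᵥ v.2 - (h.rot.1 * v.1.1 * (h.rot⁻¹).1) *ᵥ h.trans)

/-- The vector field `x ↦ Ω x + a` on `ℝ^p` of `(Ω, a) ∈ se(p)`. -/
def seField {p : ℕ} (v : se p) (x : Pt p) : Pt p := v.1.1 *ᵥ x + v.2

/-- The inverse of the motion `(exp (ε Ω), ε a)`, a curve through `1` tangent to `(Ω, a)`. -/
def seCurveInv {p : ℕ} (v : se p) (ε : ℝ) (x : Pt p) : Pt p :=
  NormedSpace.exp (-(ε • v.1.1)) *ᵥ (x - ε • v.2)

/-- The curve `γ` in `SE(p)` passes through `1` at time `0` with velocity `v ∈ se(p)`. -/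
structure IsTangentCurve {p : ℕ} (γ : ℝ → SE p) (v : se p) : Prop where
  at_zero : γ 0 = 1
  rot : ∀ i j, HasDerivAt (fun ε => (γ ε).rot.1 i j) (v.1.1 i j) 0
  trans : HasDerivAt (fun ε => (γ ε).trans) v.2 0

/-! ### The group `G` of rotation fields and the semidirect product -/

/-- The group `G` of smooth maps `ℝ^p → SO(3)` that are the identity outside a compact set,
with pointwise multiplication. -/
def rotFields (p : ℕ) : Subgroup (Pt p → SO 3) where
  carrier := {A | (∀ i j, ContDiff ℝ ∞ fun x => (A x).1 i j) ∧
    ∃ K : Set (Pt p), IsCompact K ∧ ∀ x ∉ K, A x = 1}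
  one_mem' := ⟨fun _ _ => contDiff_const, ∅, isCompact_empty, fun _ _ => rfl⟩
  mul_mem' := by
    rintro A B ⟨hA, K, hK, hAK⟩ ⟨hB, L, hL, hBL⟩
    refine ⟨fun i j => ?_, K ∪ L, hK.union hL, fun x hx => ?_⟩
    · simp only [Pi.mul_apply, SO.mul_val, Matrix.mul_apply]
      exact ContDiff.sum fun k _ => (hA i k).mul (hB k j)
    · simp only [Set.mem_union, not_or] at hx
      simp only [Pi.mul_apply, hAK x hx.1, hBL x hx.2, mul_one]
  inv_mem' := by
    rintro A ⟨hA, K, hK, hAK⟩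
    exact ⟨fun i j => hA j i, K, hK, fun x hx => by simp only [Pi.inv_apply, hAK x hx, inv_one]⟩

/-- `G`. -/
abbrev Gp (p : ℕ) : Type := rotFields p

lemma comp_mem_rotFields {p : ℕ} (h : SE p) (A : Gp p) :
    (fun x => A.1 (h⁻¹ • x)) ∈ rotFields p := by
  obtain ⟨hA, K, hK, hAK⟩ := A.2
  refine ⟨fun i j => (hA i j).comp (SE.contDiff_smul h⁻¹), (fun x => h • x) '' K,
    hK.image (SE.contDiff_smul h).continuous, fun x hx => hAK _ fun hx' => hx ?_⟩
  exact ⟨h⁻¹ • x, hx', smul_inv_smul h x⟩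

/-- The action `θ` of `SE(p)` on `G` by automorphisms, `θ_h(A)(x) = A(h⁻¹ x)`. -/
def theta (p : ℕ) : SE p →* MulAut (Gp p) where
  toFun h :=
    { toFun := fun A => ⟨fun x => A.1 (h⁻¹ • x), comp_mem_rotFields h A⟩
      invFun := fun A => ⟨fun x => A.1 (h⁻¹⁻¹ • x), comp_mem_rotFields h⁻¹ A⟩
      left_inv := fun A => Subtype.ext <| funext fun x => by simp
      right_inv := fun A => Subtype.ext <| funext fun x => by simp
      map_mul' := fun A B => rfl }
  map_one' := by
    ext A x : 3
    change A.1 ((1 : SE p)⁻¹ • x) = A.1 x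
    simp
  map_mul' g h := by
    ext A x : 3
    change A.1 ((g * h)⁻¹ • x) = A.1 (h⁻¹ • g⁻¹ • x)
    rw [mul_inv_rev, mul_smul]

/-- The semidirect product of `G` and `SE(p)`. -/
abbrev Gtilde (p : ℕ) : Type := Gp p ⋊[theta p] SE p

/-! ### The phase space `T^*G` -/

/-- The dual `𝔤^*` : smooth fields `ℝ^p → ℝ³`, without any condition at infinity. -/
abbrev DualField (p : ℕ) : Type := {ν : Pt p → R3 // ContDiff ℝ ∞ ν}

lemma contDiff_mulVec {p : ℕ} (A : Gp p) {ν : Pt p → R3} (hν : ContDiff ℝ ∞ ν) :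
    ContDiff ℝ ∞ fun x => (A.1 x).1 *ᵥ ν x := by
  rw [contDiff_pi]
  intro i
  simp only [Matrix.mulVec, dotProduct]
  exact ContDiff.sum fun j _ => (A.2.1 i j).mul (contDiff_pi.1 hν j)

/-- `T^*G`, trivialized by right translation: pairs `(ψ, ν)` in `G × 𝔤^*`. -/
@[ext]
structure Phase (p : ℕ) where
  conf : Gp p
  mom : DualField p

/-- The action of the semidirect product on `T^*G`:
`(A, h) · (ψ, ν) = ((ψ ∘ h⁻¹) A⁻¹, ν ∘ h⁻¹)`. -/
instance {p : ℕ} : MulAction (Gtilde p) (Phase p) where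
  smul g q := ⟨theta p g.right q.conf * g.left⁻¹,
    ⟨fun x => q.mom.1 (g.right⁻¹ • x), q.mom.2.comp (SE.contDiff_smul _)⟩⟩
  one_smul q := by
    refine Phase.ext ?_ (Subtype.ext <| funext fun x => ?_)
    · change theta p 1 q.conf * 1⁻¹ = q.conf
      simp
    · change q.mom.1 ((1 : SE p)⁻¹ • x) = q.mom.1 x
      simp
  mul_smul g h q := by
    refine Phase.ext ?_ (Subtype.ext <| funext fun x => ?_)
    · change theta p (g.right * h.right) q.conf * (g.left * theta p g.right h.left)⁻¹ =
        theta p g.right (theta p h.right q.conf * h.left⁻¹) * g.left⁻¹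
      simp [mul_assoc]
    · change q.mom.1 ((g.right * h.right)⁻¹ • x) = q.mom.1 (h.right⁻¹ • g.right⁻¹ • x)
      rw [mul_inv_rev, mul_smul]

/-- The momentum map of right translation, `J^G(ψ, ν) = -ψ⁻¹ ν`. -/
def JG {p : ℕ} (q : Phase p) : DualField p :=
  ⟨fun x => -(((q.conf⁻¹).1 x).1 *ᵥ q.mom.1 x), (contDiff_mulVec q.conf⁻¹ q.mom.2).neg⟩

/-- The elements `(ξ, (Ω, a))` of the Lie algebra of the semidirect product, `ξ` being a smooth
compactly supported field with values in `so(3) = ℝ³`. -/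
structure LieElt (p : ℕ) where
  fld : Pt p → R3
  smooth : ContDiff ℝ ∞ fld
  supp : HasCompactSupport fld
  eucl : se p

/-- The infinitesimal generator of `X = (ξ, (Ω, a))` on `G` at `ψ`, brought back to the identity
by right translation: the derivative at `ε = 0` of
`ψ(exp(-εΩ)(x - εa)) exp(-ε ξ(x)) ψ(x)⁻¹`. -/
def generator {p : ℕ} (X : LieElt p) (ψ : Gp p) (x : Pt p) : Matrix (Fin 3) (Fin 3) ℝ :=
  Matrix.of fun i j => deriv (fun ε : ℝ =>
    ((ψ.1 (seCurveInv X.eucl ε x)).1 * NormedSpace.exp (-(ε • hat (X.fld x))) *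
      ((ψ.1 x)⁻¹).1) i j) 0

/-- The momentum map of the (cotangent lifted) action of the semidirect product on `T^*G`:
the pairing of the momentum with the infinitesimal generator. -/
def momentum {p : ℕ} (X : LieElt p) (q : Phase p) : ℝ :=
  ∫ x, q.mom.1 x ⬝ᵥ vee (generator X q.conf x)

/-- The pairing of `𝔤^*` with `𝔤`. Composed with the projection to the first factor it also is
the extension `μ̂` of `μ`. -/
def pairing {p : ℕ} (μ : DualField p) (ξ : Pt p → R3) : ℝ := ∫ x, μ.1 x ⬝ᵥ ξ x

/-! ### Reduction at `μ` -/

/-- `μ` is a field of unit vectors which is constant outside a compact set. -/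
structure IsUnitField {p : ℕ} (μ : DualField p) : Prop where
  unit : ∀ x, μ.1 x ⬝ᵥ μ.1 x = 1
  const_at_infty : ∃ (e : R3) (K : Set (Pt p)), IsCompact K ∧ ∀ x ∉ K, μ.1 x = e

/-- The isotropy group `G_μ = {A ∈ G | A μ = μ}`. -/
def Gmu {p : ℕ} (μ : DualField p) : Subgroup (Gp p) where
  carrier := {A | ∀ x, (A.1 x).1 *ᵥ μ.1 x = μ.1 x}
  one_mem' := fun x => Matrix.one_mulVec _
  mul_mem' := by
    intro A B hA hB x
    change (A.1 x * B.1 x).1 *ᵥ μ.1 x = μ.1 x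
    rw [SO.mul_mulVec, hB x, hA x]
  inv_mem' := by
    intro A hA x
    change ((A.1 x)⁻¹).1 *ᵥ μ.1 x = μ.1 x
    conv_lhs => rw [← hA x]
    rw [SO.inv_mulVec_mulVec]

lemma JG_smul {p : ℕ} (g : Gtilde p) (q : Phase p) (x : Pt p) :
    (JG (g • q)).1 x = (g.left.1 x).1 *ᵥ (JG q).1 (g.right⁻¹ • x) := by
  change -(((q.conf.1 (g.right⁻¹ • x) * (g.left.1 x)⁻¹)⁻¹).1 *ᵥ q.mom.1 (g.right⁻¹ • x)) =
    (g.left.1 x).1 *ᵥ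
      (-(((q.conf.1 (g.right⁻¹ • x))⁻¹).1 *ᵥ q.mom.1 (g.right⁻¹ • x)))
  rw [mul_inv_rev, inv_inv, SO.mul_mulVec, Matrix.mulVec_neg]

lemma JG_base {p : ℕ} (μ : DualField p) : JG ⟨1, ⟨fun x => -μ.1 x, μ.2.neg⟩⟩ = μ := by
  refine Subtype.ext <| funext fun x => ?_
  change -(((1 : SO 3)⁻¹).1 *ᵥ (-μ.1 x)) = μ.1 x
  rw [inv_one, SO.one_val, Matrix.one_mulVec, neg_neg]

/-- The subgroup `H_μ` of the elements that map the level set `(J^G)⁻¹(μ)` into itself. -/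
def Hmu {p : ℕ} (μ : DualField p) : Subgroup (Gtilde p) where
  carrier := {g | ∀ q : Phase p, JG q = μ → JG (g • q) = μ}
  one_mem' := fun q hq => by rw [one_smul]; exact hq
  mul_mem' := by
    intro g h hg hh q hq
    rw [mul_smul]
    exact hg _ (hh _ hq)
  inv_mem' := by
    intro g hg q hq
    have h1 := hg _ (JG_base μ)
    refine Subtype.ext <| funext fun x => ?_
    have h2 := congrFun (congrArg Subtype.val h1) (g.right • x)
    have h3 := congrFun (congrArg Subtype.val (congrArg JG (smul_inv_smul g q))) (g.right • x)
    rw [JG_smul, JG_base, inv_smul_smul] at h2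
    rw [JG_smul, inv_smul_smul, hq, ← h2] at h3
    have h4 := congrArg (fun v => ((g.left.1 (g.right • x))⁻¹).1 *ᵥ v) h3
    simpa only [SO.inv_mulVec_mulVec] using h4

/-- `G_μ` as a subgroup of the semidirect product. -/
def GmuTilde {p : ℕ} (μ : DualField p) : Subgroup (Gtilde p) :=
  (Gmu μ).map SemidirectProduct.inl

/-- Membership in the Lie algebra `𝔥_μ`: the defining condition `A(x) μ(h⁻¹ x) = μ(x)` of `H_μ`,
differentiated at the identity in the direction `X`. -/
def InLieHmu {p : ℕ} (μ : DualField p) (X : LieElt p) : Prop :=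
  ∀ x, deriv (fun ε : ℝ =>
    NormedSpace.exp (ε • hat (X.fld x)) *ᵥ μ.1 (seCurveInv X.eucl ε x)) 0 = 0

/-- The derivative `∇_v n (x)` of a field. -/
def grad {p : ℕ} (n : Pt p → R3) (v : Pt p) (x : Pt p) : R3 := fderiv ℝ n x v

/-- The reduced space `P_μ = (J^G)⁻¹(μ)/G_μ`, realized as the set of the fields `n = -ψ μ`,
that is, of the second components of the points `(ψ, -ψ μ)` of `(J^G)⁻¹(μ)`. -/
def reducedSpace {p : ℕ} (μ : DualField p) : Set (Pt p → R3) :=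
  {n | ∃ q : Phase p, JG q = μ ∧ q.mom.1 = n}

/-- The action of `SE(p)` on fields, `(h · n)(x) = n(h⁻¹ x)`. -/
def act {p : ℕ} (h : SE p) (n : Pt p → R3) : Pt p → R3 := fun x => n (h⁻¹ • x)

/-- `J : P_μ → se(p)^*` is the reduced momentum map: `J^{H_μ} - μ̂` on `(J^G)⁻¹(μ)`, passed to
the quotients `P_μ` and `𝔥_μ/𝔤_μ = se(p)`. -/
def IsReducedMomentum {p : ℕ} (μ : DualField p) (J : (Pt p → R3) → Module.Dual ℝ (se p)) : Prop :=
  ∀ q : Phase p, JG q = μ → ∀ X : LieElt p, InLieHmu μ X →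
    J q.mom.1 X.eucl = momentum X q - pairing μ X.fld

/-- The nonequivariance cocycle `⟨σ(h), v⟩ = ⟨J(h n) - CoAd_h J(n), v⟩`, computed at `n`. -/
def sigma {p : ℕ} (J : (Pt p → R3) → Module.Dual ℝ (se p)) (n : Pt p → R3) (h : SE p)
    (v : se p) : ℝ :=
  J (act h n) v - J n (seAd h⁻¹ v)

/-- The bilinear form `-∫ μ · (∇_{Ω₁x+a₁} μ × ∇_{Ω₂x+a₂} μ)` on `se(p)`. -/
def Sigma2 {p : ℕ} (μ : Pt p → R3) (v w : se p) : ℝ :=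
  -∫ x, μ x ⬝ᵥ (grad μ (seField v x) x ⨯₃ grad μ (seField w x) x)

/-- The degree, `(1/4π) ∫ n · (∂n/∂x × ∂n/∂y)`, for `p = 2`. -/
def deg (n : Pt 2 → R3) : ℝ :=
  1 / (4 * Real.pi) *
    ∫ x, n x ⬝ᵥ (grad n (Pi.single 0 1) x ⨯₃ grad n (Pi.single 1 1) x)

/-- `ω₀(a, b) = aᵗ J b`. -/
def omega0 (a b : Pt 2) : ℝ := a ⬝ᵥ (!![0, 1; -1, 0] *ᵥ b)

/-- Spherical symmetry up to rotations of the values: each rotation of space changes the field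
by a constant rotation only. -/
def IsSphericallySymmetric {p : ℕ} (μ : Pt p → R3) : Prop :=
  ∀ U : SO p, ∃ R : SO 3, ∀ x, μ (U.1 *ᵥ x) = R.1 *ᵥ μ x

/-- Spherical symmetry in the strict sense: the field is a function of `|x|` only. -/
def IsRadial {p : ℕ} (μ : Pt p → R3) : Prop :=
  ∃ f : ℝ → R3, ∀ x, μ x = f (Real.sqrt (x ⬝ᵥ x))

/-- The Papanicolaou–Tomaras momenta
`P_i(n) = (1/(p-1)) ∫ n · (∂n/∂x^i × x^j ∂n/∂x^j)`. -/
def PT {p : ℕ} (i : Fin p) (n : Pt p → R3) : ℝ :=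
  1 / ((p : ℝ) - 1) * ∫ x, n x ⬝ᵥ (grad n (Pi.single i 1) x ⨯₃ grad n x x)

/-- The angular analogue `(1/p) ∫ n · (∇_{Ωx} n × x^j ∂n/∂x^j)`. -/
def PTrot {p : ℕ} (Ω : so p) (n : Pt p → R3) : ℝ :=
  1 / (p : ℝ) * ∫ x, n x ⬝ᵥ (grad n (Ω.1 *ᵥ x) x ⨯₃ grad n x x)

/-! ### The Lie–Poisson bracket -/

/-- Smooth variations `c` of `n` inside a set `S` of fields, fixed outside a compact set. -/
structure IsVariation {p : ℕ} (S : Set (Pt p → R3)) (n : Pt p → R3) (c : ℝ → Pt p → R3) :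
    Prop where
  mem : ∀ t, c t ∈ S
  at_zero : c 0 = n
  smooth : ContDiff ℝ ∞ fun z : ℝ × Pt p => c z.1 z.2
  supp : ∃ K : Set (Pt p), IsCompact K ∧ ∀ t, ∀ x ∉ K, c t x = n x

/-- `D = δF/δn` is the functional derivative at `n` of the functional `F` on a set `S` of fields
of unit vectors (normalized to be tangent to the sphere, `D · n = 0`). -/
structure HasFunctionalDeriv {p : ℕ} (S : Set (Pt p → R3)) (F : (Pt p → R3) → ℝ)
    (n : Pt p → R3) (D : Pt p → R3) : Prop where
  smooth : ContDiff ℝ ∞ D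
  tangent : ∀ x, D x ⬝ᵥ n x = 0
  deriv : ∀ c, IsVariation S n c →
    HasDerivAt (fun t => F (c t)) (∫ x, D x ⬝ᵥ deriv (fun t => c t x) 0) 0

/-- The functionals `F` and `K` on `S` have functional derivatives at `n`, and their (`+`)
Lie–Poisson bracket `{F, K}(n) = ∫ n · (δF/δn × δK/δn)` has the value `b`. With this bracket
Hamilton's equation for `E` is the Landau–Lifshitz equation `∂n/∂t = -n × δE/δn`. -/
def HasPoissonBracket {p : ℕ} (S : Set (Pt p → R3)) (F K : (Pt p → R3) → ℝ)
    (n : Pt p → R3) (b : ℝ) : Prop :=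
  (∃ D, HasFunctionalDeriv S F n D) ∧ (∃ D, HasFunctionalDeriv S K n D) ∧
  ∀ DF DK, HasFunctionalDeriv S F n DF → HasFunctionalDeriv S K n DK →
    ∫ x, n x ⬝ᵥ (DF x ⨯₃ DK x) = b

/-- `F` generates, by `∂n/∂t = -n × δF/δn`, the infinitesimal action
`n ↦ -∇_{Ωx+a} n` of `(Ω, a)` on `S`. -/
def Generates {p : ℕ} (S : Set (Pt p → R3)) (F : (Pt p → R3) → ℝ) (v : se p) : Prop :=
  ∀ n ∈ S, ∃ D, HasFunctionalDeriv S F n D ∧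
    ∀ x, -(n x ⨯₃ D x) = -grad n (seField v x) x

end

end LandauLifshitz

open LandauLifshitz

namespace LandauLifshitz

open Topology

/-! ### Vector algebra in `ℝ³` -/

/-! On a point `(ψ, n)` of the level set, `n = -ψ μ`, the momentum minus the pairing with `μ` is the
integral over `ℝ^p` of the one-form `α = -n · (dψ ψ⁻¹)` evaluated on the affine field `Ω x + a`
(`momentum_sub_pairing`). Two facts about `α` carry the theorem. By the Maurer–Cartan equation, `dα
= n · (dn × dn) + μ · (dμ × dμ)`, which no longer involves `ψ` (`exterior_momForm`). And `α` is a
sum of terms `f dh` with `dh` compactly supported, so it can be integrated by parts along affine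
fields (`integral_sum_wedge`).

Contracting `dα` with the Euler field `x` recovers the integral of `α` along `Ω x + a`; this
homotopy formula (`integral_homotopy`) produces the factors `1/p` and `1/(p-1)`. With `M = ptMom`,
the Papanicolaou–Tomaras functional, it gives `J(n) = M(n) + M(μ)`. Hence `J` descends to the fields
`n`, and the cocycle is `M(μ) - M(hμ)`, independent of `n`. Contracting `dα` with two Euclidean
fields, which are divergence free, gives the Poisson relation instead.

The form `n · (dn × dn)` changes by an exact form when the unit field `n` varies, so the same
homotopy formula yields `δM/δn = ∇n × n` (`hasFDerivAt_ptMom`). This gives the generated flow, the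
bracket and, applied to moving copies of `μ`, the infinitesimal cocycle.

That every Euclidean motion lifts to `H_μ` is a connectedness argument (`lifts_all`): nearby copies
of `μ` are nowhere antipodal, so a canonical smooth rotation carries one to the other, and rotations
are joined to the identity through products of pairs of reflections. -/

lemma dot3 (a b : R3) : a ⬝ᵥ b = a 0 * b 0 + a 1 * b 1 + a 2 * b 2 := by
  simp [dotProduct, Fin.sum_univ_three]

lemma cross3_0 (a b : R3) : (a ⨯₃ b) 0 = a 1 * b 2 - a 2 * b 1 := by simp [cross_apply]
lemma cross3_1 (a b : R3) : (a ⨯₃ b) 1 = a 2 * b 0 - a 0 * b 2 := by simp [cross_apply]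
lemma cross3_2 (a b : R3) : (a ⨯₃ b) 2 = a 0 * b 1 - a 1 * b 0 := by simp [cross_apply]

lemma ext3 {a b : R3} (h0 : a 0 = b 0) (h1 : a 1 = b 1) (h2 : a 2 = b 2) : a = b := by
  funext i; fin_cases i <;> assumption

lemma mulVec3 (M : Matrix (Fin 3) (Fin 3) ℝ) (v : R3) (i : Fin 3) :
    (M *ᵥ v) i = M i 0 * v 0 + M i 1 * v 1 + M i 2 * v 2 := by
  simp [Matrix.mulVec, dot3]

lemma hat_mulVec (v w : R3) : hat v *ᵥ w = v ⨯₃ w := by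
  refine ext3 ?_ ?_ ?_ <;> rw [mulVec3] <;>
    simp [hat, cross3_0, cross3_1, cross3_2] <;> ring

/-- The vector `(n × d) × n` is the part of `d` orthogonal to the unit vector `n`. -/
lemma cross_cross_unit {n d : R3} (hn : n ⬝ᵥ n = 1) (hd : d ⬝ᵥ n = 0) :
    (n ⨯₃ d) ⨯₃ n = d := by
  rw [dot3] at hn hd
  refine ext3 ?_ ?_ ?_ <;> simp only [cross3_0, cross3_1, cross3_2]
  · linear_combination d 0 * hn - n 0 * hd
  · linear_combination d 1 * hn - n 1 * hd
  · linear_combination d 2 * hn - n 2 * hd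

/-- Used to see that the functional derivative `∇n × n` generates `-∇n` under the Landau–Lifshitz
equation. -/
lemma unit_cross_cross {n d : R3} (hn : n ⬝ᵥ n = 1) (hd : d ⬝ᵥ n = 0) :
    n ⨯₃ (d ⨯₃ n) = d := by
  rw [dot3] at hn hd
  refine ext3 ?_ ?_ ?_ <;> simp only [cross3_0, cross3_1, cross3_2]
  · linear_combination d 0 * hn - n 0 * hd
  · linear_combination d 1 * hn - n 1 * hd
  · linear_combination d 2 * hn - n 2 * hd

/-- `n · ((a × n) × (b × n)) = n · (a × b)` for a unit vector `n`. -/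
lemma triple_cross_unit {n : R3} (hn : n ⬝ᵥ n = 1) (a b : R3) :
    n ⬝ᵥ ((a ⨯₃ n) ⨯₃ (b ⨯₃ n)) = n ⬝ᵥ (a ⨯₃ b) := by
  rw [dot3] at hn
  simp only [dot3, cross3_0, cross3_1, cross3_2]
  linear_combination (n 0 * (a 1 * b 2 - a 2 * b 1) + n 1 * (a 2 * b 0 - a 0 * b 2)
    + n 2 * (a 0 * b 1 - a 1 * b 0)) * hn

/-- Three vectors orthogonal to a common unit vector are coplanar. -/
lemma triple_eq_zero_of_orthogonal {n a b c : R3} (hn : n ⬝ᵥ n = 1) (ha : a ⬝ᵥ n = 0)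
    (hb : b ⬝ᵥ n = 0) (hc : c ⬝ᵥ n = 0) : a ⬝ᵥ (b ⨯₃ c) = 0 := by
  rw [dot3] at hn ha hb hc
  simp only [dot3, cross3_0, cross3_1, cross3_2]
  linear_combination
    -(a 0 * (b 1 * c 2 - b 2 * c 1) + a 1 * (b 2 * c 0 - b 0 * c 2)
      + a 2 * (b 0 * c 1 - b 1 * c 0)) * hn
    + (n 0 * (b 1 * c 2 - b 2 * c 1) + n 1 * (b 2 * c 0 - b 0 * c 2)
      + n 2 * (b 0 * c 1 - b 1 * c 0)) * ha
    + (n 0 * (c 1 * a 2 - c 2 * a 1) + n 1 * (c 2 * a 0 - c 0 * a 2)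
      + n 2 * (c 0 * a 1 - c 1 * a 0)) * hb
    + (n 0 * (a 1 * b 2 - a 2 * b 1) + n 1 * (a 2 * b 0 - a 0 * b 2)
      + n 2 * (a 0 * b 1 - a 1 * b 0)) * hc

/-! ### Rotations -/

lemma SO.inv_val {q : ℕ} (A : SO q) : (A⁻¹).1 = A.1ᵀ := rfl

lemma SO.transpose_mul_self {q : ℕ} (A : SO q) : A.1ᵀ * A.1 = 1 := by
  rw [← SO.inv_val, ← SO.mul_val, inv_mul_cancel, SO.one_val]

lemma SO.mul_transpose_self {q : ℕ} (A : SO q) : A.1 * A.1ᵀ = 1 := by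
  rw [← SO.inv_val, ← SO.mul_val, mul_inv_cancel, SO.one_val]

lemma SO.det_eq_one {q : ℕ} (A : SO q) : A.1.det = 1 :=
  (Matrix.mem_specialOrthogonalGroup_iff.1 A.2).2

lemma SO.dot_mulVec_inv {q : ℕ} (A : SO q) (v w : Fin q → ℝ) :
    v ⬝ᵥ (A.1 *ᵥ w) = ((A⁻¹).1 *ᵥ v) ⬝ᵥ w := by
  rw [SO.inv_val, Matrix.mulVec_transpose, Matrix.dotProduct_mulVec]

lemma SO.dot_mulVec {q : ℕ} (A : SO q) (v w : Fin q → ℝ) :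
    (A.1 *ᵥ v) ⬝ᵥ (A.1 *ᵥ w) = v ⬝ᵥ w := by
  rw [SO.dot_mulVec_inv, SO.inv_mulVec_mulVec]

/-- With determinant one, the adjugate is the inverse, hence the transpose. For `q = 3` this
identifies the 2×2 minors with the entries, which is the compatibility with the cross product. -/
lemma SO.adjugate {q : ℕ} (A : SO q) : A.1.adjugate = A.1ᵀ := by
  have h := Matrix.mul_adjugate A.1
  rw [SO.det_eq_one, one_smul] at h
  calc A.1.adjugate = A.1ᵀ * A.1 * A.1.adjugate := by rw [SO.transpose_mul_self, one_mul]
    _ = A.1ᵀ := by rw [mul_assoc, h, mul_one]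

/-- Rotations respect the cross product. -/
lemma SO.cross_mulVec (R : SO 3) (a b : R3) :
    (R.1 *ᵥ a) ⨯₃ (R.1 *ᵥ b) = R.1 *ᵥ (a ⨯₃ b) := by
  have h : ∀ i j, R.1.adjugate i j = R.1 j i := fun i j => by rw [SO.adjugate]; rfl
  simp only [Matrix.adjugate_fin_three] at h
  have h00 := h 0 0
  have h01 := h 0 1
  have h02 := h 0 2
  have h10 := h 1 0
  have h11 := h 1 1
  have h12 := h 1 2
  have h20 := h 2 0
  have h21 := h 2 1
  have h22 := h 2 2
  simp at h00 h01 h02 h10 h11 h12 h20 h21 h22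
  refine ext3 ?_ ?_ ?_ <;> simp only [cross3_0, cross3_1, cross3_2, mulVec3]
  · linear_combination (a 1 * b 2 - a 2 * b 1) * h00 + (a 2 * b 0 - a 0 * b 2) * h10
      + (a 0 * b 1 - a 1 * b 0) * h20
  · linear_combination (a 1 * b 2 - a 2 * b 1) * h01 + (a 2 * b 0 - a 0 * b 2) * h11
      + (a 0 * b 1 - a 1 * b 0) * h21
  · linear_combination (a 1 * b 2 - a 2 * b 1) * h02 + (a 2 * b 0 - a 0 * b 2) * h12
      + (a 0 * b 1 - a 1 * b 0) * h22

lemma SO.triple_mulVec (R : SO 3) (a b c : R3) :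
    (R.1 *ᵥ a) ⬝ᵥ ((R.1 *ᵥ b) ⨯₃ (R.1 *ᵥ c)) = a ⬝ᵥ (b ⨯₃ c) := by
  rw [SO.cross_mulVec, SO.dot_mulVec]

lemma vee_hat (v : R3) : vee (hat v) = v := by
  refine ext3 ?_ ?_ ?_ <;> simp [vee, hat]

lemma SO.mul_hat_mul_inv (R : SO 3) (v : R3) :
    R.1 * hat v * (R⁻¹).1 = hat (R.1 *ᵥ v) := by
  refine Matrix.ext_of_mulVec_single fun i => ?_
  rw [← Matrix.mulVec_mulVec, ← Matrix.mulVec_mulVec, hat_mulVec, hat_mulVec,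
    ← SO.cross_mulVec, SO.mulVec_inv_mulVec]

/-! ### The Cayley parametrization of rotations -/

/-- The matrix of the rotation with the Rodrigues vector `a`. -/
noncomputable def cayMatrix (a : R3) : Matrix (Fin 3) (Fin 3) ℝ :=
  (1 + a ⬝ᵥ a)⁻¹ • ((1 - a ⬝ᵥ a) • 1 + (2 : ℝ) • Matrix.vecMulVec a a + (2 : ℝ) • hat a)

lemma one_add_dot_self_pos (a : R3) : 0 < 1 + a ⬝ᵥ a := by
  rw [dot3]; nlinarith [sq_nonneg (a 0), sq_nonneg (a 1), sq_nonneg (a 2)]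

lemma cayMatrix_mulVec (a v : R3) :
    cayMatrix a *ᵥ v =
      (1 + a ⬝ᵥ a)⁻¹ • ((1 - a ⬝ᵥ a) • v + (2 * (a ⬝ᵥ v)) • a + (2 : ℝ) • (a ⨯₃ v)) := by
  simp only [cayMatrix, Matrix.smul_mulVec, Matrix.add_mulVec, Matrix.one_mulVec, hat_mulVec,
    Matrix.vecMulVec_mulVec]
  simp [mul_comm, smul_smul]

/-- The rational parametrization reduces this to polynomial identities after clearing `1 + a · a`,
and makes smooth dependence on `a` immediate. -/
lemma cayMatrix_mem (a : R3) : cayMatrix a ∈ Matrix.specialOrthogonalGroup (Fin 3) ℝ := by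
  have h := (one_add_dot_self_pos a).ne'
  rw [Matrix.mem_specialOrthogonalGroup_iff, Matrix.mem_orthogonalGroup_iff]
  rw [dot3] at h
  constructor
  · ext i j
    fin_cases i <;> fin_cases j <;>
      simp [cayMatrix, Matrix.mul_apply, Fin.sum_univ_three, hat, Matrix.vecMulVec_apply, dot3] <;>
      field_simp <;> ring
  · simp [cayMatrix, Matrix.det_fin_three, hat, Matrix.vecMulVec_apply, dot3]
    field_simp
    ring

/-- The rotation with the Rodrigues vector `a`. -/
noncomputable def cay (a : R3) : SO 3 := ⟨cayMatrix a, cayMatrix_mem a⟩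

lemma cay_zero : cay 0 = 1 := by
  refine Subtype.ext (Matrix.ext_of_mulVec_single fun i => ?_)
  change cayMatrix 0 *ᵥ _ = (1 : Matrix (Fin 3) (Fin 3) ℝ) *ᵥ _
  rw [cayMatrix_mulVec, Matrix.one_mulVec]
  simp

/-- A rotation carrying the unit vector `a` to the unit vector `b ≠ -a`. -/
lemma cay_mulVec_eq {a b : R3} (ha : a ⬝ᵥ a = 1) (hb : b ⬝ᵥ b = 1) (hab : -1 < a ⬝ᵥ b) :
    (cay ((1 + a ⬝ᵥ b)⁻¹ • (a ⨯₃ b))).1 *ᵥ a = b := by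
  change cayMatrix _ *ᵥ a = b
  -- If `θ` is the angle from `a` to `b`, the chosen Rodrigues vector has length `sin θ / (1 + cos
  -- θ) = tan (θ/2)` along the axis `a × b`.
  have hs : (1 + a ⬝ᵥ b) ≠ 0 := by linarith
  set s := 1 + a ⬝ᵥ b with hsdef
  have h1 : (a ⨯₃ b) ⬝ᵥ (a ⨯₃ b) = s * (2 - s) := by
    rw [cross_dot_cross, ha, hb, dotProduct_comm b a]
    have : a ⬝ᵥ b = s - 1 := by rw [hsdef]; ring
    rw [this]; ring
  have h2 : (a ⨯₃ b) ⬝ᵥ a = 0 := by rw [dotProduct_comm, dot_self_cross]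
  have h3 : (a ⨯₃ b) ⨯₃ a = b - (s - 1) • a := by
    rw [hsdef]
    rw [dot3] at ha
    refine ext3 ?_ ?_ ?_ <;>
      simp only [cross3_0, cross3_1, cross3_2, dot3, Pi.sub_apply, Pi.smul_apply, smul_eq_mul]
    · linear_combination b 0 * ha
    · linear_combination b 1 * ha
    · linear_combination b 2 * ha
  rw [cayMatrix_mulVec]
  simp only [smul_dotProduct, dotProduct_smul, h1, h2, map_smul, LinearMap.smul_apply, h3,
    smul_eq_mul, mul_zero, zero_smul, add_zero]
  have e1 : 1 + s⁻¹ * (s⁻¹ * (s * (2 - s))) = 2 * s⁻¹ := by field_simp; ring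
  have e2 : 1 - s⁻¹ * (s⁻¹ * (s * (2 - s))) = 2 * s⁻¹ * (s - 1) := by field_simp; ring
  rw [e1, e2]
  ext i
  simp only [Pi.smul_apply, Pi.add_apply, Pi.sub_apply, smul_eq_mul]
  field_simp
  ring

lemma contDiff_dot {E : Type*} [NormedAddCommGroup E] [NormedSpace ℝ E] {f g : E → R3}
    {k : WithTop ℕ∞} (hf : ContDiff ℝ k f) (hg : ContDiff ℝ k g) :
    ContDiff ℝ k fun x => f x ⬝ᵥ g x := by
  simp only [dot3]
  rw [contDiff_pi] at hf hg
  exact (((hf 0).mul (hg 0)).add ((hf 1).mul (hg 1))).add ((hf 2).mul (hg 2))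

lemma contDiff_cross {E : Type*} [NormedAddCommGroup E] [NormedSpace ℝ E] {f g : E → R3}
    {k : WithTop ℕ∞} (hf : ContDiff ℝ k f) (hg : ContDiff ℝ k g) :
    ContDiff ℝ k fun x => f x ⨯₃ g x := by
  rw [contDiff_pi] at hf hg ⊢
  intro i
  fin_cases i
  · simpa only [Fin.zero_eta, cross3_0] using ((hf 1).mul (hg 2)).sub ((hf 2).mul (hg 1))
  · simpa only [Fin.mk_one, cross3_1] using ((hf 2).mul (hg 0)).sub ((hf 0).mul (hg 2))
  · simpa only [Fin.reduceFinMk, cross3_2] using ((hf 0).mul (hg 1)).sub ((hf 1).mul (hg 0))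

lemma contDiff_cay {E : Type*} [NormedAddCommGroup E] [NormedSpace ℝ E] {f : E → R3}
    {k : WithTop ℕ∞} (hf : ContDiff ℝ k f) (i j : Fin 3) :
    ContDiff ℝ k fun x => (cay (f x)).1 i j := by
  have hd := contDiff_dot hf hf
  have hf' := contDiff_pi.1 hf
  change ContDiff ℝ k fun x => cayMatrix (f x) i j
  simp only [cayMatrix, Matrix.smul_apply, Matrix.add_apply, smul_eq_mul, Matrix.vecMulVec_apply]
  have hh : ContDiff ℝ k fun x => hat (f x) i j := by
    fin_cases i <;> fin_cases j <;> simp [hat] <;> first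
      | exact contDiff_const
      | exact hf' _
      | exact (hf' _).neg
  exact ((contDiff_const.add hd).inv fun x => (one_add_dot_self_pos (f x)).ne').mul
    ((((contDiff_const.sub hd).mul contDiff_const).add
      (contDiff_const.mul ((hf' i).mul (hf' j)))).add (contDiff_const.mul hh))

lemma two_le_infty : (2 : WithTop ℕ∞) ≤ ∞ :=
  WithTop.coe_le_coe.2 (le_top : (2 : ℕ∞) ≤ ⊤)

/-! ### Integration by parts along affine vector fields -/

lemma contDiff_affine {p : ℕ} {k : WithTop ℕ∞} (M : Matrix (Fin p) (Fin p) ℝ) (a : Pt p) :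
    ContDiff ℝ k fun x : Pt p => M *ᵥ x + a :=
  (Matrix.mulVecLin M).toContinuousLinearMap.contDiff.add contDiff_const

lemma hasFDerivAt_affine {p : ℕ} (M : Matrix (Fin p) (Fin p) ℝ) (a x : Pt p) :
    HasFDerivAt (fun x : Pt p => M *ᵥ x + a) (Matrix.mulVecLin M).toContinuousLinearMap x :=
  (Matrix.mulVecLin M).toContinuousLinearMap.hasFDerivAt.add_const a

lemma fderiv_eq_sum {p : ℕ} (f : Pt p → ℝ) (x u : Pt p) :
    fderiv ℝ f x u = ∑ i, u i * fderiv ℝ f x (Pi.single i 1) := by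
  conv_lhs => rw [pi_eq_sum_univ' u, map_sum]
  refine Finset.sum_congr rfl fun i _ => ?_
  rw [map_smul, smul_eq_mul]

/-- The divergence theorem for the affine vector field `x ↦ M x + a`. -/
lemma integral_fderiv_affine {p : ℕ} {f : Pt p → ℝ} (hf : ContDiff ℝ 1 f)
    (hc : HasCompactSupport f) (M : Matrix (Fin p) (Fin p) ℝ) (a : Pt p) :
    ∫ x, fderiv ℝ f x (M *ᵥ x + a) = -M.trace * ∫ x, f x := by
  have hcoord : ∀ i, ContDiff ℝ 1 fun x : Pt p => (M *ᵥ x + a) i :=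
    fun i => contDiff_pi.1 (contDiff_affine M a) i
  have hf' : ∀ i, Continuous fun x => fderiv ℝ f x (Pi.single i 1) :=
    fun i => (hf.continuous_fderiv one_ne_zero).clm_apply continuous_const
  have hfc : ∀ i, HasCompactSupport fun x => fderiv ℝ f x (Pi.single i 1) :=
    fun i => hc.fderiv_apply ℝ _
  have hd : ∀ i x, fderiv ℝ (fun x : Pt p => (M *ᵥ x + a) i) x (Pi.single i 1) = M i i := by
    intro i x
    have := (hasFDerivAt_pi'.1 (hasFDerivAt_affine M a x)) i
    rw [this.fderiv]
    simp
  -- Integration by parts in the `i`-th coordinate: the `i`-th component of the field has `i`-th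
  -- partial derivative `M i i`, and these add up to the trace.
  have key : ∀ i, ∫ x, (M *ᵥ x + a) i * fderiv ℝ f x (Pi.single i 1) = -M i i * ∫ x, f x := by
    intro i
    rw [integral_mul_fderiv_eq_neg_fderiv_mul_of_integrable]
    · simp only [hd, integral_const_mul, neg_mul]
    · simp only [hd]
      exact (hf.continuous.integrable_of_hasCompactSupport hc).const_mul _
    · exact ((hcoord i).continuous.mul (hf' i)).integrable_of_hasCompactSupport (hfc i).mul_left
    · exact ((hcoord i).continuous.mul hf.continuous).integrable_of_hasCompactSupport hc.mul_left
    · exact fun x _ => (hcoord i).differentiable one_ne_zero x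
    · exact fun x _ => hf.differentiable one_ne_zero x
  simp only [fderiv_eq_sum f _ (M *ᵥ _ + a)]
  rw [integral_finsetSum]
  · simp only [key, ← Finset.sum_mul, Finset.sum_neg_distrib, Matrix.trace, Matrix.diag_apply]
  · exact fun i _ =>
      ((hcoord i).continuous.mul (hf' i)).integrable_of_hasCompactSupport (hfc i).mul_left

lemma contDiff_mul_fderiv_affine {p : ℕ} {f h : Pt p → ℝ} (hf : ContDiff ℝ ∞ f)
    (hh : ContDiff ℝ ∞ h) (N : Matrix (Fin p) (Fin p) ℝ) (b : Pt p) :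
    ContDiff ℝ ∞ fun x => f x * fderiv ℝ h x (N *ᵥ x + b) :=
  hf.mul ((hh.fderiv_right (by simp)).clm_apply (contDiff_affine N b))

/-- The compact support comes from `dh` alone; neither `f` nor the vector field needs to decay. -/
lemma integrable_mul_fderiv {p : ℕ} {f h : Pt p → ℝ} {v : Pt p → Pt p} (hf : Continuous f)
    (hh : ContDiff ℝ ∞ h) (hv : Continuous v) (hc : HasCompactSupport (fderiv ℝ h)) :
    Integrable fun x => f x * fderiv ℝ h x (v x) := by
  refine (hf.mul ((hh.continuous_fderiv (by simp)).clm_apply hv)).integrable_of_hasCompactSupport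
    (hc.mono fun x hx hx' => hx ?_)
  change f x * fderiv ℝ h x (v x) = 0
  rw [hx']; simp

lemma fderiv_mul_fderiv_affine {p : ℕ} {f h : Pt p → ℝ} (hf : ContDiff ℝ ∞ f)
    (hh : ContDiff ℝ ∞ h) (N : Matrix (Fin p) (Fin p) ℝ) (b x u : Pt p) :
    fderiv ℝ (fun x => f x * fderiv ℝ h x (N *ᵥ x + b)) x u =
      fderiv ℝ f x u * fderiv ℝ h x (N *ᵥ x + b) +
        f x * (fderiv ℝ (fderiv ℝ h) x u (N *ᵥ x + b) + fderiv ℝ h x (N *ᵥ u)) := by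
  have h1 : HasFDerivAt f (fderiv ℝ f x) x := (hf.differentiable (by simp) x).hasFDerivAt
  have h2 : HasFDerivAt (fderiv ℝ h) (fderiv ℝ (fderiv ℝ h) x) x :=
    (((hh.fderiv_right (m := ∞) (by simp)).differentiable (by simp)) x).hasFDerivAt
  rw [(h1.fun_mul (h2.clm_apply (hasFDerivAt_affine N b x))).fderiv]
  simp
  ring

/-- Integration of the two-form `df ∧ dh` over the affine vector fields `M x + a`, `N x + b`. -/
lemma integral_wedge {p : ℕ} {f h : Pt p → ℝ} (hf : ContDiff ℝ ∞ f) (hh : ContDiff ℝ ∞ h)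
    (hc : HasCompactSupport (fderiv ℝ h)) (M N : Matrix (Fin p) (Fin p) ℝ) (a b : Pt p) :
    ∫ x, (fderiv ℝ f x (M *ᵥ x + a) * fderiv ℝ h x (N *ᵥ x + b) -
        fderiv ℝ f x (N *ᵥ x + b) * fderiv ℝ h x (M *ᵥ x + a)) =
      ∫ x, f x * fderiv ℝ h x (N.trace • (M *ᵥ x + a) - M.trace • (N *ᵥ x + b) -
        (N *ᵥ (M *ᵥ x + a) - M *ᵥ (N *ᵥ x + b))) := by
  have aux : ∀ (M N : Matrix (Fin p) (Fin p) ℝ) (a b : Pt p),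
      -- The divergence theorem for the function `f dh(Y)` along the affine field `X`.
      ∫ x, fderiv ℝ (fun x => f x * fderiv ℝ h x (N *ᵥ x + b)) x (M *ᵥ x + a) =
        ∫ x, f x * fderiv ℝ h x (-M.trace • (N *ᵥ x + b)) := by
    intro M N a b
    rw [integral_fderiv_affine ((contDiff_mul_fderiv_affine hf hh N b).of_le (by simp))]
    · rw [← integral_const_mul]
      congr 1; funext x
      rw [map_smul, smul_eq_mul]; ring
    · refine hc.mono fun x hx hx' => hx ?_
      simp only at hx' ⊢
      rw [hx']; simp
  have hcont : ∀ (N : Matrix (Fin p) (Fin p) ℝ) (b : Pt p),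
      Continuous fun x : Pt p => N *ᵥ x + b := fun N b => (contDiff_affine (k := 0) N b).continuous
  have hinteg : ∀ (M N : Matrix (Fin p) (Fin p) ℝ) (a b : Pt p), Integrable
      fun x => fderiv ℝ (fun x => f x * fderiv ℝ h x (N *ᵥ x + b)) x (M *ᵥ x + a) := by
    intro M N a b
    have hs : HasCompactSupport fun x => f x * fderiv ℝ h x (N *ᵥ x + b) := by
      refine hc.mono fun x hx hx' => hx ?_
      simp only at hx' ⊢
      rw [hx']; simp
    refine Continuous.integrable_of_hasCompactSupport
      (((contDiff_mul_fderiv_affine hf hh N b).continuous_fderiv (by simp)).clm_apply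
        (hcont M a)) ((hs.fderiv ℝ).mono fun x hx hx' => hx ?_)
    simp only at hx' ⊢
    rw [hx']; simp
  have hZ : Continuous fun x : Pt p => N *ᵥ (M *ᵥ x + a) - M *ᵥ (N *ᵥ x + b) := by
    fun_prop
  -- Cartan's formula `d(f dh)(X, Y) = X(f dh(Y)) - Y(f dh(X)) - f dh([X, Y])` for affine `X`, `Y`;
  -- the Hessian terms of `h` cancel by symmetry.
  have e : ∀ x, fderiv ℝ f x (M *ᵥ x + a) * fderiv ℝ h x (N *ᵥ x + b) -
        fderiv ℝ f x (N *ᵥ x + b) * fderiv ℝ h x (M *ᵥ x + a) =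
      fderiv ℝ (fun x => f x * fderiv ℝ h x (N *ᵥ x + b)) x (M *ᵥ x + a) -
      fderiv ℝ (fun x => f x * fderiv ℝ h x (M *ᵥ x + a)) x (N *ᵥ x + b) -
      f x * fderiv ℝ h x (N *ᵥ (M *ᵥ x + a) - M *ᵥ (N *ᵥ x + b)) := by
    intro x
    rw [fderiv_mul_fderiv_affine hf hh, fderiv_mul_fderiv_affine hf hh,
      (hh.contDiffAt.isSymmSndFDerivAt (by simp [two_le_infty])).eq (M *ᵥ x + a) (N *ᵥ x + b), map_sub]
    ring
  simp only [e]
  have hinteg' : Integrable fun x =>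
      fderiv ℝ (fun x => f x * fderiv ℝ h x (N *ᵥ x + b)) x (M *ᵥ x + a) -
      fderiv ℝ (fun x => f x * fderiv ℝ h x (M *ᵥ x + a)) x (N *ᵥ x + b) :=
    (hinteg M N a b).sub (hinteg N M b a)
  rw [integral_sub hinteg'
      (integrable_mul_fderiv hf.continuous hh hZ hc),
    integral_sub (hinteg M N a b) (hinteg N M b a), aux, aux,
    ← integral_sub (integrable_mul_fderiv hf.continuous hh ((hcont N b).fun_const_smul _) hc)
      (integrable_mul_fderiv hf.continuous hh ((hcont M a).fun_const_smul _) hc),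
    ← integral_sub _ (integrable_mul_fderiv hf.continuous hh hZ hc)]
  · congr 1; funext x
    simp only [map_sub, map_smul, smul_eq_mul]
    ring
  · exact (integrable_mul_fderiv hf.continuous hh ((hcont N b).fun_const_smul _) hc).sub
      (integrable_mul_fderiv hf.continuous hh ((hcont M a).fun_const_smul _) hc)

/-- Integration of the two-form `∑ dfᵢ ∧ dhᵢ` over affine vector fields. -/
lemma integral_sum_wedge {p : ℕ} {ι : Type*} [Fintype ι] {f h : ι → Pt p → ℝ}
    (hf : ∀ i, ContDiff ℝ ∞ (f i)) (hh : ∀ i, ContDiff ℝ ∞ (h i))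
    (hc : ∀ i, HasCompactSupport (fderiv ℝ (h i))) (M N : Matrix (Fin p) (Fin p) ℝ)
    (a b : Pt p) :
    ∫ x, ∑ i, (fderiv ℝ (f i) x (M *ᵥ x + a) * fderiv ℝ (h i) x (N *ᵥ x + b) -
        fderiv ℝ (f i) x (N *ᵥ x + b) * fderiv ℝ (h i) x (M *ᵥ x + a)) =
      ∫ x, ∑ i, f i x * fderiv ℝ (h i) x (N.trace • (M *ᵥ x + a) - M.trace • (N *ᵥ x + b) -
        (N *ᵥ (M *ᵥ x + a) - M *ᵥ (N *ᵥ x + b))) := by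
  have hcont : ∀ (N : Matrix (Fin p) (Fin p) ℝ) (b : Pt p),
      Continuous fun x : Pt p => N *ᵥ x + b := fun N b => (contDiff_affine (k := 0) N b).continuous
  rw [integral_finsetSum, integral_finsetSum]
  · exact Finset.sum_congr rfl fun i _ => integral_wedge (hf i) (hh i) (hc i) M N a b
  · intro i _
    exact integrable_mul_fderiv (hf i).continuous (hh i)
      (by fun_prop) (hc i)
  · intro i _
    have hfc : ∀ (M : Matrix (Fin p) (Fin p) ℝ) (a : Pt p),
        Continuous fun x => fderiv ℝ (f i) x (M *ᵥ x + a) := fun M a =>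
      ((hf i).continuous_fderiv (by simp)).clm_apply (hcont M a)
    exact (integrable_mul_fderiv (hfc M a) (hh i) (hcont N b) (hc i)).sub
      (integrable_mul_fderiv (hfc N b) (hh i) (hcont M a) (hc i))

/-! ### Differentiation under the integral sign -/

/-- For parameters near `θ₀` all integrands vanish off one compact `K`. In a proper parameter space
the derivative is bounded on the product of a closed ball with `K`, so a constant on `K` dominates.
-/
lemma hasFDerivAt_integral_of_contDiff {p : ℕ} {E : Type*} [NormedAddCommGroup E]
    [NormedSpace ℝ E] [ProperSpace E] {g : E × Pt p → ℝ} (hg : ContDiff ℝ ∞ g) {θ₀ : E}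
    {K : Set (Pt p)} (hK : IsCompact K) (hgK : ∀ᶠ θ in 𝓝 θ₀, ∀ x ∉ K, g (θ, x) = 0) :
    ∃ L : E →L[ℝ] ℝ, HasFDerivAt (fun θ => ∫ x, g (θ, x)) L θ₀ ∧
      ∀ δ, L δ = ∫ x, fderiv ℝ g (θ₀, x) (δ, 0) := by
  obtain ⟨r, hr, hball⟩ := Metric.eventually_nhds_iff_ball.1 hgK
  let F' : E → Pt p → E →L[ℝ] ℝ := fun θ x =>
    (fderiv ℝ g (θ, x)).comp (ContinuousLinearMap.inl ℝ E (Pt p))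
  have hF'c : Continuous fun z : E × Pt p => F' z.1 z.2 :=
    (hg.continuous_fderiv (by simp)).clm_comp continuous_const
  have hF' : ∀ θ x, HasFDerivAt (fun θ => g (θ, x)) (F' θ x) θ := fun θ x =>
    ((hg.differentiable (by simp) (θ, x)).hasFDerivAt).comp θ
      (hasFDerivAt_prodMk_left θ x)
  have hzero : ∀ θ ∈ Metric.ball θ₀ r, ∀ x ∉ K, F' θ x = 0 := by
    intro θ hθ x hx
    have : (fun θ => g (θ, x)) =ᶠ[𝓝 θ] fun _ => 0 := by
      filter_upwards [Metric.isOpen_ball.mem_nhds hθ] with θ' hθ'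
      exact hball θ' hθ' x hx
    exact (hF' θ x).unique ((hasFDerivAt_const (0 : ℝ) θ).congr_of_eventuallyEq this)
  obtain ⟨C, hC⟩ := ((isCompact_closedBall θ₀ r).prod hK).exists_bound_of_continuousOn
    hF'c.continuousOn
  have hmem : θ₀ ∈ Metric.ball θ₀ r := Metric.mem_ball_self hr
  have hsec : ∀ θ, Continuous fun x => g (θ, x) := fun θ =>
    hg.continuous.comp (Continuous.prodMk_right θ)
  have hF'int : Integrable (F' θ₀) := by
    refine Continuous.integrable_of_hasCompactSupport (hF'c.comp (Continuous.prodMk_right θ₀))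
      (HasCompactSupport.intro hK (hzero θ₀ hmem))
  refine ⟨∫ x, F' θ₀ x, ?_, fun δ => ?_⟩
  · refine hasFDerivAt_integral_of_dominated_of_fderiv_le (s := Metric.ball θ₀ r)
      (bound := K.indicator fun _ => C) (F' := F') (Metric.ball_mem_nhds θ₀ hr) ?_ ?_ ?_ ?_ ?_ ?_
    · exact Filter.Eventually.of_forall fun θ => (hsec θ).aestronglyMeasurable
    · exact (hsec θ₀).integrable_of_hasCompactSupport
        (HasCompactSupport.intro hK (hball θ₀ hmem))
    · exact hF'int.aestronglyMeasurable
    · refine Filter.Eventually.of_forall fun x θ hθ => ?_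
      by_cases hx : x ∈ K
      · rw [Set.indicator_of_mem hx]
        exact hC (θ, x) ⟨Metric.ball_subset_closedBall hθ, hx⟩
      · rw [hzero θ hθ x hx, Set.indicator_of_notMem hx, norm_zero]
    · exact (integrable_indicator_iff hK.measurableSet).2
        (integrableOn_const hK.measure_lt_top.ne)
    · exact Filter.Eventually.of_forall fun x θ _ => hF' θ x
  · rw [ContinuousLinearMap.integral_apply hF'int]
    rfl

/-! ### Euclidean motions preserve Lebesgue measure -/

lemma measurePreserving_smul {p : ℕ} (h : SE p) : MeasurePreserving (fun x : Pt p => h • x) := by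
  have h1 : MeasurePreserving (fun x : Pt p => h.rot.1 *ᵥ x) := by
    refine ⟨(by fun_prop : Continuous fun x : Pt p => h.rot.1 *ᵥ x).measurable, ?_⟩
    have := Real.map_matrix_volume_pi_eq_smul_volume_pi (M := h.rot.1)
      (by rw [SO.det_eq_one]; exact one_ne_zero)
    rw [SO.det_eq_one] at this
    simpa [Matrix.toLin'_apply', Matrix.coe_mulVecLin] using this
  exact (measurePreserving_add_right volume h.trans).comp h1

lemma integral_smul {p : ℕ} (h : SE p) (f : Pt p → ℝ) : ∫ x, f (h • x) = ∫ x, f x := by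
  let e : Pt p ≃ₜ Pt p :=
    { toFun := fun x => h • x
      invFun := fun x => h⁻¹ • x
      left_inv := inv_smul_smul h
      right_inv := smul_inv_smul h
      continuous_toFun := (SE.contDiff_smul h).continuous
      continuous_invFun := (SE.contDiff_smul h⁻¹).continuous }
  exact (measurePreserving_smul h).integral_comp e.measurableEmbedding f

/-! ### Calculus of `ℝ³`-valued maps -/

/-- The cross product as a continuous bilinear map. -/
noncomputable def crossL : R3 →L[ℝ] R3 →L[ℝ] R3 :=
  LinearMap.toContinuousLinearMap
    ((LinearMap.toContinuousLinearMap : (R3 →ₗ[ℝ] R3) ≃ₗ[ℝ] _).toLinearMap ∘ₗ crossProduct)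

lemma crossL_apply (a b : R3) : crossL a b = a ⨯₃ b := rfl

/-- The inner product as a continuous bilinear map. -/
noncomputable def dotL : R3 →L[ℝ] R3 →L[ℝ] ℝ :=
  LinearMap.toContinuousLinearMap
    ((LinearMap.toContinuousLinearMap : (R3 →ₗ[ℝ] ℝ) ≃ₗ[ℝ] _).toLinearMap ∘ₗ
      dotProductBilin ℝ ℝ)

lemma dotL_apply (a b : R3) : dotL a b = a ⬝ᵥ b := rfl

section
variable {E : Type*} [NormedAddCommGroup E] [NormedSpace ℝ E] {f g : E → R3}
  {x : E}

lemma fderiv_dot (hf : DifferentiableAt ℝ f x) (hg : DifferentiableAt ℝ g x) (u : E) :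
    fderiv ℝ (fun x => f x ⬝ᵥ g x) x u = fderiv ℝ f x u ⬝ᵥ g x + f x ⬝ᵥ fderiv ℝ g x u := by
  have := (dotL.hasFDerivAt_of_bilinear hf.hasFDerivAt hg.hasFDerivAt).fderiv
  simp only [dotL_apply] at this
  rw [this]
  simp [dotL_apply, add_comm]

lemma differentiableAt_cross (hf : DifferentiableAt ℝ f x) (hg : DifferentiableAt ℝ g x) :
    DifferentiableAt ℝ (fun x => f x ⨯₃ g x) x :=
  (crossL.hasFDerivAt_of_bilinear hf.hasFDerivAt hg.hasFDerivAt).differentiableAt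

lemma fderiv_cross (hf : DifferentiableAt ℝ f x) (hg : DifferentiableAt ℝ g x) (u : E) :
    fderiv ℝ (fun x => f x ⨯₃ g x) x u = fderiv ℝ f x u ⨯₃ g x + f x ⨯₃ fderiv ℝ g x u := by
  have := (crossL.hasFDerivAt_of_bilinear hf.hasFDerivAt hg.hasFDerivAt).fderiv
  simp only [crossL_apply] at this
  rw [this]
  simp [crossL_apply, add_comm]

lemma fderiv_coord {ι : Type*} [Fintype ι] {f : E → ι → ℝ} (hf : DifferentiableAt ℝ f x) (i : ι)
    (u : E) : fderiv ℝ (fun x => f x i) x u = fderiv ℝ f x u i := by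
  rw [(hasFDerivAt_pi'.1 hf.hasFDerivAt i).fderiv]
  rfl

end

/-! ### Fields of unit vectors -/

/-- Smooth fields of unit vectors, constant outside a compact set. -/
structure UnitField {p : ℕ} (n : Pt p → R3) : Prop where
  smooth : ContDiff ℝ ∞ n
  unit : ∀ x, n x ⬝ᵥ n x = 1
  const_at_infty : ∃ (e : R3) (K : Set (Pt p)), IsCompact K ∧ ∀ x ∉ K, n x = e

lemma IsUnitField.unitField {p : ℕ} {μ : DualField p} (h : IsUnitField μ) : UnitField μ.1 :=
  ⟨μ.2, h.unit, h.const_at_infty⟩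

lemma fderiv_eq_zero_of_const {p : ℕ} {F : Type*} [NormedAddCommGroup F] [NormedSpace ℝ F]
    {n : Pt p → F} {e : F} {K : Set (Pt p)} (hK : IsCompact K) (h : ∀ x ∉ K, n x = e) :
    ∀ x ∉ K, fderiv ℝ n x = 0 := by
  intro x hx
  have : n =ᶠ[𝓝 x] fun _ => e := by
    filter_upwards [hK.isClosed.isOpen_compl.mem_nhds hx] with y hy using h y hy
  rw [this.fderiv_eq]
  simp

namespace UnitField

variable {p : ℕ} {n : Pt p → R3}

lemma differentiable (hn : UnitField n) : Differentiable ℝ n := hn.smooth.differentiable (by simp)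

lemma hasCompactSupport_fderiv (hn : UnitField n) : HasCompactSupport (fderiv ℝ n) := by
  obtain ⟨e, K, hK, h⟩ := hn.const_at_infty
  exact HasCompactSupport.intro hK (fderiv_eq_zero_of_const hK h)

lemma contDiff_coord (hn : UnitField n) (i : Fin 3) : ContDiff ℝ ∞ fun x => n x i :=
  contDiff_pi.1 hn.smooth i

lemma hasCompactSupport_fderiv_coord (hn : UnitField n) (i : Fin 3) :
    HasCompactSupport (fderiv ℝ fun x => n x i) := by
  refine hn.hasCompactSupport_fderiv.mono fun x hx hx' => hx ?_
  ext u
  rw [fderiv_coord (hn.differentiable x), hx']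
  rfl

lemma contDiff_grad (hn : UnitField n) {v : Pt p → Pt p} (hv : ContDiff ℝ ∞ v) :
    ContDiff ℝ ∞ fun x => grad n (v x) x :=
  (hn.smooth.fderiv_right (by simp)).clm_apply hv

lemma continuous_grad (hn : UnitField n) {v : Pt p → Pt p} (hv : Continuous v) :
    Continuous fun x => grad n (v x) x :=
  (hn.smooth.continuous_fderiv (by simp)).clm_apply hv

/-- Differentiate `n · n = 1`. -/
lemma grad_dot (hn : UnitField n) (u x : Pt p) : grad n u x ⬝ᵥ n x = 0 := by
  have h := fderiv_dot (hn.differentiable x) (hn.differentiable x) u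
  have h1 : (fun x => n x ⬝ᵥ n x) = fun _ => 1 := funext hn.unit
  rw [h1, fderiv_fun_const, dotProduct_comm (n x)] at h
  have h2 : (0 : Pt p → Pt p →L[ℝ] ℝ) x u = 0 := rfl
  rw [h2] at h
  unfold grad
  linarith

lemma hasCompactSupport_of_grad (hn : UnitField n) {F : Type*} [Zero F] {g : Pt p → F}
    (h : ∀ x, fderiv ℝ n x = 0 → g x = 0) : HasCompactSupport g :=
  hn.hasCompactSupport_fderiv.mono fun x hx hx' => hx (h x hx')

lemma continuous_cross {g h : Pt p → R3} (hg : Continuous g) (hh : Continuous h) :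
    Continuous fun x => g x ⨯₃ h x :=
  (crossL.continuous.comp hg).clm_apply hh

lemma integrable_triple (hn : UnitField n) {v w : Pt p → Pt p} (hv : Continuous v)
    (hw : Continuous w) :
    Integrable fun x => n x ⬝ᵥ (grad n (v x) x ⨯₃ grad n (w x) x) := by
  refine (Continuous.dotProduct hn.smooth.continuous (continuous_cross (hn.continuous_grad hv)
    (hn.continuous_grad hw))).integrable_of_hasCompactSupport
    (hn.hasCompactSupport_of_grad fun x hx => ?_)
  simp [grad, hx]

end UnitField

/-! ### The Papanicolaou–Tomaras functional -/

/-- The functional `L_Ω + aⁱ P_i`. -/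
noncomputable def ptMom {p : ℕ} (n : Pt p → R3) (v : se p) : ℝ :=
  PTrot v.1 n + ∑ i, v.2 i * PT i n

lemma grad_eq_sum {p : ℕ} (n : Pt p → R3) (a x : Pt p) :
    grad n a x = ∑ i, a i • grad n (Pi.single i 1) x := by
  unfold grad
  conv_lhs => rw [pi_eq_sum_univ' a, map_sum]
  exact Finset.sum_congr rfl fun i _ => map_smul _ _ _

lemma UnitField.sum_PT {p : ℕ} {n : Pt p → R3} (hn : UnitField n) (a : Pt p) :
    ∑ i, a i * PT i n =
      1 / ((p : ℝ) - 1) * ∫ x, n x ⬝ᵥ (grad n a x ⨯₃ grad n x x) := by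
  have h : ∀ x, n x ⬝ᵥ (grad n a x ⨯₃ grad n x x) =
      ∑ i, a i * (n x ⬝ᵥ (grad n (Pi.single i 1) x ⨯₃ grad n x x)) := by
    intro x
    rw [grad_eq_sum n a x, map_sum, LinearMap.sum_apply, dotProduct_sum]
    simp
  simp only [h]
  rw [integral_finsetSum]
  · simp only [integral_const_mul, PT, Finset.mul_sum]
    exact Finset.sum_congr rfl fun i _ => by ring
  · exact fun i _ => (hn.integrable_triple continuous_const continuous_id).const_mul _

lemma UnitField.ptMom_eq {p : ℕ} {n : Pt p → R3} (hn : UnitField n) (v : se p) :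
    ptMom n v = 1 / (p : ℝ) * (∫ x, n x ⬝ᵥ (grad n (v.1.1 *ᵥ x) x ⨯₃ grad n x x)) +
      1 / ((p : ℝ) - 1) * ∫ x, n x ⬝ᵥ (grad n v.2 x ⨯₃ grad n x x) := by
  rw [ptMom, hn.sum_PT, PTrot]

lemma trace_so {p : ℕ} (Ω : so p) : Ω.1.trace = 0 := by
  have h := congrArg Matrix.trace ((LieAlgebra.Orthogonal.mem_so (Fin p) ℝ Ω.1).1 Ω.2)
  rw [Matrix.trace_transpose, Matrix.trace_neg] at h
  linarith

/-- The homotopy formula: the integral of the one-form `∑ fᵢ dhᵢ` along `Ω x + a` in terms of its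
exterior derivative. -/
lemma integral_homotopy {p : ℕ} (hp : 2 ≤ p) {ι : Type*} [Fintype ι] {f h : ι → Pt p → ℝ}
    (hf : ∀ i, ContDiff ℝ ∞ (f i)) (hh : ∀ i, ContDiff ℝ ∞ (h i))
    (hc : ∀ i, HasCompactSupport (fderiv ℝ (h i))) (v : se p) :
    1 / (p : ℝ) * (∫ x, ∑ i, (fderiv ℝ (f i) x (v.1.1 *ᵥ x) * fderiv ℝ (h i) x x -
        fderiv ℝ (f i) x x * fderiv ℝ (h i) x (v.1.1 *ᵥ x))) +
      1 / ((p : ℝ) - 1) * ∫ x, ∑ i, (fderiv ℝ (f i) x v.2 * fderiv ℝ (h i) x x -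
        fderiv ℝ (f i) x x * fderiv ℝ (h i) x v.2) =
      ∫ x, ∑ i, f i x * fderiv ℝ (h i) x (seField v x) := by
  have hp1 : (p : ℝ) ≠ 0 := by positivity
  have hp2 : (p : ℝ) - 1 ≠ 0 := by
    have : (2 : ℝ) ≤ p := by exact_mod_cast hp
    linarith
  -- The second field is the Euler field, of divergence `p`. It commutes with `Ω x`, leaving the
  -- factor `p`; its bracket with the constant field `a` is `a` up to sign, leaving `p - 1`, which
  -- is nonzero because `2 ≤ p`.
  have h1 := integral_sum_wedge hf hh hc v.1.1 1 0 0
  have h2 := integral_sum_wedge hf hh hc 0 1 v.2 0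
  simp only [add_zero, Matrix.one_mulVec, trace_so, zero_smul, sub_zero, sub_self,
    Matrix.trace_one, Fintype.card_fin, Matrix.zero_mulVec, zero_add, Matrix.trace_zero,
    map_smul, smul_eq_mul, map_sub] at h1 h2
  rw [h1, h2, ← integral_const_mul, ← integral_const_mul, ← integral_add]
  · congr 1; funext x
    rw [Finset.mul_sum, Finset.mul_sum, ← Finset.sum_add_distrib]
    refine Finset.sum_congr rfl fun i _ => ?_
    rw [seField, map_add]
    field_simp
  · refine (integrable_finsetSum _ fun i _ => ?_).const_mul _
    have : Continuous fun x : Pt p => v.1.1 *ᵥ x := by fun_prop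
    simpa only [mul_assoc, mul_comm, mul_left_comm] using
      (integrable_mul_fderiv (hf i).continuous (hh i) this (hc i)).const_mul (p : ℝ)
  · refine (integrable_finsetSum _ fun i _ => ?_).const_mul _
    have := (integrable_mul_fderiv (hf i).continuous (hh i)
      (continuous_const (y := v.2)) (hc i)).const_mul ((p : ℝ) - 1)
    refine this.congr (Filter.Eventually.of_forall fun x => ?_)
    simp only
    ring

/-! ### The first variation -/

/-- The two-form `n · (dn × dn)` varies by an exact form when the unit vector `n` varies. Here `a`
and `b` are derivatives of `n`, `m` is the variation, and `m₁`, `m₂` are the derivatives of `m`. -/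
lemma variation_identity {n m a b : R3} (m₁ m₂ : R3) (hn : n ⬝ᵥ n = 1) (hm : m ⬝ᵥ n = 0)
    (ha : a ⬝ᵥ n = 0) (hb : b ⬝ᵥ n = 0) :
    m ⬝ᵥ (a ⨯₃ b) + n ⬝ᵥ (m₁ ⨯₃ b) + n ⬝ᵥ (a ⨯₃ m₂) =
      (a ⨯₃ m + n ⨯₃ m₁) ⬝ᵥ b - (b ⨯₃ m + n ⨯₃ m₂) ⬝ᵥ a := by
  have h := triple_eq_zero_of_orthogonal hn hm ha hb
  simp only [dot3, cross3_0, cross3_1, cross3_2, Pi.add_apply] at h ⊢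
  -- The two sides differ by three times `m · (a × b)`, which vanishes because the three vectors are
  -- tangent to the sphere at `n`.
  linear_combination 3 * h

section Variation

variable {p : ℕ} {E : Type*} [NormedAddCommGroup E] [NormedSpace ℝ E] {c : E × Pt p → R3}

lemma grad_section (hc : ContDiff ℝ ∞ c) (θ : E) (u x : Pt p) :
    grad (fun x => c (θ, x)) u x = fderiv ℝ c (θ, x) (0, u) := by
  have h : HasFDerivAt (fun x => c (θ, x)) _ x :=
    ((hc.differentiable (by simp) (θ, x)).hasFDerivAt).comp x (hasFDerivAt_prodMk_right θ x)
  unfold grad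
  rw [HasFDerivAt.fderiv h]
  rfl

/-- The integrand of the Papanicolaou–Tomaras functional for a family of fields. -/
noncomputable def ptDensity (c : E × Pt p → R3) (M : Matrix (Fin p) (Fin p) ℝ) (a : Pt p)
    (z : E × Pt p) : ℝ :=
  c z ⬝ᵥ (fderiv ℝ c z (0, M *ᵥ z.2 + a) ⨯₃ fderiv ℝ c z (0, z.2))

lemma contDiff_partial (hc : ContDiff ℝ ∞ c) (M : Matrix (Fin p) (Fin p) ℝ) (a : Pt p) :
    ContDiff ℝ ∞ fun z : E × Pt p => fderiv ℝ c z (0, M *ᵥ z.2 + a) :=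
  (hc.fderiv_right (by simp)).clm_apply
    (contDiff_const.prodMk ((contDiff_affine M a).comp contDiff_snd))

lemma fderiv_partial (hc : ContDiff ℝ ∞ c) (M : Matrix (Fin p) (Fin p) ℝ) (a : Pt p)
    (z : E × Pt p) (δ : E) :
    fderiv ℝ (fun z : E × Pt p => fderiv ℝ c z (0, M *ᵥ z.2 + a)) z (δ, 0) =
      fderiv ℝ (fderiv ℝ c) z (δ, 0) (0, M *ᵥ z.2 + a) := by
  have h1 : HasFDerivAt (fderiv ℝ c) (fderiv ℝ (fderiv ℝ c) z) z :=
    (((hc.fderiv_right (m := ∞) (by simp)).differentiable (by simp)) z).hasFDerivAt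
  have h2 : HasFDerivAt (fun z : E × Pt p => ((0 : E), M *ᵥ z.2 + a)) _ z :=
    (hasFDerivAt_const (0 : E) z).prodMk ((hasFDerivAt_affine M a z.2).comp z hasFDerivAt_snd)
  rw [(h1.clm_apply h2).fderiv]
  have h0 : ((0, 0) : E × Pt p) = 0 := rfl
  simp [h0]

lemma contDiff_ptDensity (hc : ContDiff ℝ ∞ c) (M : Matrix (Fin p) (Fin p) ℝ) (a : Pt p) :
    ContDiff ℝ ∞ (ptDensity c M a) := by
  have h := contDiff_partial hc 1 0
  simp only [Matrix.one_mulVec, add_zero] at h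
  exact contDiff_dot hc (contDiff_cross (contDiff_partial hc M a) h)

/-- With `m` the variation of the field in the direction `δ`, the right side is the exterior
derivative of the one-form `(n × m) · dn` on the pair `M x + a`, `x`. This is the shape to which the
homotopy formula applies. -/
lemma fderiv_ptDensity (hc : ContDiff ℝ ∞ c) (M : Matrix (Fin p) (Fin p) ℝ) (a : Pt p)
    {θ : E} (hu : ∀ᶠ θ' in 𝓝 θ, ∀ x, c (θ', x) ⬝ᵥ c (θ', x) = 1) (x : Pt p) (δ : E) :
    fderiv ℝ (ptDensity c M a) (θ, x) (δ, 0) =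
      ∑ i, (fderiv ℝ (fun y => (c (θ, y) ⨯₃ fderiv ℝ c (θ, y) (δ, 0)) i) x (M *ᵥ x + a) *
          fderiv ℝ (fun y => c (θ, y) i) x x -
        fderiv ℝ (fun y => (c (θ, y) ⨯₃ fderiv ℝ c (θ, y) (δ, 0)) i) x x *
          fderiv ℝ (fun y => c (θ, y) i) x (M *ᵥ x + a)) := by
  set w := M *ᵥ x + a with hw
  have hdc : Differentiable ℝ c := hc.differentiable (by simp)
  have hdM := (contDiff_partial hc M a).differentiable (by simp)
  have hdE : Differentiable ℝ fun z : E × Pt p => fderiv ℝ c z (0, z.2) := by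
    have h := (contDiff_partial hc 1 0).differentiable (by simp)
    simpa only [Matrix.one_mulVec, add_zero] using h
  have hfE : fderiv ℝ (fun z : E × Pt p => fderiv ℝ c z (0, z.2)) (θ, x) (δ, 0) =
      fderiv ℝ (fderiv ℝ c) (θ, x) (δ, 0) (0, x) := by
    have h := fderiv_partial hc 1 0 (θ, x) δ
    simpa only [Matrix.one_mulVec, add_zero] using h
  have hsec : ContDiff ℝ ∞ fun y => c (θ, y) := hc.comp (contDiff_prodMk_right θ)
  have hm : ContDiff ℝ ∞ fun y => fderiv ℝ c (θ, y) (δ, 0) :=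
    ((hc.fderiv_right (by simp)).comp (contDiff_prodMk_right θ)).clm_apply contDiff_const
  have hsecd := hsec.differentiable (by simp)
  have hmd := hm.differentiable (by simp)
  -- Derivatives in the parameter and in space commute.
  have hgm : ∀ u, fderiv ℝ (fun y => fderiv ℝ c (θ, y) (δ, 0)) x u =
      fderiv ℝ (fderiv ℝ c) (θ, x) (δ, 0) (0, u) := by
    intro u
    have h1 : HasFDerivAt (fderiv ℝ c) (fderiv ℝ (fderiv ℝ c) (θ, x)) (θ, x) :=
      (((hc.fderiv_right (m := ∞) (by simp)).differentiable (by simp)) _).hasFDerivAt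
    have h2 := ((h1.comp x (hasFDerivAt_prodMk_right θ x)).clm_apply
      (hasFDerivAt_const ((δ, 0) : E × Pt p) x)).fderiv
    simp only [Function.comp_def] at h2
    rw [h2, (hc.contDiffAt.isSymmSndFDerivAt (by simp [two_le_infty])).eq]
    simp
  have hn : ∀ u, fderiv ℝ (fun y => c (θ, y)) x u = fderiv ℝ c (θ, x) (0, u) :=
    fun u => grad_section hc θ u x
  have hunit : (fun z => c z ⬝ᵥ c z) =ᶠ[𝓝 (θ, x)] fun _ => 1 := by
    have := hu.prod_inl_nhds x
    filter_upwards [this] with z hz using hz z.2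
  have horth : ∀ ζ, fderiv ℝ c (θ, x) ζ ⬝ᵥ c (θ, x) = 0 := by
    intro ζ
    have h := fderiv_dot (hdc (θ, x)) (hdc (θ, x)) ζ
    rw [hunit.fderiv_eq, dotProduct_comm (c (θ, x))] at h
    simp at h
    linarith
  have hcross : ∀ i u,
      fderiv ℝ (fun y => (c (θ, y) ⨯₃ fderiv ℝ c (θ, y) (δ, 0)) i) x u =
        (fderiv ℝ c (θ, x) (0, u) ⨯₃ fderiv ℝ c (θ, x) (δ, 0) +
          c (θ, x) ⨯₃ fderiv ℝ (fderiv ℝ c) (θ, x) (δ, 0) (0, u)) i := by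
    intro i u
    rw [fderiv_coord (differentiableAt_cross (hsecd x) (hmd x)), fderiv_cross (hsecd x) (hmd x),
      hn, hgm]
  have hcoord : ∀ i u, fderiv ℝ (fun y => c (θ, y) i) x u = fderiv ℝ c (θ, x) (0, u) i := by
    intro i u
    rw [fderiv_coord (hsecd x), hn]
  simp only [hcross, hcoord, Finset.sum_sub_distrib]
  change fderiv ℝ (fun z => c z ⬝ᵥ (fderiv ℝ c z (0, M *ᵥ z.2 + a) ⨯₃ fderiv ℝ c z (0, z.2)))
    (θ, x) (δ, 0) = _ ⬝ᵥ _ - _ ⬝ᵥ _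
  rw [fderiv_dot (hdc _) (differentiableAt_cross (hdM _) (hdE _)),
    fderiv_cross (hdM _) (hdE _), fderiv_partial hc, hfE, dotProduct_add, ← add_assoc]
  exact variation_identity _ _ (hu.self_of_nhds x) (horth _) (horth _) (horth _)

/-- The first variation of the Papanicolaou–Tomaras functional. -/
lemma hasFDerivAt_ptMom [ProperSpace E] (hp : 2 ≤ p) (hc : ContDiff ℝ ∞ c) {θ : E}
    (hu : ∀ᶠ θ' in 𝓝 θ, ∀ x, c (θ', x) ⬝ᵥ c (θ', x) = 1) {K : Set (Pt p)} (hK : IsCompact K)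
    {e : R3} (he : ∀ᶠ θ' in 𝓝 θ, ∀ x ∉ K, c (θ', x) = e) (v : se p) :
    ∃ L : E →L[ℝ] ℝ, HasFDerivAt (fun θ' => ptMom (fun x => c (θ', x)) v) L θ ∧
      ∀ δ, L δ = ∫ x, (grad (fun x => c (θ, x)) (seField v x) x ⨯₃ c (θ, x)) ⬝ᵥ
        fderiv ℝ c (θ, x) (δ, 0) := by
  have hfield : ∀ᶠ θ' in 𝓝 θ, UnitField fun x => c (θ', x) := by
    filter_upwards [hu, he] with θ' h1 h2
    exact ⟨hc.comp (contDiff_prodMk_right θ'), h1, e, K, hK, h2⟩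
  have hsupp : ∀ (M : Matrix (Fin p) (Fin p) ℝ) (a : Pt p),
      ∀ᶠ θ' in 𝓝 θ, ∀ x ∉ K, ptDensity c M a (θ', x) = 0 := by
    intro M a
    filter_upwards [he] with θ' h x hx
    have h1 := fderiv_eq_zero_of_const hK h x hx
    have h2 : ∀ u, fderiv ℝ c (θ', x) (0, u) = 0 := fun u => by
      rw [← grad_section hc, grad, h1]; rfl
    simp [ptDensity, h2]
  obtain ⟨L₁, hL₁, hL₁'⟩ := hasFDerivAt_integral_of_contDiff
    (contDiff_ptDensity hc v.1.1 0) hK (hsupp v.1.1 0)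
  obtain ⟨L₂, hL₂, hL₂'⟩ := hasFDerivAt_integral_of_contDiff
    (contDiff_ptDensity hc 0 v.2) hK (hsupp 0 v.2)
  refine ⟨(1 / (p : ℝ)) • L₁ + (1 / ((p : ℝ) - 1)) • L₂, ?_, fun δ => ?_⟩
  · refine ((hL₁.const_smul _).add (hL₂.const_smul _)).congr_of_eventuallyEq ?_
    filter_upwards [hfield] with θ' h
    rw [h.ptMom_eq]
    simp [ptDensity, grad_section hc]
  · have hn := hfield.self_of_nhds
    have hm : ContDiff ℝ ∞ fun y => fderiv ℝ c (θ, y) (δ, 0) :=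
      ((hc.fderiv_right (by simp)).comp (contDiff_prodMk_right θ)).clm_apply contDiff_const
    have hf := contDiff_pi.1 (contDiff_cross hn.smooth hm)
    -- Applied to `(n × m) · dn`, the homotopy formula merges the rotational and translational
    -- integrals into the integral of `(n × m) · ∇_v n`, which is `(∇_v n × n) · m` by cyclicity.
    have key := integral_homotopy hp hf hn.contDiff_coord hn.hasCompactSupport_fderiv_coord v
    simp only [add_apply, smul_apply, hL₁', hL₂',
      fderiv_ptDensity hc _ _ hu, add_zero, Matrix.zero_mulVec, zero_add, smul_eq_mul]
    rw [key]
    congr 1; funext x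
    simp only [fderiv_coord (hn.differentiable x)]
    change (c (θ, x) ⨯₃ fderiv ℝ c (θ, x) (δ, 0)) ⬝ᵥ
      grad (fun x => c (θ, x)) (seField v x) x = _
    simp only [dot3, cross3_0, cross3_1, cross3_2]
    ring

end Variation

/-! ### Matrix exponentials and one-parameter motions -/

section Exp

attribute [local instance] Matrix.linftyOpNormedRing Matrix.linftyOpNormedAlgebra

lemma hasDerivAt_exp_smul_entry {q : ℕ} (A : Matrix (Fin q) (Fin q) ℝ) (i j : Fin q) :
    HasDerivAt (fun t : ℝ => NormedSpace.exp (t • A) i j) (A i j) 0 := by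
  have h := hasDerivAt_exp_smul_const (𝕂 := ℝ) A (0 : ℝ)
  rw [zero_smul, NormedSpace.exp_zero, one_mul] at h
  exact (LinearMap.toContinuousLinearMap
    (Matrix.entryLinearMap ℝ ℝ i j)).hasFDerivAt.comp_hasDerivAt (0 : ℝ) h

end Exp

lemma hasDerivAt_exp_neg_smul_entry {q : ℕ} (A : Matrix (Fin q) (Fin q) ℝ) (i j : Fin q) :
    HasDerivAt (fun t : ℝ => NormedSpace.exp (-(t • A)) i j) (-A i j) 0 := by
  have h := hasDerivAt_exp_smul_entry (-A) i j
  simpa only [smul_neg, Matrix.neg_apply] using h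

lemma seCurveInv_zero {p : ℕ} (v : se p) (x : Pt p) : seCurveInv v 0 x = x := by
  simp [seCurveInv]

lemma hasDerivAt_mulVec_zero {q : ℕ} {M : ℝ → Matrix (Fin q) (Fin q) ℝ}
    {M' : Matrix (Fin q) (Fin q) ℝ} {y : ℝ → Fin q → ℝ} {y' : Fin q → ℝ}
    (hM : ∀ i j, HasDerivAt (fun t => M t i j) (M' i j) 0) (hy : HasDerivAt y y' 0) :
    HasDerivAt (fun t => M t *ᵥ y t) (M' *ᵥ y 0 + M 0 *ᵥ y') 0 := by
  rw [hasDerivAt_pi] at hy ⊢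
  intro i
  simp only [Matrix.mulVec, dotProduct, Pi.add_apply, ← Finset.sum_add_distrib]
  exact HasDerivAt.fun_sum fun j _ => (hM i j).mul (hy j)

lemma hasDerivAt_seCurveInv {p : ℕ} (v : se p) (x : Pt p) :
    HasDerivAt (fun ε => seCurveInv v ε x) (-seField v x) 0 := by
  have h1 : HasDerivAt (fun ε : ℝ => x - ε • v.2) (-v.2) 0 := by
    simpa using ((hasDerivAt_id (0 : ℝ)).smul_const v.2).const_sub x
  have h2 := hasDerivAt_mulVec_zero (M' := -v.1.1)
    (fun i j => hasDerivAt_exp_neg_smul_entry v.1.1 i j) h1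
  refine h2.congr_deriv ?_
  simp [seField, Matrix.neg_mulVec, add_comm]

lemma hasDerivAt_comp_seCurveInv {p : ℕ} {F : Type*} [NormedAddCommGroup F] [NormedSpace ℝ F]
    {f : Pt p → F} {x : Pt p} (hf : DifferentiableAt ℝ f x) (v : se p) :
    HasDerivAt (fun ε => f (seCurveInv v ε x)) (-fderiv ℝ f x (seField v x)) 0 := by
  have hf' : HasFDerivAt f (fderiv ℝ f x) (seCurveInv v 0 x) := by
    rw [seCurveInv_zero]; exact hf.hasFDerivAt
  have h := hf'.comp_hasDerivAt (0 : ℝ) (hasDerivAt_seCurveInv v x)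
  rw [map_neg] at h
  exact h

/-- The Lie algebra of the residual group. -/
lemma inLieHmu_iff {p : ℕ} (μ : DualField p) (X : LieElt p) :
    InLieHmu μ X ↔ ∀ x, X.fld x ⨯₃ μ.1 x = grad μ.1 (seField X.eucl x) x := by
  refine forall_congr' fun x => ?_
  have h := hasDerivAt_mulVec_zero (fun i j => hasDerivAt_exp_smul_entry (hat (X.fld x)) i j)
    (hasDerivAt_comp_seCurveInv (μ.2.differentiable (by simp) x) X.eucl)
  rw [h.deriv, zero_smul, NormedSpace.exp_zero, Matrix.one_mulVec, seCurveInv_zero, hat_mulVec,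
    ← sub_eq_add_neg, sub_eq_zero]
  rfl

/-- Since `∇μ` is orthogonal to `μ`, the vector `μ × ∇μ` solves `ξ × μ = ∇μ`. It is compactly
supported because `∇μ` is. -/
lemma exists_lieElt {p : ℕ} {μ : DualField p} (hμ : IsUnitField μ) (v : se p) :
    ∃ X : LieElt p, InLieHmu μ X ∧ X.eucl = v ∧
      ∀ x, X.fld x = μ.1 x ⨯₃ grad μ.1 (seField v x) x := by
  have hu := hμ.unitField
  refine ⟨⟨fun x => μ.1 x ⨯₃ grad μ.1 (seField v x) x,
    contDiff_cross hu.smooth (hu.contDiff_grad (contDiff_affine v.1.1 v.2)),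
    hu.hasCompactSupport_of_grad fun x hx => by simp [grad, hx], v⟩, ?_, rfl, fun x => rfl⟩
  rw [inLieHmu_iff]
  exact fun x => cross_cross_unit (hu.unit x) (hu.grad_dot _ x)

/-! ### The momentum one-form -/

section Momentum

variable {p : ℕ}

lemma JG_eq_iff (q : Phase p) (μ : DualField p) :
    JG q = μ ↔ ∀ x, q.mom.1 x = -((q.conf.1 x).1 *ᵥ μ.1 x) := by
  rw [Subtype.ext_iff, funext_iff]
  refine forall_congr' fun x => ?_
  change -(((q.conf.1 x)⁻¹).1 *ᵥ q.mom.1 x) = μ.1 x ↔ _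
  constructor
  · intro h
    rw [← h, Matrix.mulVec_neg, SO.mulVec_inv_mulVec, neg_neg]
  · intro h
    rw [h, Matrix.mulVec_neg, SO.inv_mulVec_mulVec, neg_neg]

/-- Rotations preserve length, and outside a compact set `ψ` is the identity, so the value of `n =
-ψ μ` there is `-e`. -/
lemma unitField_mom {q : Phase p} {μ : DualField p} (hμ : UnitField μ.1) (hq : JG q = μ) :
    UnitField q.mom.1 := by
  rw [JG_eq_iff] at hq
  refine ⟨q.mom.2, fun x => ?_, ?_⟩
  · rw [hq x, neg_dotProduct_neg, SO.dot_mulVec, hμ.unit]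
  · obtain ⟨e, K, hK, h⟩ := hμ.const_at_infty
    obtain ⟨-, L, hL, h'⟩ := q.conf.2
    refine ⟨-e, K ∪ L, hK.union hL, fun x hx => ?_⟩
    simp only [Set.mem_union, not_or] at hx
    rw [hq x, h x hx.1, h' x hx.2, SO.one_val, Matrix.one_mulVec]

lemma unitField_of_mem_reducedSpace {μ : DualField p} (hμ : UnitField μ.1) {n : Pt p → R3}
    (hn : n ∈ reducedSpace μ) : UnitField n := by
  obtain ⟨q, hq, rfl⟩ := hn
  exact unitField_mom hμ hq

/-- The derivative of a rotation field as a matrix. -/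
noncomputable def dRot (ψ : Gp p) (u x : Pt p) : Matrix (Fin 3) (Fin 3) ℝ :=
  Matrix.of fun i j => fderiv ℝ (fun y => (ψ.1 y).1 i j) x u

/-- The derivative of a rotation field, brought back to the identity by right translation. -/
noncomputable def logDeriv (ψ : Gp p) (u x : Pt p) : R3 :=
  vee (dRot ψ u x * ((ψ.1 x)⁻¹).1)

lemma differentiable_entry (ψ : Gp p) (i j : Fin 3) :
    Differentiable ℝ fun y => (ψ.1 y).1 i j := (ψ.2.1 i j).differentiable (by simp)

lemma hasCompactSupport_fderiv_entry (ψ : Gp p) (i j : Fin 3) :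
    HasCompactSupport (fderiv ℝ fun y => (ψ.1 y).1 i j) := by
  obtain ⟨-, L, hL, h⟩ := ψ.2
  exact HasCompactSupport.intro hL (fderiv_eq_zero_of_const (e := (1 : SO 3).1 i j) hL
    fun x hx => by rw [h x hx])

lemma generator_eq (X : LieElt p) (ψ : Gp p) (x : Pt p) :
    generator X ψ x = -(dRot ψ (seField X.eucl x) x * ((ψ.1 x)⁻¹).1) -
      (ψ.1 x).1 * hat (X.fld x) * ((ψ.1 x)⁻¹).1 := by
  have hmul : ∀ i l, HasDerivAt (fun ε : ℝ => ((ψ.1 (seCurveInv X.eucl ε x)).1 *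
      NormedSpace.exp (-(ε • hat (X.fld x)))) i l)
      (-dRot ψ (seField X.eucl x) x i l - ((ψ.1 x).1 * hat (X.fld x)) i l) 0 := by
    intro i l
    have h : HasDerivAt (fun ε : ℝ => ∑ k, (ψ.1 (seCurveInv X.eucl ε x)).1 i k *
        NormedSpace.exp (-(ε • hat (X.fld x))) k l) _ 0 :=
      HasDerivAt.fun_sum fun k _ =>
        (hasDerivAt_comp_seCurveInv (differentiable_entry ψ i k x) X.eucl).mul
          (hasDerivAt_exp_neg_smul_entry (hat (X.fld x)) k l)
    refine h.congr_deriv ?_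
    simp only [zero_smul, neg_zero, NormedSpace.exp_zero, seCurveInv_zero, Matrix.mul_apply,
      mul_neg, ← sub_eq_add_neg]
    simp [Matrix.one_apply, dRot]
  ext i j
  have h : HasDerivAt (fun ε : ℝ => ∑ l, ((ψ.1 (seCurveInv X.eucl ε x)).1 *
      NormedSpace.exp (-(ε • hat (X.fld x)))) i l * ((ψ.1 x)⁻¹).1 l j) _ 0 :=
    HasDerivAt.fun_sum fun l _ => (hmul i l).mul_const (((ψ.1 x)⁻¹).1 l j)
  change deriv (fun ε : ℝ => ∑ l, ((ψ.1 (seCurveInv X.eucl ε x)).1 *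
      NormedSpace.exp (-(ε • hat (X.fld x)))) i l * ((ψ.1 x)⁻¹).1 l j) 0 = _
  rw [h.deriv]
  simp only [sub_mul, neg_mul, Finset.sum_sub_distrib, Finset.sum_neg_distrib]
  rfl

lemma vee_neg_sub (M N : Matrix (Fin 3) (Fin 3) ℝ) : vee (-M - N) = -vee M - vee N := by
  refine ext3 ?_ ?_ ?_ <;> simp [vee]

/-- The one-form `-n · (dψ ψ⁻¹)` on `ℝ^p` of a point `(ψ, n)` of the phase space. -/
noncomputable def momForm (q : Phase p) (u x : Pt p) : ℝ :=
  -(q.mom.1 x ⬝ᵥ logDeriv q.conf u x)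

/-- Separates the two factors of the Lie algebra: the Euclidean part enters through a one-form on
`ℝ^p`, and `ξ` only through its pairing with `J^G`. -/
lemma dot_vee_generator (X : LieElt p) (q : Phase p) (x : Pt p) :
    q.mom.1 x ⬝ᵥ vee (generator X q.conf x) =
      momForm q (seField X.eucl x) x + (JG q).1 x ⬝ᵥ X.fld x := by
  rw [generator_eq, SO.mul_hat_mul_inv, vee_neg_sub, vee_hat, dotProduct_sub, dotProduct_neg,
    SO.dot_mulVec_inv]
  change _ = _ + (-(((q.conf.1 x)⁻¹).1 *ᵥ q.mom.1 x)) ⬝ᵥ X.fld x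
  rw [neg_dotProduct, ← sub_eq_add_neg]
  rfl

lemma momForm_zero (q : Phase p) (x : Pt p) : momForm q 0 x = 0 := by
  have h : dRot q.conf 0 x = 0 := by ext i j; simp [dRot]
  simp [momForm, logDeriv, h, vee]

lemma momentum_of_eucl_eq_zero (q : Phase p) (X : LieElt p) (hX : X.eucl = 0) :
    momentum X q = pairing (JG q) X.fld := by
  unfold momentum pairing
  congr 1; funext x
  have h : seField X.eucl x = 0 := by simp [hX, seField]
  rw [dot_vee_generator, h, momForm_zero, zero_add]

/-- The coefficients of `momForm`. -/
noncomputable def momCoeff (q : Phase p) (s : Fin 3 × Fin 3) (x : Pt p) : ℝ :=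
  -(q.mom.1 x s.1 * (q.conf.1 x).1 (s.1 + 1) s.2)

/-- The coordinate functions whose differentials enter `momForm`. -/
def momCoord (q : Phase p) (s : Fin 3 × Fin 3) (x : Pt p) : ℝ :=
  (q.conf.1 x).1 (s.1 + 2) s.2

lemma contDiff_momCoeff (q : Phase p) (s) : ContDiff ℝ ∞ (momCoeff q s) :=
  ((contDiff_pi.1 q.mom.2 s.1).mul (q.conf.2.1 _ _)).neg

lemma contDiff_momCoord (q : Phase p) (s) : ContDiff ℝ ∞ (momCoord q s) := q.conf.2.1 _ _

lemma hasCompactSupport_momCoord (q : Phase p) (s) :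
    HasCompactSupport (fderiv ℝ (momCoord q s)) := hasCompactSupport_fderiv_entry _ _ _

/-- Component `i` of `vee` is the entry `(i + 2, i + 1)`, with indices modulo 3. This cyclic form
allows the three components to be treated at once. -/
lemma logDeriv_apply (ψ : Gp p) (u x : Pt p) (i : Fin 3) :
    logDeriv ψ u x i = ∑ k, dRot ψ u x (i + 2) k * (ψ.1 x).1 (i + 1) k := by
  fin_cases i <;> rfl

/-- The form `∑ f dh` with `dh` compactly supported, as required by the integration lemmas; the `h`
are matrix entries of `ψ`, constant outside a compact set. -/
lemma momForm_eq_sum (q : Phase p) (u x : Pt p) :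
    momForm q u x = ∑ s, momCoeff q s x * fderiv ℝ (momCoord q s) x u := by
  rw [Fintype.sum_prod_type]
  simp only [momForm, dotProduct, logDeriv_apply, Finset.mul_sum, ← Finset.sum_neg_distrib]
  refine Finset.sum_congr rfl fun i _ => Finset.sum_congr rfl fun k _ => ?_
  simp only [momCoeff, dRot, Matrix.of_apply]
  change _ = _ * fderiv ℝ (fun y => (q.conf.1 y).1 (i + 2) k) x u
  ring

/-- Differentiate `ψ ψᵀ = 1`. -/
lemma dRot_mul_skew (ψ : Gp p) (u x : Pt p) :
    (dRot ψ u x * ((ψ.1 x)⁻¹).1)ᵀ = -(dRot ψ u x * ((ψ.1 x)⁻¹).1) := by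
  ext i j
  have h : (fun y => ∑ k, (ψ.1 y).1 i k * (ψ.1 y).1 j k) = fun _ => (1 : SO 3).1 i j := by
    funext y
    have := congrFun (congrFun (SO.mul_transpose_self (ψ.1 y)) i) j
    exact this
  have h1 := (HasFDerivAt.fun_sum (u := Finset.univ) fun k _ =>
    ((differentiable_entry ψ i k x).hasFDerivAt).fun_mul
      ((differentiable_entry ψ j k x).hasFDerivAt)).fderiv
  rw [h, fderiv_fun_const] at h1
  have h2 := congrArg (fun L : Pt p →L[ℝ] ℝ => L u) h1
  simp only [Pi.zero_apply, zero_apply, sum_apply, add_apply, smul_apply, smul_eq_mul,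
    Finset.sum_add_distrib] at h2
  change ∑ k, dRot ψ u x j k * (ψ.1 x).1 i k = -∑ k, dRot ψ u x i k * (ψ.1 x).1 j k
  simp only [dRot, Matrix.of_apply]
  have h3 : ∑ k, (ψ.1 x).1 j k * fderiv ℝ (fun y => (ψ.1 y).1 i k) x u =
      ∑ k, fderiv ℝ (fun y => (ψ.1 y).1 i k) x u * (ψ.1 x).1 j k :=
    Finset.sum_congr rfl fun k _ => mul_comm _ _
  have h4 : ∑ k, (ψ.1 x).1 i k * fderiv ℝ (fun y => (ψ.1 y).1 j k) x u =
      ∑ k, fderiv ℝ (fun y => (ψ.1 y).1 j k) x u * (ψ.1 x).1 i k :=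
    Finset.sum_congr rfl fun k _ => mul_comm _ _
  linarith

lemma hat_vee {M : Matrix (Fin 3) (Fin 3) ℝ} (hM : Mᵀ = -M) : hat (vee M) = M := by
  have h : ∀ i j, M j i = -M i j := fun i j => congrFun (congrFun hM i) j
  ext i j
  have h00 := h 0 0
  have h11 := h 1 1
  have h22 := h 2 2
  fin_cases i <;> fin_cases j <;> simp [hat, vee] <;> first | linarith | exact (h _ _).symm

lemma dRot_eq (ψ : Gp p) (u x : Pt p) : dRot ψ u x = hat (logDeriv ψ u x) * (ψ.1 x).1 := by
  rw [logDeriv, hat_vee (dRot_mul_skew ψ u x), Matrix.mul_assoc, SO.inv_val,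
    SO.transpose_mul_self, Matrix.mul_one]

/-- Differentiate `n = -ψ μ`, writing `dψ` as the skew matrix of `dψ ψ⁻¹` times `ψ`. -/
lemma grad_mom {q : Phase p} {μ : DualField p} (hq : JG q = μ) (u x : Pt p) :
    grad q.mom.1 u x = logDeriv q.conf u x ⨯₃ q.mom.1 x - (q.conf.1 x).1 *ᵥ grad μ.1 u x := by
  have hq' := (JG_eq_iff q μ).1 hq
  have hd : dRot q.conf u x *ᵥ μ.1 x = -(logDeriv q.conf u x ⨯₃ q.mom.1 x) := by
    rw [dRot_eq, ← Matrix.mulVec_mulVec, hat_mulVec, hq' x, map_neg, neg_neg]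
  have hμd := μ.2.differentiable (by simp) x
  have hnd := q.mom.2.differentiable (by simp) x
  ext i
  have h1 : HasFDerivAt (fun y => -∑ k, (q.conf.1 y).1 i k * μ.1 y k) _ x :=
    (HasFDerivAt.fun_sum (u := Finset.univ) fun k _ =>
      ((differentiable_entry q.conf i k x).hasFDerivAt).fun_mul
        (hasFDerivAt_pi'.1 hμd.hasFDerivAt k)).fun_neg
  have h2 : (fun y => q.mom.1 y i) = fun y => -∑ k, (q.conf.1 y).1 i k * μ.1 y k :=
    funext fun y => congrFun (hq' y) i
  rw [grad, ← fderiv_coord hnd, h2, h1.fderiv]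
  have h3 := congrFun hd i
  have h4 : (logDeriv q.conf u x ⨯₃ q.mom.1 x) i = -(dRot q.conf u x *ᵥ μ.1 x) i := by
    rw [h3]; simp
  rw [Pi.sub_apply, h4]
  simp only [neg_apply, sum_apply, add_apply, smul_apply, smul_eq_mul, Finset.sum_add_distrib,
    Matrix.mulVec, dotProduct, dRot, Matrix.of_apply, grad]
  rw [neg_add, add_comm, sub_eq_add_neg]
  congr 1
  simp [mul_comm]

/-- The Maurer–Cartan equation and the definition of the momentum form, combined. -/
lemma maurerCartan_identity {n α β : R3} (a b : R3) (hn : n ⬝ᵥ n = 1) (hα : α ⬝ᵥ n = 0)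
    (hβ : β ⬝ᵥ n = 0) :
    -(n ⬝ᵥ (a ⨯₃ b) + (a ⨯₃ n - α) ⬝ᵥ b - (b ⨯₃ n - β) ⬝ᵥ a) =
      n ⬝ᵥ ((a ⨯₃ n - α) ⨯₃ (b ⨯₃ n - β)) - n ⬝ᵥ (α ⨯₃ β) := by
  simp only [dot3, cross3_0, cross3_1, cross3_2, Pi.sub_apply] at *
  linear_combination
    -(n 0 * (a 1 * b 2 - a 2 * b 1) + n 1 * (a 2 * b 0 - a 0 * b 2)
      + n 2 * (a 0 * b 1 - a 1 * b 0) - (a 0 * β 0 + a 1 * β 1 + a 2 * β 2)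
      + (b 0 * α 0 + b 1 * α 1 + b 2 * α 2)) * hn
    - (a 0 * n 0 + a 1 * n 1 + a 2 * n 2) * hβ + (b 0 * n 0 + b 1 * n 1 + b 2 * n 2) * hα

/-- The quadratic term of the Maurer–Cartan equation: orthogonality removes `R`, and
antisymmetrization leaves a commutator of skew matrices, which is a cross product. -/
lemma sum_mul_hat (R : SO 3) (a b : R3) (i : Fin 3) :
    ∑ k, ((hat a * R.1) (i + 1) k * (hat b * R.1) (i + 2) k -
      (hat b * R.1) (i + 1) k * (hat a * R.1) (i + 2) k) = (a ⨯₃ b) i := by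
  have h : ∀ a b : R3, ∀ j l, ∑ k, (hat a * R.1) j k * (hat b * R.1) l k =
      (hat a * (hat b)ᵀ) j l := by
    intro a b j l
    have : hat a * R.1 * (hat b * R.1)ᵀ = hat a * (hat b)ᵀ := by
      rw [Matrix.transpose_mul, Matrix.mul_assoc, ← Matrix.mul_assoc R.1, SO.mul_transpose_self,
        Matrix.one_mul]
    rw [← this]; rfl
  rw [Finset.sum_sub_distrib, h, h]
  fin_cases i <;> simp [hat, Matrix.mul_apply, Fin.sum_univ_three, cross_apply] <;> ring

/-- The exterior derivative of the momentum form is `n · (dn × dn) + μ · (dμ × dμ)`. -/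
lemma exterior_momForm {q : Phase p} {μ : DualField p} (hμ : UnitField μ.1) (hq : JG q = μ)
    (u w x : Pt p) :
    ∑ s, (fderiv ℝ (momCoeff q s) x u * fderiv ℝ (momCoord q s) x w -
      fderiv ℝ (momCoeff q s) x w * fderiv ℝ (momCoord q s) x u) =
    q.mom.1 x ⬝ᵥ (grad q.mom.1 u x ⨯₃ grad q.mom.1 w x) +
      μ.1 x ⬝ᵥ (grad μ.1 u x ⨯₃ grad μ.1 w x) := by
  have hu := unitField_mom hμ hq
  have hq' := (JG_eq_iff q μ).1 hq x
  have hcoeff : ∀ (s : Fin 3 × Fin 3) u, fderiv ℝ (momCoeff q s) x u =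
      -(grad q.mom.1 u x s.1 * (q.conf.1 x).1 (s.1 + 1) s.2 +
        q.mom.1 x s.1 * dRot q.conf u x (s.1 + 1) s.2) := by
    intro s u
    have h : HasFDerivAt (momCoeff q s) _ x :=
      (((hasFDerivAt_pi'.1 (hu.differentiable x).hasFDerivAt s.1)).fun_mul
        (differentiable_entry q.conf (s.1 + 1) s.2 x).hasFDerivAt).fun_neg
    rw [h.fderiv]
    simp only [neg_apply, add_apply, smul_apply, smul_eq_mul, dRot, Matrix.of_apply, grad]
    simp [mul_comm, add_comm]
  have hcoord : ∀ (s : Fin 3 × Fin 3) u, fderiv ℝ (momCoord q s) x u =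
      dRot q.conf u x (s.1 + 2) s.2 := fun s u => rfl
  set a := logDeriv q.conf u x with ha
  set b := logDeriv q.conf w x with hb
  set R := q.conf.1 x with hR
  set n := q.mom.1 x with hn
  -- Because the form is `∑ f dh`, its exterior derivative `∑ df ∧ dh` contains only first
  -- derivatives of `ψ`.
  have hsum : ∑ s, (fderiv ℝ (momCoeff q s) x u * fderiv ℝ (momCoord q s) x w -
      fderiv ℝ (momCoeff q s) x w * fderiv ℝ (momCoord q s) x u) =
      -(n ⬝ᵥ (a ⨯₃ b) + grad q.mom.1 u x ⬝ᵥ b - grad q.mom.1 w x ⬝ᵥ a) := by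
    rw [Fintype.sum_prod_type]
    simp only [hcoeff, hcoord, dotProduct, ← Finset.sum_add_distrib, ← Finset.sum_sub_distrib,
      ← Finset.sum_neg_distrib]
    refine Finset.sum_congr rfl fun i _ => ?_
    rw [← sum_mul_hat R a b i, ha, hb, logDeriv_apply, logDeriv_apply, dRot_eq q.conf u,
      dRot_eq q.conf w, ← ha, ← hb, Finset.mul_sum, Finset.mul_sum, Finset.mul_sum,
      ← Finset.sum_add_distrib, ← Finset.sum_sub_distrib, ← Finset.sum_neg_distrib]
    refine Finset.sum_congr rfl fun k _ => ?_
    ring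
  have horth : ∀ u, (R.1 *ᵥ grad μ.1 u x) ⬝ᵥ n = 0 := by
    intro u
    rw [hq', dotProduct_neg, SO.dot_mulVec, hμ.grad_dot, neg_zero]
  rw [hsum, grad_mom hq, grad_mom hq,
    maurerCartan_identity _ _ (hu.unit x) (horth u) (horth w), sub_eq_add_neg]
  congr 1
  -- With `n = -ψ μ`, the remaining term is a triple product of vectors all rotated by `ψ`; the sign
  -- of `n` makes the contribution of `μ` positive.
  rw [← hn, hq', neg_dotProduct, neg_neg, SO.triple_mulVec]

lemma continuous_seField (v : se p) : Continuous (seField v) :=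
  (contDiff_affine (k := 0) v.1.1 v.2).continuous

lemma integrable_momForm (q : Phase p) (v : se p) :
    Integrable fun x => momForm q (seField v x) x := by
  simp only [momForm_eq_sum]
  exact integrable_finsetSum _ fun s _ => integrable_mul_fderiv
    (contDiff_momCoeff q s).continuous (contDiff_momCoord q s) (continuous_seField v)
    (hasCompactSupport_momCoord q s)

/-- The momentum map on the level set of `J^G`, up to the pairing with `μ`. -/
lemma momentum_sub_pairing {q : Phase p} {μ : DualField p} (hq : JG q = μ) (X : LieElt p) :
    momentum X q - pairing μ X.fld = ∫ x, momForm q (seField X.eucl x) x := by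
  unfold momentum pairing
  simp only [dot_vee_generator, hq]
  rw [integral_add (integrable_momForm q X.eucl), add_sub_cancel_right]
  refine Continuous.integrable_of_hasCompactSupport
    (Continuous.dotProduct μ.2.continuous X.smooth.continuous)
    (X.supp.mono fun x hx hx' => hx ?_)
  change μ.1 x ⬝ᵥ X.fld x = 0
  rw [hx', dotProduct_zero]

/-- The momentum map in terms of the Papanicolaou–Tomaras functional. -/
lemma integral_momForm (hp : 2 ≤ p) {q : Phase p} {μ : DualField p} (hμ : UnitField μ.1)
    (hq : JG q = μ) (v : se p) :
    ∫ x, momForm q (seField v x) x = ptMom q.mom.1 v + ptMom μ.1 v := by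
  have hu := unitField_mom hμ hq
  have h := integral_homotopy hp (contDiff_momCoeff q) (contDiff_momCoord q)
    (hasCompactSupport_momCoord q) v
  simp only [exterior_momForm hμ hq, ← momForm_eq_sum] at h
  have hc : Continuous fun x : Pt p => v.1.1 *ᵥ x := by fun_prop
  rw [← h, hu.ptMom_eq, hμ.ptMom_eq,
    integral_add (hu.integrable_triple hc continuous_id') (hμ.integrable_triple hc continuous_id'),
    integral_add (hu.integrable_triple continuous_const continuous_id')
      (hμ.integrable_triple continuous_const continuous_id')]
  ring

/-- The bracket of `se(p)` corresponds to minus the bracket of vector fields, which is the sign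
produced by `integral_sum_wedge`. -/
lemma seField_seBracket (v w : se p) (x : Pt p) :
    seField (seBracket v w) x = -(w.1.1 *ᵥ seField v x - v.1.1 *ᵥ seField w x) := by
  have h : (⁅v.1, w.1⁆ : so p).1 = v.1.1 * w.1.1 - w.1.1 * v.1.1 := rfl
  simp only [seField, seBracket, h, Matrix.sub_mulVec, ← Matrix.mulVec_mulVec, Matrix.mulVec_add]
  abel

/-- Euclidean fields are divergence free, so integrating Cartan's formula for the momentum form
leaves only the bracket term. -/
lemma integral_momForm_seBracket {q : Phase p} {μ : DualField p} (hμ : UnitField μ.1)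
    (hq : JG q = μ) (v w : se p) :
    ∫ x, momForm q (seField (seBracket v w) x) x =
      (∫ x, q.mom.1 x ⬝ᵥ (grad q.mom.1 (seField v x) x ⨯₃ grad q.mom.1 (seField w x) x)) +
        ∫ x, μ.1 x ⬝ᵥ (grad μ.1 (seField v x) x ⨯₃ grad μ.1 (seField w x) x) := by
  have hu := unitField_mom hμ hq
  have h := integral_sum_wedge (contDiff_momCoeff q) (contDiff_momCoord q)
    (hasCompactSupport_momCoord q) v.1.1 w.1.1 v.2 w.2
  simp only [trace_so, zero_smul, sub_self, zero_sub] at h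
  change ∫ x, ∑ s, (fderiv ℝ (momCoeff q s) x (seField v x) *
      fderiv ℝ (momCoord q s) x (seField w x) - fderiv ℝ (momCoeff q s) x (seField w x) *
      fderiv ℝ (momCoord q s) x (seField v x)) = ∫ x, ∑ s, momCoeff q s x *
      fderiv ℝ (momCoord q s) x (-(w.1.1 *ᵥ seField v x - v.1.1 *ᵥ seField w x)) at h
  simp only [exterior_momForm hμ hq, ← momForm_eq_sum, ← seField_seBracket] at h
  rw [← h, integral_add (hu.integrable_triple (continuous_seField v) (continuous_seField w))
    (hμ.integrable_triple (continuous_seField v) (continuous_seField w))]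

end Momentum

/-! ### Rotations as products of reflections -/

section Householder

variable {p : ℕ}

/-- The matrix of the reflection in the hyperplane orthogonal to `u`. -/
noncomputable def householder (u : Pt p) : Matrix (Fin p) (Fin p) ℝ :=
  1 - (2 / (u ⬝ᵥ u)) • Matrix.vecMulVec u u

lemma householder_zero : householder (0 : Pt p) = 1 := by simp [householder]

lemma householder_neg (u : Pt p) : householder (-u) = householder u := by
  simp [householder, Matrix.neg_vecMulVec, Matrix.vecMulVec_neg]

lemma householder_transpose (u : Pt p) : (householder u)ᵀ = householder u := by
  simp [householder, Matrix.transpose_vecMulVec]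

lemma dot_self_ne_zero {u : Pt p} (hu : u ≠ 0) : u ⬝ᵥ u ≠ 0 := by
  rwa [Ne, dotProduct_self_eq_zero]

lemma householder_mul_self (u : Pt p) : householder u * householder u = 1 := by
  by_cases hu : u = 0
  · rw [hu, householder_zero, one_mul]
  have h := dot_self_ne_zero hu
  simp only [householder, sub_mul, mul_sub, one_mul, mul_one, Matrix.smul_mul, Matrix.mul_smul,
    Matrix.vecMulVec_mul_vecMulVec, smul_smul]
  ext i j
  simp only [Matrix.sub_apply, Matrix.smul_apply, smul_eq_mul, Matrix.vecMulVec_apply,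
    Pi.smul_apply]
  field_simp
  ring

lemma det_householder {u : Pt p} (hu : u ≠ 0) : (householder u).det = -1 := by
  have h := dot_self_ne_zero hu
  -- As a rank-one perturbation of the identity, the reflection has the determinant of the 1×1
  -- matrix `1 - 2`.
  have e : householder u = 1 - Matrix.replicateCol Unit ((2 / (u ⬝ᵥ u)) • u) *
      Matrix.replicateRow Unit u := by
    rw [householder]
    ext i j
    simp [Matrix.mul_apply, Matrix.vecMulVec_apply]
  rw [e, Matrix.det_one_sub_mul_comm, Matrix.det_unique]
  simp only [Matrix.sub_apply, Matrix.one_apply_eq, Matrix.mul_apply, Matrix.replicateRow_apply,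
    Matrix.replicateCol_apply, Pi.smul_apply, smul_eq_mul]
  have : ∑ j, u j * (2 / (u ⬝ᵥ u) * u j) = 2 / (u ⬝ᵥ u) * (u ⬝ᵥ u) := by
    rw [dotProduct, Finset.mul_sum]
    exact Finset.sum_congr rfl fun j _ => by ring
  rw [this, div_mul_cancel₀ _ h]
  norm_num

lemma householder_mul_householder_mem {u v : Pt p} (hu : u ≠ 0) (hv : v ≠ 0) :
    householder u * householder v ∈ Matrix.specialOrthogonalGroup (Fin p) ℝ := by
  rw [Matrix.mem_specialOrthogonalGroup_iff, Matrix.mem_orthogonalGroup_iff]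
  constructor
  · change householder u * householder v * (householder u * householder v)ᵀ = 1
    rw [Matrix.transpose_mul, householder_transpose, householder_transpose, mul_assoc,
      ← mul_assoc (householder v), householder_mul_self, one_mul, householder_mul_self]
  · rw [Matrix.det_mul, det_householder hu, det_householder hv]; norm_num

/-- Carries the Cartan–Dieudonné theorem from Euclidean space to matrices. It includes `v = 0`,
where both sides are the identity since `2 / 0 = 0`. -/
lemma reflection_toLp (v : EuclideanSpace ℝ (Fin p)) (x : Pt p) :
    (ℝ ∙ v)ᗮ.reflection (WithLp.toLp 2 x) = WithLp.toLp 2 (householder (WithLp.ofLp v) *ᵥ x) := by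
  rw [Submodule.reflection_orthogonal_apply, Submodule.reflection_singleton_apply]
  ext i
  have h1 : inner ℝ v (WithLp.toLp 2 x) = WithLp.ofLp v ⬝ᵥ x := by
    rw [EuclideanSpace.inner_eq_star_dotProduct, dotProduct_comm]; rfl
  have h2 : ‖v‖ ^ 2 = WithLp.ofLp v ⬝ᵥ WithLp.ofLp v := by
    rw [← real_inner_self_eq_norm_sq, EuclideanSpace.inner_eq_star_dotProduct]; rfl
  simp only [householder, Matrix.sub_mulVec, Matrix.one_mulVec, Matrix.smul_mulVec,
    Matrix.vecMulVec_mulVec]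
  simp [h1, h2]
  ring

/-- The Cartan–Dieudonné theorem for matrices. -/
lemma exists_householder_prod (U : SO p) :
    ∃ l : List (Pt p), U.1 = (l.map householder).prod := by
  let φ₀ : EuclideanSpace ℝ (Fin p) →ₗᵢ[ℝ] EuclideanSpace ℝ (Fin p) :=
    { toLinearMap := Matrix.toEuclideanLin U.1
      norm_map' := fun x => by
        have h : ‖Matrix.toEuclideanLin U.1 x‖ ^ 2 = ‖x‖ ^ 2 := by
          rw [← real_inner_self_eq_norm_sq, ← real_inner_self_eq_norm_sq,
            EuclideanSpace.inner_eq_star_dotProduct, EuclideanSpace.inner_eq_star_dotProduct]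
          exact SO.dot_mulVec U _ _
        exact (sq_eq_sq₀ (norm_nonneg _) (norm_nonneg _)).1 h }
  obtain ⟨l, -, hl⟩ := (φ₀.toLinearIsometryEquiv rfl).reflections_generate_dim
  refine ⟨l.map WithLp.ofLp, ?_⟩
  have key : ∀ (l : List (EuclideanSpace ℝ (Fin p))) (x : Pt p),
      (l.map fun v => (ℝ ∙ v)ᗮ.reflection).prod (WithLp.toLp 2 x) =
        WithLp.toLp 2 (((l.map WithLp.ofLp).map householder).prod *ᵥ x) := by
    intro l x
    induction l with
    | nil => simp
    | cons v l ih =>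
      simp only [List.map_cons, List.prod_cons, LinearIsometryEquiv.coe_mul, Function.comp_apply,
        ih, reflection_toLp, Matrix.mulVec_mulVec]
  refine Matrix.ext_of_mulVec_single fun i => ?_
  have h := congrArg (fun φ : EuclideanSpace ℝ (Fin p) ≃ₗᵢ[ℝ] EuclideanSpace ℝ (Fin p) =>
    WithLp.ofLp (φ (WithLp.toLp 2 (Pi.single i 1)))) hl
  simp only [key] at h
  exact h

end Householder

/-! ### Lifting motions to the residual group -/

section Lift

variable {p : ℕ}

/-- The motion `h` lifts to an element `(A, h)` of the residual group. -/
def Lifts (μ : DualField p) (h : SE p) : Prop :=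
  ∃ A : Gp p, ∀ x, (A.1 x).1 *ᵥ μ.1 (h⁻¹ • x) = μ.1 x

/-- `J^G` is equivariant, so testing at the single point `(1, -μ)` of the level set suffices. -/
lemma mem_Hmu_iff (μ : DualField p) (g : Gtilde p) :
    g ∈ Hmu μ ↔ ∀ x, (g.left.1 x).1 *ᵥ μ.1 (g.right⁻¹ • x) = μ.1 x := by
  constructor
  · intro hg x
    have h := congrFun (congrArg Subtype.val (hg _ (JG_base μ))) x
    rwa [JG_smul, JG_base] at h
  · intro hg q hq
    refine Subtype.ext (funext fun x => ?_)
    rw [JG_smul, hq, hg x]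

lemma lifts_iff (μ : DualField p) (h : SE p) : Lifts μ h ↔ ∃ g ∈ Hmu μ, g.right = h := by
  constructor
  · rintro ⟨A, hA⟩
    exact ⟨⟨A, h⟩, (mem_Hmu_iff μ _).2 hA, rfl⟩
  · rintro ⟨g, hg, rfl⟩
    exact ⟨g.left, (mem_Hmu_iff μ g).1 hg⟩

lemma Lifts.one (μ : DualField p) : Lifts μ 1 :=
  (lifts_iff μ 1).2 ⟨1, one_mem _, rfl⟩

lemma Lifts.mul {μ : DualField p} {g h : SE p} (hg : Lifts μ g) (hh : Lifts μ h) :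
    Lifts μ (g * h) := by
  rw [lifts_iff] at *
  obtain ⟨a, ha, rfl⟩ := hg
  obtain ⟨b, hb, rfl⟩ := hh
  exact ⟨a * b, mul_mem ha hb, rfl⟩

/-- When the two displaced copies of `μ` are nowhere antipodal, the Cayley rotation from `μ ∘ h⁻¹`
to `μ ∘ g⁻¹` is smooth in `x`, and it is the identity where both have their value at infinity.
Composing it with a lift of `g` gives a lift of `h`. -/
lemma Lifts.of_close {μ : DualField p} (hμ : IsUnitField μ) {g h : SE p} (hg : Lifts μ g)
    (hgh : ∀ x, -1 < μ.1 (h⁻¹ • x) ⬝ᵥ μ.1 (g⁻¹ • x)) : Lifts μ h := by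
  obtain ⟨A, hA⟩ := hg
  obtain ⟨e, K, hK, he⟩ := hμ.const_at_infty
  let a : Pt p → R3 := fun x => μ.1 (h⁻¹ • x)
  let b : Pt p → R3 := fun x => μ.1 (g⁻¹ • x)
  have ha : ContDiff ℝ ∞ a := μ.2.comp (SE.contDiff_smul h⁻¹)
  have hb : ContDiff ℝ ∞ b := μ.2.comp (SE.contDiff_smul g⁻¹)
  have hs : ContDiff ℝ ∞ fun x => (1 + a x ⬝ᵥ b x)⁻¹ • (a x ⨯₃ b x) :=
    ((contDiff_const.add (contDiff_dot ha hb)).inv fun x => by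
      have := hgh x
      change 1 + μ.1 (h⁻¹ • x) ⬝ᵥ μ.1 (g⁻¹ • x) ≠ 0
      linarith).smul (contDiff_cross ha hb)
  let B : Gp p := ⟨fun x => cay ((1 + a x ⬝ᵥ b x)⁻¹ • (a x ⨯₃ b x)),
    fun i j => contDiff_cay hs i j, (fun x => h • x) '' K ∪ (fun x => g • x) '' K,
    (hK.image (SE.contDiff_smul h).continuous).union (hK.image (SE.contDiff_smul g).continuous),
    fun x hx => by
      simp only [Set.mem_union, not_or] at hx
      have h1 : a x = e := he _ fun hx' => hx.1 ⟨h⁻¹ • x, hx', smul_inv_smul h x⟩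
      have h2 : b x = e := he _ fun hx' => hx.2 ⟨g⁻¹ • x, hx', smul_inv_smul g x⟩
      simp only [h1, h2, cross_self, smul_zero, cay_zero]⟩
  refine ⟨A * B, fun x => ?_⟩
  change (A.1 x * cay ((1 + a x ⬝ᵥ b x)⁻¹ • (a x ⨯₃ b x))).1 *ᵥ a x = μ.1 x
  rw [SO.mul_mulVec, cay_mulVec_eq (hμ.unit _) (hμ.unit _) (hgh x)]
  exact hA x

/-- Motions joined by a path lift simultaneously. -/
lemma Lifts.of_path {μ : DualField p} (hμ : IsUnitField μ) {T : Type*} [TopologicalSpace T]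
    [CompactSpace T] [PreconnectedSpace T] {c : T → SE p}
    (hrot : Continuous fun t => (c t).rot.1) (htrans : Continuous fun t => (c t).trans) {s t : T}
    (hs : Lifts μ (c s)) : Lifts μ (c t) := by
  obtain ⟨e, K, hK, he⟩ := hμ.const_at_infty
  have hact : Continuous fun z : T × Pt p => c z.1 • z.2 :=
    ((hrot.comp continuous_fst).matrix_mulVec continuous_snd).add (htrans.comp continuous_fst)
  have hrotT : Continuous fun t => ((c t).rot⁻¹).1 := hrot.matrix_transpose
  have hinv : Continuous fun z : T × Pt p => (c z.1)⁻¹ • z.2 :=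
    ((hrotT.comp continuous_fst).matrix_mulVec continuous_snd).add
      ((hrotT.comp continuous_fst).matrix_mulVec (htrans.comp continuous_fst)).neg
  -- The region swept by `K` along the whole path; it is compact, and outside it every displaced
  -- field has the value at infinity.
  let K' : Set (Pt p) := (fun z : T × Pt p => c z.1 • z.2) '' (Set.univ ×ˢ K)
  have hK' : IsCompact K' := (isCompact_univ.prod hK).image hact
  have hout : ∀ t, ∀ x ∉ K', μ.1 ((c t)⁻¹ • x) = e := fun t x hx => he _ fun hx' =>
    hx ⟨(t, (c t)⁻¹ • x), ⟨Set.mem_univ _, hx'⟩, smul_inv_smul (c t) x⟩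
  -- At `t = s` the inner product is one; compactness of `K'` makes the neighbourhood of `s` uniform
  -- in `x`.
  have hclose : ∀ s, ∀ᶠ t in 𝓝 s, ∀ x, -1 < μ.1 ((c t)⁻¹ • x) ⬝ᵥ μ.1 ((c s)⁻¹ • x) := by
    intro s
    have hcont : Continuous fun z : T × Pt p =>
        μ.1 ((c z.1)⁻¹ • z.2) ⬝ᵥ μ.1 ((c s)⁻¹ • z.2) :=
      Continuous.dotProduct (μ.2.continuous.comp hinv)
        (μ.2.continuous.comp ((SE.contDiff_smul (c s)⁻¹).continuous.comp continuous_snd))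
    have h := hK'.eventually_forall_of_forall_eventually (x₀ := s)
      (P := fun t x => -1 < μ.1 ((c t)⁻¹ • x) ⬝ᵥ μ.1 ((c s)⁻¹ • x)) fun y _ =>
        hcont.continuousAt.eventually_const_lt (by simp [hμ.unit])
    filter_upwards [h] with t ht x
    by_cases hx : x ∈ K'
    · exact ht x hx
    · rw [hout t x hx, ← hout s x hx, hμ.unit]; norm_num
  -- The relation "a lift at `s` gives a lift at `t`" is transitive and holds locally in both
  -- directions, so it holds throughout the connected parameter space.
  refine PreconnectedSpace.induction₂' (fun s t => Lifts μ (c s) → Lifts μ (c t)) ?_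
    ⟨fun _ _ _ h1 h2 h => h2 (h1 h)⟩ s t hs
  intro s
  filter_upwards [hclose s] with t ht
  exact ⟨fun h => h.of_close hμ ht, fun h => h.of_close hμ fun x => by
    rw [dotProduct_comm]; exact ht x⟩

lemma lifts_translation {μ : DualField p} (hμ : IsUnitField μ) (a : Pt p) :
    Lifts μ ⟨1, a⟩ := by
  have h := Lifts.of_path hμ (T := unitInterval) (c := fun t => ⟨1, (t : ℝ) • a⟩) (s := 0) (t := 1)
    continuous_const (continuous_subtype_val.smul continuous_const)
    (by simpa using (show Lifts μ ⟨1, 0⟩ from Lifts.one μ))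
  simpa using h

/-- Rotations whose lifts are centred at the origin. -/
def LiftsRot (μ : DualField p) (M : Matrix (Fin p) (Fin p) ℝ) : Prop :=
  ∃ hM : M ∈ Matrix.specialOrthogonalGroup (Fin p) ℝ, Lifts μ ⟨⟨M, hM⟩, 0⟩

lemma LiftsRot.mul {μ : DualField p} {M N : Matrix (Fin p) (Fin p) ℝ} (hM : LiftsRot μ M)
    (hN : LiftsRot μ N) : LiftsRot μ (M * N) := by
  obtain ⟨hM, h1⟩ := hM
  obtain ⟨hN, h2⟩ := hN
  refine ⟨mul_mem hM hN, ?_⟩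
  have h := h1.mul h2
  have e : (⟨⟨M, hM⟩, 0⟩ * ⟨⟨N, hN⟩, 0⟩ : SE p) = ⟨⟨M * N, mul_mem hM hN⟩, 0⟩ := by
    ext1
    · rfl
    · simp [SE.mul_trans]
  rwa [e] at h

lemma liftsRot_one (μ : DualField p) : LiftsRot μ 1 := ⟨one_mem _, Lifts.one μ⟩

/-- The inner product of the point with `u` is `(1 - t) |u|² + t u · v`, positive for `t < 1`; at `t
= 1` the point is `v`. -/
lemma segment_ne_zero {u v : Pt p} (hu : u ≠ 0) (hv : v ≠ 0) (huv : 0 ≤ u ⬝ᵥ v)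
    (t : unitInterval) : u + (t : ℝ) • (v - u) ≠ 0 := by
  intro h
  have h1 := congrArg (fun w => u ⬝ᵥ w) h
  simp only [dotProduct_add, dotProduct_smul, dotProduct_sub, smul_eq_mul, dotProduct_zero] at h1
  have hpos : 0 < u ⬝ᵥ u := lt_of_le_of_ne (by
    simp only [dotProduct]; exact Finset.sum_nonneg fun i _ => mul_self_nonneg _)
    (dot_self_ne_zero hu).symm
  have ht0 := t.2.1
  have ht1 := t.2.2
  have h2 : (t : ℝ) = 1 := by
    by_contra hne
    have : (t : ℝ) < 1 := lt_of_le_of_ne ht1 hne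
    nlinarith [mul_nonneg ht0 huv, mul_pos (sub_pos.2 this) hpos]
  rw [h2] at h
  exact hv (by simpa using h)

/-- Moving the second vector along the segment from `u` to `v` joins the product to the identity. If
the angle is obtuse, `-v` defines the same reflection and replaces `v`. -/
lemma liftsRot_householder {μ : DualField p} (hμ : IsUnitField μ) {u v : Pt p} (hu : u ≠ 0)
    (hv : v ≠ 0) : LiftsRot μ (householder u * householder v) := by
  have main : ∀ v : Pt p, v ≠ 0 → 0 ≤ u ⬝ᵥ v → LiftsRot μ (householder u * householder v) := by
    intro v hv huv
    let w : unitInterval → Pt p := fun t => u + (t : ℝ) • (v - u)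
    have hw : ∀ t, w t ≠ 0 := segment_ne_zero hu hv huv
    have hwc : Continuous w :=
      continuous_const.add (continuous_subtype_val.smul continuous_const)
    have hdot : Continuous fun t => w t ⬝ᵥ w t := Continuous.dotProduct hwc hwc
    have hc : Continuous fun t => householder u * householder (w t) := by
      refine continuous_const.mul (continuous_const.sub (Continuous.smul
        (continuous_const.div hdot fun t => dot_self_ne_zero (hw t)) ?_))
      exact Continuous.matrix_vecMulVec hwc hwc
    have h := Lifts.of_path hμ (T := unitInterval) (s := 0) (t := 1)
      (c := fun t => ⟨⟨householder u * householder (w t),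
        householder_mul_householder_mem hu (hw t)⟩, 0⟩) hc continuous_const (by
        have e : (⟨⟨householder u * householder (w 0),
            householder_mul_householder_mem hu (hw 0)⟩, 0⟩ : SE p) = 1 := by
          ext1
          · refine Subtype.ext ?_
            change householder u * householder (w 0) = 1
            have : w 0 = u := by simp [w]
            rw [this, householder_mul_self]
          · rfl
        rw [e]
        exact Lifts.one μ)
    have hw1 : w 1 = v := by simp [w]
    rw [← hw1]
    exact ⟨householder_mul_householder_mem hu (hw 1), h⟩
  rcases le_total 0 (u ⬝ᵥ v) with h | h
  · exact main v hv h
  · rw [← householder_neg v]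
    exact main (-v) (neg_ne_zero.2 hv) (by rw [dotProduct_neg]; linarith)

/-- Induction on parity: an odd product is recorded by its determinant and by the fact that one more
reflection makes it liftable. Zero vectors contribute the identity, so parity is not that of the
length of the list. -/
lemma liftsRot_prod {μ : DualField p} (hμ : IsUnitField μ) (l : List (Pt p)) :
    LiftsRot μ (l.map householder).prod ∨ ((l.map householder).prod.det = -1 ∧
      ∀ u : Pt p, u ≠ 0 → LiftsRot μ (householder u * (l.map householder).prod)) := by
  induction l with
  | nil => exact Or.inl (liftsRot_one μ)
  | cons v l ih =>
    rw [List.map_cons, List.prod_cons]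
    by_cases hv : v = 0
    · rwa [hv, householder_zero, one_mul]
    rcases ih with ih | ih
    · refine Or.inr ⟨?_, fun u hu => ?_⟩
      · rw [Matrix.det_mul, det_householder hv,
          (Matrix.mem_specialOrthogonalGroup_iff.1 ih.1).2, mul_one]
      · rw [← mul_assoc]
        exact (liftsRot_householder hμ hu hv).mul ih
    · exact Or.inl (ih.2 v hv)

/-- Every Euclidean motion lifts to the residual group. -/
lemma lifts_all {μ : DualField p} (hμ : IsUnitField μ) (h : SE p) : Lifts μ h := by
  have hrot : Lifts μ ⟨h.rot, 0⟩ := by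
    obtain ⟨l, hl⟩ := exists_householder_prod h.rot
    rcases liftsRot_prod hμ l with h1 | h1
    · rw [← hl] at h1
      exact h1.2
    · have := h1.1
      rw [← hl, SO.det_eq_one] at this
      norm_num at this
  have e : h = ⟨1, h.trans⟩ * ⟨h.rot, 0⟩ := by
    ext1
    · simp [SE.mul_rot]
    · simp [SE.mul_trans]
  rw [e]
  exact (lifts_translation hμ h.trans).mul hrot

/-! ### The residual group and the reduced space -/

lemma mem_GmuTilde_iff (μ : DualField p) (g : Gtilde p) :
    g ∈ GmuTilde μ ↔ g.right = 1 ∧ g ∈ Hmu μ := by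
  rw [mem_Hmu_iff]
  constructor
  · rintro ⟨A, hA, rfl⟩
    refine ⟨rfl, fun x => ?_⟩
    change (A.1 x).1 *ᵥ μ.1 ((1 : SE p)⁻¹ • x) = μ.1 x
    rw [inv_one, one_smul]
    exact hA x
  · rintro ⟨h1, h2⟩
    refine ⟨g.left, fun x => ?_, SemidirectProduct.ext rfl h1.symm⟩
    have := h2 x
    rwa [h1, inv_one, one_smul] at this

lemma GmuTilde_eq (μ : DualField p) :
    GmuTilde μ = (SemidirectProduct.inl : Gp p →* Gtilde p).range ⊓ Hmu μ := by
  ext g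
  rw [mem_GmuTilde_iff, Subgroup.mem_inf, SemidirectProduct.range_inl_eq_ker_rightHom]
  rfl

/-- The first isomorphism theorem for the projection to `SE(p)`; its surjectivity is `lifts_all`. -/
lemma exists_quotient_equiv {μ : DualField p} (hμ : IsUnitField μ) :
    ∃ _ : ((GmuTilde μ).subgroupOf (Hmu μ)).Normal,
      ∃ e : (Hmu μ ⧸ (GmuTilde μ).subgroupOf (Hmu μ)) ≃* SE p,
        ∀ g : Hmu μ, e (QuotientGroup.mk g) = g.1.right := by
  let π : Hmu μ →* SE p := SemidirectProduct.rightHom.comp (Hmu μ).subtype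
  have hker : (GmuTilde μ).subgroupOf (Hmu μ) = π.ker := by
    ext g
    rw [Subgroup.mem_subgroupOf, mem_GmuTilde_iff, MonoidHom.mem_ker]
    exact ⟨fun h => h.1, fun h => ⟨h, g.2⟩⟩
  have hsurj : Function.Surjective π := fun h => by
    obtain ⟨g, hg, rfl⟩ := (lifts_iff μ h).1 (lifts_all hμ h)
    exact ⟨⟨g, hg⟩, rfl⟩
  have hnormal : ((GmuTilde μ).subgroupOf (Hmu μ)).Normal := by rw [hker]; infer_instance
  refine ⟨hnormal, (QuotientGroup.quotientMulEquivOfEq hker).trans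
    (QuotientGroup.quotientKerEquivOfSurjective π hsurj), fun g => rfl⟩

lemma mom_eq_iff {μ : DualField p} {q r : Phase p} (hq : JG q = μ) (hr : JG r = μ) :
    q.mom = r.mom ↔ ∃ g ∈ GmuTilde μ, g • q = r := by
  have hq' := (JG_eq_iff q μ).1 hq
  have hr' := (JG_eq_iff r μ).1 hr
  constructor
  · intro h
    -- Equal momenta mean that the two configurations rotate `μ` to the same field, so this quotient
    -- fixes `μ`.
    refine ⟨SemidirectProduct.inl (r.conf⁻¹ * q.conf), ⟨_, fun x => ?_, rfl⟩, ?_⟩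
    · change ((r.conf.1 x)⁻¹ * q.conf.1 x).1 *ᵥ μ.1 x = μ.1 x
      have h1 : (q.conf.1 x).1 *ᵥ μ.1 x = (r.conf.1 x).1 *ᵥ μ.1 x := by
        rw [← neg_inj, ← hq', ← hr', h]
      rw [SO.mul_mulVec, h1, SO.inv_mulVec_mulVec]
    · refine Phase.ext ?_ ?_
      · change theta p 1 q.conf * (r.conf⁻¹ * q.conf)⁻¹ = r.conf
        simp
      · rw [← h]
        refine Subtype.ext (funext fun x => ?_)
        change q.mom.1 ((1 : SE p)⁻¹ • x) = q.mom.1 x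
        rw [inv_one, one_smul]
  · rintro ⟨g, ⟨A, -, rfl⟩, rfl⟩
    refine Subtype.ext (funext fun x => ?_)
    change q.mom.1 x = q.mom.1 ((1 : SE p)⁻¹ • x)
    rw [inv_one, one_smul]

lemma act_mem_reducedSpace {μ : DualField p} (hμ : IsUnitField μ) {n : Pt p → R3}
    (hn : n ∈ reducedSpace μ) (h : SE p) : act h n ∈ reducedSpace μ := by
  obtain ⟨q, hq, rfl⟩ := hn
  obtain ⟨g, hg, rfl⟩ := (lifts_iff μ h).1 (lifts_all hμ h)
  exact ⟨g • q, hg q hq, rfl⟩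

end Lift

variable {p : ℕ}

/-! ### Equivariance -/

lemma fderiv_comp_smul {F : Type*} [NormedAddCommGroup F] [NormedSpace ℝ F] {f : Pt p → F}
    (hf : Differentiable ℝ f) (h : SE p) (x u : Pt p) :
    fderiv ℝ (fun y => f (h • y)) x u = fderiv ℝ f (h • x) (h.rot.1 *ᵥ u) := by
  have h1 : HasFDerivAt (fun y => f (h • y)) _ x :=
    (hf (h • x)).hasFDerivAt.comp x (hasFDerivAt_affine h.rot.1 h.trans x)
  rw [h1.fderiv]
  rfl

lemma rot_mulVec_seField (g : SE p) (v : se p) (x : Pt p) :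
    g.rot.1 *ᵥ seField v x = seField (seAd g v) (g • x) := by
  simp only [seField, seAd, SE.smul_def, Matrix.mulVec_add, ← Matrix.mulVec_mulVec,
    SO.inv_mulVec_mulVec]
  abel

lemma unitField_act {n : Pt p → R3} (hn : UnitField n) (h : SE p) : UnitField (act h n) := by
  refine ⟨hn.smooth.comp (SE.contDiff_smul h⁻¹), fun x => hn.unit _, ?_⟩
  obtain ⟨e, K, hK, he⟩ := hn.const_at_infty
  exact ⟨e, (fun x => h • x) '' K, hK.image (SE.contDiff_smul h).continuous, fun x hx =>
    he _ fun hx' => hx ⟨h⁻¹ • x, hx', smul_inv_smul h x⟩⟩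

lemma momForm_smul (q : Phase p) (h : SE p) (u x : Pt p) :
    momForm ((SemidirectProduct.inr h : Gtilde p) • q) u x =
      momForm q ((h⁻¹).rot.1 *ᵥ u) (h⁻¹ • x) := by
  have hconf : ∀ y, (((SemidirectProduct.inr h : Gtilde p) • q).conf).1 y =
      q.conf.1 (h⁻¹ • y) := by
    intro y
    change q.conf.1 (h⁻¹ • y) * 1⁻¹ = _
    rw [inv_one, mul_one]
  have hd : dRot ((SemidirectProduct.inr h : Gtilde p) • q).conf u x =
      dRot q.conf ((h⁻¹).rot.1 *ᵥ u) (h⁻¹ • x) := by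
    ext i j
    simp only [dRot, Matrix.of_apply, hconf]
    exact fderiv_comp_smul (differentiable_entry q.conf i j) h⁻¹ x u
  simp only [momForm, logDeriv, hd, hconf]
  rfl

lemma integral_momForm_smul (q : Phase p) (h : SE p) (v : se p) :
    ∫ x, momForm ((SemidirectProduct.inr h : Gtilde p) • q) (seField v x) x =
      ∫ x, momForm q (seField (seAd h⁻¹ v) x) x := by
  simp only [momForm_smul, rot_mulVec_seField]
  exact integral_smul h⁻¹ fun x => momForm q (seField (seAd h⁻¹ v) x) x

/-- The pure motion `(1, h)` need not preserve the level set of `μ`, but it maps it to that of `μ ∘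
h⁻¹`. The formula for the momentum there, pulled back by `h`, computes the coadjoint term of the
cocycle. -/
lemma ptMom_act_add (hp : 2 ≤ p) {q : Phase p} {μ : DualField p} (hμ : UnitField μ.1)
    (hq : JG q = μ) (h : SE p) (v : se p) :
    ptMom (act h q.mom.1) v + ptMom (act h μ.1) v =
      ∫ x, momForm q (seField (seAd h⁻¹ v) x) x := by
  let μ' : DualField p := ⟨act h μ.1, (unitField_act hμ h).smooth⟩
  have hq' : JG ((SemidirectProduct.inr h : Gtilde p) • q) = μ' := by
    refine Subtype.ext (funext fun x => ?_)
    rw [JG_smul, hq]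
    change (1 : SO 3).1 *ᵥ μ.1 (h⁻¹ • x) = μ.1 (h⁻¹ • x)
    rw [SO.one_val, Matrix.one_mulVec]
  rw [← integral_momForm_smul, integral_momForm hp (μ := μ') (unitField_act hμ h) hq']
  rfl

/-! ### The reduced momentum map -/

lemma IsReducedMomentum.eq_integral {μ : DualField p} (hμ : IsUnitField μ)
    {J : (Pt p → R3) → Module.Dual ℝ (se p)} (hJ : IsReducedMomentum μ J) {q : Phase p}
    (hq : JG q = μ) (v : se p) : J q.mom.1 v = ∫ x, momForm q (seField v x) x := by
  obtain ⟨X, hX, rfl, -⟩ := exists_lieElt hμ v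
  rw [hJ q hq X hX, momentum_sub_pairing hq]

lemma IsReducedMomentum.eq_ptMom (hp : 2 ≤ p) {μ : DualField p} (hμ : IsUnitField μ)
    {J : (Pt p → R3) → Module.Dual ℝ (se p)} (hJ : IsReducedMomentum μ J) {n : Pt p → R3}
    (hn : n ∈ reducedSpace μ) (v : se p) : J n v = ptMom n v + ptMom μ.1 v := by
  obtain ⟨q, hq, rfl⟩ := hn
  rw [hJ.eq_integral hμ hq, integral_momForm hp hμ.unitField hq]

lemma momForm_add (q : Phase p) (u w x : Pt p) :
    momForm q (u + w) x = momForm q u x + momForm q w x := by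
  simp only [momForm_eq_sum, map_add, mul_add, Finset.sum_add_distrib]

lemma momForm_smul_vec (q : Phase p) (r : ℝ) (u x : Pt p) :
    momForm q (r • u) x = r * momForm q u x := by
  simp only [momForm_eq_sum, map_smul, smul_eq_mul, Finset.mul_sum]
  exact Finset.sum_congr rfl fun s _ => by ring

/-- The momentum map at a point of the phase space, as a linear form on `se(p)`. -/
noncomputable def momDual (q : Phase p) : Module.Dual ℝ (se p) where
  toFun v := ∫ x, momForm q (seField v x) x
  map_add' v w := by
    have h : ∀ x, seField (v + w) x = seField v x + seField w x := fun x => by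
      have e : (v.1 + w.1).1 = v.1.1 + w.1.1 := rfl
      simp only [seField, Prod.fst_add, Prod.snd_add, e, Matrix.add_mulVec]
      abel
    simp only [h, momForm_add]
    exact integral_add (integrable_momForm q v) (integrable_momForm q w)
  map_smul' r v := by
    have h : ∀ x, seField (r • v) x = r • seField v x := fun x => by
      have e : (r • v.1).1 = r • v.1.1 := rfl
      simp only [seField, Prod.smul_fst, Prod.smul_snd, e, Matrix.smul_mulVec, smul_add]
    simp only [h, momForm_smul_vec, integral_const_mul, RingHom.id_apply, smul_eq_mul]

/-- By `integral_momForm`, two points over the same `n` give the same linear form. Off the reduced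
space the value is irrelevant and set to zero. -/
lemma exists_isReducedMomentum (hp : 2 ≤ p) {μ : DualField p} (hμ : IsUnitField μ) :
    ∃ J, IsReducedMomentum μ J := by
  have h : ∀ n : Pt p → R3, ∃ l : Module.Dual ℝ (se p), ∀ q : Phase p, JG q = μ →
      q.mom.1 = n → ∀ v, l v = ∫ x, momForm q (seField v x) x := by
    intro n
    by_cases hn : n ∈ reducedSpace μ
    · obtain ⟨q, hq, hqn⟩ := hn
      refine ⟨momDual q, fun r hr hrn v => ?_⟩
      change ∫ x, momForm q (seField v x) x = _
      rw [integral_momForm hp hμ.unitField hq, integral_momForm hp hμ.unitField hr, hqn, hrn]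
    · exact ⟨0, fun q hq hqn => absurd ⟨q, hq, hqn⟩ hn⟩
  choose J hJ using h
  exact ⟨J, fun q hq X _ => by rw [hJ _ q hq rfl, momentum_sub_pairing hq]⟩

/-- The terms in `n` cancel between `J(hn)` and the coadjoint term, leaving only `μ`; this is the
independence of `n`. -/
lemma sigma_eq (hp : 2 ≤ p) {μ : DualField p} (hμ : IsUnitField μ)
    {J : (Pt p → R3) → Module.Dual ℝ (se p)} (hJ : IsReducedMomentum μ J) {n : Pt p → R3}
    (hn : n ∈ reducedSpace μ) (h : SE p) (v : se p) :
    sigma J n h v = ptMom μ.1 v - ptMom (act h μ.1) v := by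
  rw [sigma, hJ.eq_ptMom hp hμ (act_mem_reducedSpace hμ hn h)]
  obtain ⟨q, hq, rfl⟩ := hn
  rw [hJ.eq_integral hμ hq, ← ptMom_act_add hp hμ.unitField hq]
  ring

/-! ### Functional derivatives -/

lemma hasFunctionalDeriv_ptMom (hp : 2 ≤ p) {S : Set (Pt p → R3)} (hS : ∀ n ∈ S, UnitField n)
    {n : Pt p → R3} (hn : n ∈ S) (v : se p) :
    HasFunctionalDeriv S (fun m => ptMom m v) n fun x => grad n (seField v x) x ⨯₃ n x := by
  have hu := hS n hn
  refine ⟨contDiff_cross (hu.contDiff_grad (contDiff_affine v.1.1 v.2)) hu.smooth,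
    fun x => by rw [dotProduct_comm, dot_cross_self], fun c hc => ?_⟩
  obtain ⟨e, K, hK, he⟩ := hu.const_at_infty
  obtain ⟨K', hK', he'⟩ := hc.supp
  obtain ⟨L, hL, hL'⟩ := hasFDerivAt_ptMom hp hc.smooth (θ := 0)
    (Filter.Eventually.of_forall fun t x => (hS _ (hc.mem t)).unit x) (hK.union hK') (e := e)
    (Filter.Eventually.of_forall fun t x hx => by
      simp only [Set.mem_union, not_or] at hx
      change c t x = e
      rw [he' t x hx.2, he x hx.1]) v
  have h := hL.hasDerivAt
  rw [hL'] at h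
  refine h.congr_deriv ?_
  simp only [hc.at_zero]
  congr 1; funext x
  congr 1
  have h1 : HasDerivAt (fun t => c t x)
      (fderiv ℝ (fun z : ℝ × Pt p => c z.1 z.2) (0, x) (1, 0)) 0 :=
    HasFDerivAt.comp_hasDerivAt (0 : ℝ) (f := fun t : ℝ => (t, x))
      ((hc.smooth.differentiable (by simp) (0, x)).hasFDerivAt)
      ((hasDerivAt_id' (0 : ℝ)).prodMk (hasDerivAt_const (0 : ℝ) x))
  exact h1.deriv.symm

lemma HasFunctionalDeriv.congr_add {S : Set (Pt p → R3)} {F G : (Pt p → R3) → ℝ}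
    {n D : Pt p → R3} {C : ℝ} (h : HasFunctionalDeriv S F n D) (hFG : ∀ m ∈ S, G m = F m + C) :
    HasFunctionalDeriv S G n D := by
  refine ⟨h.smooth, h.tangent, fun c hc => ?_⟩
  have e : (fun t => G (c t)) = fun t => F (c t) + C := funext fun t => hFG _ (hc.mem t)
  rw [e]
  exact (h.deriv c hc).add_const C

/-- The variation of a field by the rotations with Rodrigues vectors `t ξ / 2`. -/
lemma isVariation_cay {μ : DualField p} {n : Pt p → R3} (hn : n ∈ reducedSpace μ)
    {ξ : Pt p → R3} (hξ : ContDiff ℝ ∞ ξ) (hc : HasCompactSupport ξ) :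
    IsVariation (reducedSpace μ) n fun t x => (cay ((t / 2) • ξ x)).1 *ᵥ n x := by
  obtain ⟨q, hq, rfl⟩ := hn
  have hq' := (JG_eq_iff q μ).1 hq
  have hzero : ∀ x ∉ tsupport ξ, ξ x = 0 := fun x hx => image_eq_zero_of_notMem_tsupport hx
  refine ⟨fun t => ?_, ?_, ?_, tsupport ξ, hc, fun t x hx => ?_⟩
  · let A : Gp p := ⟨fun x => cay ((t / 2) • ξ x), fun i j => contDiff_cay (hξ.const_smul _) i j,
      tsupport ξ, hc, fun x hx => by simp only [hzero x hx, smul_zero, cay_zero]⟩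
    refine ⟨⟨A * q.conf, ⟨fun x => (A.1 x).1 *ᵥ q.mom.1 x, contDiff_mulVec A q.mom.2⟩⟩, ?_, rfl⟩
    rw [JG_eq_iff]
    intro x
    change (A.1 x).1 *ᵥ q.mom.1 x = -((A.1 x * q.conf.1 x).1 *ᵥ μ.1 x)
    rw [SO.mul_mulVec, hq' x, Matrix.mulVec_neg]
  · funext x
    rw [zero_div, zero_smul, cay_zero, SO.one_val, Matrix.one_mulVec]
  · have h1 : ContDiff ℝ ∞ fun z : ℝ × Pt p => (z.1 / 2) • ξ z.2 :=
      (contDiff_fst.div_const 2).smul (hξ.comp contDiff_snd)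
    rw [contDiff_pi]
    intro i
    simp only [mulVec3]
    have h2 := contDiff_pi.1 (q.mom.2.comp (contDiff_snd (E := ℝ)))
    exact (((contDiff_cay h1 i 0).mul (h2 0)).add ((contDiff_cay h1 i 1).mul (h2 1))).add
      ((contDiff_cay h1 i 2).mul (h2 2))
  · rw [hzero x hx, smul_zero, cay_zero, SO.one_val, Matrix.one_mulVec]

/-- A Rodrigues vector has length the tangent of half the angle, so `t / 2` gives angular velocity
`a` at `t = 0`. -/
lemma deriv_cay (a v : R3) : deriv (fun t : ℝ => (cay ((t / 2) • a)).1 *ᵥ v) 0 = a ⨯₃ v := by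
  have e : ∀ t : ℝ, (cay ((t / 2) • a)).1 *ᵥ v = (1 + (t / 2) ^ 2 * (a ⬝ᵥ a))⁻¹ •
      ((1 - (t / 2) ^ 2 * (a ⬝ᵥ a)) • v + ((t / 2) ^ 2 * (2 * (a ⬝ᵥ v))) • a + t • (a ⨯₃ v)) := by
    intro t
    change cayMatrix _ *ᵥ v = _
    rw [cayMatrix_mulVec]
    simp only [smul_dotProduct, dotProduct_smul, map_smul, LinearMap.smul_apply, smul_eq_mul,
      smul_smul]
    ext i
    simp only [Pi.smul_apply, Pi.add_apply, smul_eq_mul]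
    ring
  simp only [e]
  have hsq : HasDerivAt (fun t : ℝ => (t / 2) ^ 2) 0 0 := by
    simpa using ((hasDerivAt_id (0 : ℝ)).div_const 2).fun_pow 2
  have h1 := ((hsq.mul_const (a ⬝ᵥ a)).const_add 1).fun_inv (by norm_num)
  have h2 := (((hsq.mul_const (a ⬝ᵥ a)).const_sub 1).smul_const v).fun_add
    ((hsq.mul_const (2 * (a ⬝ᵥ v))).smul_const a)
  have h3 := (h2.fun_add ((hasDerivAt_id (0 : ℝ)).smul_const (a ⨯₃ v)))
  refine (h1.fun_smul h3).deriv.trans ?_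
  simp

/-- With `d = D - D'` and a bump `χ`, rotating `n` about `χ (n × d)` has initial velocity `χ d`,
since `d` is tangent. Comparing derivatives gives `∫ χ |d|² = 0`, so `d` vanishes at the centre of
the bump. -/
lemma HasFunctionalDeriv.unique {μ : DualField p} (hμ : UnitField μ.1) {n : Pt p → R3}
    (hn : n ∈ reducedSpace μ) {F : (Pt p → R3) → ℝ} {D D' : Pt p → R3}
    (h : HasFunctionalDeriv (reducedSpace μ) F n D)
    (h' : HasFunctionalDeriv (reducedSpace μ) F n D') : D = D' := by
  have hu := unitField_of_mem_reducedSpace hμ hn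
  funext x₀
  let d : Pt p → R3 := fun x => D x - D' x
  have hd : ContDiff ℝ ∞ d := h.smooth.sub h'.smooth
  have hdn : ∀ x, d x ⬝ᵥ n x = 0 := fun x => by
    simp only [d, sub_dotProduct, h.tangent, h'.tangent, sub_zero]
  let χ : ContDiffBump x₀ := default
  let ξ : Pt p → R3 := fun x => χ x • (n x ⨯₃ d x)
  have hξ : ContDiff ℝ ∞ ξ := χ.contDiff.smul (contDiff_cross hu.smooth hd)
  have hξc : HasCompactSupport ξ := χ.hasCompactSupport.smul_right
  have hvar := isVariation_cay hn hξ hξc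
  have hder : ∀ x, ξ x ⨯₃ n x = χ x • d x := fun x => by
    simp only [ξ, map_smul, LinearMap.smul_apply, cross_cross_unit (hu.unit x) (hdn x)]
  have e := (h.deriv _ hvar).unique (h'.deriv _ hvar)
  simp only [deriv_cay, hder] at e
  have hcs : HasCompactSupport fun x => χ x • d x := χ.hasCompactSupport.smul_right
  have hcc : Continuous fun x => χ x • d x := χ.continuous.smul hd.continuous
  have hinteg : ∀ {D : Pt p → R3}, Continuous D → Integrable fun x => D x ⬝ᵥ (χ x • d x) :=
    fun hD => (Continuous.dotProduct hD hcc).integrable_of_hasCompactSupport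
      (hcs.mono fun x hx hx' => hx (by simp only at hx' ⊢; rw [hx', dotProduct_zero]))
  rw [← sub_eq_zero, ← integral_sub (hinteg h.smooth.continuous) (hinteg h'.smooth.continuous)] at e
  have e2 : ∀ x, D x ⬝ᵥ (χ x • d x) - D' x ⬝ᵥ (χ x • d x) = χ x * (d x ⬝ᵥ d x) := fun x => by
    rw [← sub_dotProduct, dotProduct_smul, smul_eq_mul]
  simp only [e2] at e
  have hnn : ∀ x, 0 ≤ d x ⬝ᵥ d x := fun x => by
    simp only [dotProduct]; exact Finset.sum_nonneg fun i _ => mul_self_nonneg _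
  by_contra hne
  have hpos := Continuous.integral_pos_of_hasCompactSupport_nonneg_nonzero (μ := volume)
    (f := fun x => χ x * (d x ⬝ᵥ d x)) (x := x₀)
    (χ.continuous.mul (Continuous.dotProduct hd.continuous hd.continuous))
    χ.hasCompactSupport.mul_right (fun x => mul_nonneg χ.nonneg (hnn x)) (by
      have h1 : χ x₀ = 1 := χ.one_of_mem_closedBall (Metric.mem_closedBall_self χ.rIn_pos.le)
      rw [h1, one_mul]
      exact fun h0 => hne (sub_eq_zero.1 (dotProduct_self_eq_zero.1 h0)))
  exact hpos.ne e.symm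

/-- The Poisson bracket of functionals that differ from `L_Ω + aⁱ P_i` by constants. -/
lemma hasPoissonBracket_of_ptMom (hp : 2 ≤ p) {μ : DualField p} (hμ : IsUnitField μ)
    {n : Pt p → R3} (hn : n ∈ reducedSpace μ) {F K : (Pt p → R3) → ℝ} {v w : se p} {C C' : ℝ}
    (hF : ∀ m ∈ reducedSpace μ, F m = ptMom m v + C)
    (hK : ∀ m ∈ reducedSpace μ, K m = ptMom m w + C') :
    HasPoissonBracket (reducedSpace μ) F K n
      (∫ x, n x ⬝ᵥ (grad n (seField v x) x ⨯₃ grad n (seField w x) x)) := by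
  have hS : ∀ n ∈ reducedSpace μ, UnitField n :=
    fun n hn => unitField_of_mem_reducedSpace hμ.unitField hn
  have hDF := (hasFunctionalDeriv_ptMom hp hS hn v).congr_add hF
  have hDK := (hasFunctionalDeriv_ptMom hp hS hn w).congr_add hK
  refine ⟨⟨_, hDF⟩, ⟨_, hDK⟩, fun DF DK h1 h2 => ?_⟩
  rw [h1.unique hμ.unitField hn hDF, h2.unique hμ.unitField hn hDK]
  congr 1; funext x
  exact triple_cross_unit ((hS n hn).unit x) _ _

/-! ### The derivative of the cocycle -/

lemma norm_mulVec_le (D : Fin p → Fin p → ℝ) (x : Pt p) :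
    ‖Matrix.of D *ᵥ x‖ ≤ p * ‖D‖ * ‖x‖ := by
  refine (pi_norm_le_iff_of_nonneg (by positivity)).2 fun i => ?_
  calc ‖∑ j, D i j * x j‖ ≤ ∑ j : Fin p, ‖D‖ * ‖x‖ := norm_sum_le_of_le _ fun j _ => by
        rw [norm_mul]
        exact mul_le_mul ((norm_le_pi_norm (D i) j).trans (norm_le_pi_norm D i))
          (norm_le_pi_norm x j) (norm_nonneg _) (norm_nonneg _)
    _ = p * ‖D‖ * ‖x‖ := by simp [mul_assoc]

/-- The field `μ` composed with the affine map with matrix `N` and translation `s`. -/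
def affineFamily (μ : Pt p → R3) (z : ((Fin p → Fin p → ℝ) × Pt p) × Pt p) : R3 :=
  μ (Matrix.of z.1.1 *ᵥ z.2 + z.1.2)

/-- The identity, as a parameter of `affineFamily`. -/
def affineOne (p : ℕ) : (Fin p → Fin p → ℝ) × Pt p := (fun i j => (1 : Matrix _ _ ℝ) i j, 0)

lemma affineFamily_one (μ : Pt p → R3) (x : Pt p) : affineFamily μ (affineOne p, x) = μ x := by
  change μ ((1 : Matrix _ _ ℝ) *ᵥ x + 0) = μ x
  rw [Matrix.one_mulVec, add_zero]

lemma contDiff_affineFamily {μ : Pt p → R3} (hμ : ContDiff ℝ ∞ μ) :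
    ContDiff ℝ ∞ (affineFamily μ) := by
  refine hμ.comp (contDiff_pi.2 fun i => ?_)
  simp only [Pi.add_apply, Matrix.mulVec, dotProduct, Matrix.of_apply]
  refine (ContDiff.sum fun j _ => ContDiff.mul ?_ ?_).add ?_
  · exact contDiff_pi.1 (contDiff_pi.1 (contDiff_fst.comp contDiff_fst) i) j
  · exact contDiff_pi.1 contDiff_snd j
  · exact contDiff_pi.1 (contDiff_snd.comp contDiff_fst) i

/-- Affine maps close to the identity pull the set where `μ` varies back into one fixed ball.
Allowing all affine maps makes the parameter space a vector space, where the first variation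
applies. -/
lemma affineFamily_const {μ : Pt p → R3} (hμ : UnitField μ) :
    ∃ (e : R3) (K : Set (Pt p)), IsCompact K ∧
      ∀ᶠ θ in 𝓝 (affineOne p), ∀ x ∉ K, affineFamily μ (θ, x) = e := by
  obtain ⟨e, K, hK, he⟩ := hμ.const_at_infty
  obtain ⟨R, hR⟩ := hK.isBounded.subset_closedBall (0 : Pt p)
  refine ⟨e, Metric.closedBall 0 (2 * (R + 1)), isCompact_closedBall _ _, ?_⟩
  -- A matrix whose entries are at most this size stretches vectors by at most `1/2`; then `|x| ≤ R
  -- + |x|/2 + 1`, whence the radius `2 (R + 1)`.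
  have hr : (0 : ℝ) < 1 / (2 * (p + 1)) := by positivity
  filter_upwards [Metric.ball_mem_nhds (affineOne p) hr] with θ hθ x hx
  refine he _ fun hx' => hx ?_
  have h1 := hR hx'
  rw [mem_closedBall_zero_iff] at h1 ⊢
  rw [mem_ball_iff_norm] at hθ
  have hN : ‖θ.1 - (affineOne p).1‖ ≤ 1 / (2 * (p + 1)) := (norm_fst_le _).trans hθ.le
  have hs : ‖θ.2‖ ≤ 1 := by
    have : ‖θ.2 - (affineOne p).2‖ ≤ 1 / (2 * (p + 1)) := (norm_snd_le _).trans hθ.le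
    have h2 : (affineOne p).2 = 0 := rfl
    rw [h2, sub_zero] at this
    refine this.trans ?_
    rw [div_le_one (by positivity)]
    have : (0 : ℝ) ≤ p := by positivity
    linarith
  have e1 : x = (Matrix.of θ.1 *ᵥ x + θ.2) - Matrix.of (θ.1 - (affineOne p).1) *ᵥ x - θ.2 := by
    have h3 : Matrix.of (θ.1 - (affineOne p).1) = Matrix.of θ.1 - 1 := rfl
    rw [h3, Matrix.sub_mulVec, Matrix.one_mulVec]
    abel
  have h4 := norm_mulVec_le (θ.1 - (affineOne p).1) x
  have h5 : p * ‖θ.1 - (affineOne p).1‖ ≤ 1 / 2 := by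
    calc (p : ℝ) * ‖θ.1 - (affineOne p).1‖ ≤ p * (1 / (2 * (p + 1))) := by gcongr
      _ ≤ 1 / 2 := by
        rw [mul_one_div, div_le_div_iff₀ (by positivity) (by norm_num)]
        linarith
  have h6 : ‖x‖ ≤ R + 1 / 2 * ‖x‖ + 1 := by
    calc ‖x‖ = ‖(Matrix.of θ.1 *ᵥ x + θ.2) - Matrix.of (θ.1 - (affineOne p).1) *ᵥ x - θ.2‖ := by
          rw [← e1]
      _ ≤ ‖Matrix.of θ.1 *ᵥ x + θ.2‖ + ‖Matrix.of (θ.1 - (affineOne p).1) *ᵥ x‖ + ‖θ.2‖ :=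
          (norm_sub_le _ _).trans (add_le_add_left (norm_sub_le _ _) _)
      _ ≤ R + 1 / 2 * ‖x‖ + 1 := by
          have := mul_le_mul_of_nonneg_right h5 (norm_nonneg x)
          gcongr
          exact h4.trans this
  linarith

lemma fderiv_affineFamily {μ : Pt p → R3} (hμ : ContDiff ℝ ∞ μ) (w : se p) (x : Pt p) :
    fderiv ℝ (affineFamily μ) (affineOne p, x) ((fun i j => -w.1.1 i j, -w.2), 0) =
      -grad μ (seField w x) x := by
  set δ : (Fin p → Fin p → ℝ) × Pt p := (fun i j => -w.1.1 i j, -w.2) with hδ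
  have hline : HasDerivAt (fun t : ℝ => ((affineOne p + t • δ, x) :
      ((Fin p → Fin p → ℝ) × Pt p) × Pt p)) (δ, 0) 0 := by
    refine HasDerivAt.prodMk ?_ (hasDerivAt_const (0 : ℝ) x)
    simpa using ((hasDerivAt_id (0 : ℝ)).smul_const δ).const_add (affineOne p)
  have h1 : HasDerivAt (fun t : ℝ => affineFamily μ (affineOne p + t • δ, x))
      (fderiv ℝ (affineFamily μ) (affineOne p, x) (δ, 0)) 0 := by
    have h0 : HasFDerivAt (affineFamily μ) (fderiv ℝ (affineFamily μ) (affineOne p, x))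
        (affineOne p + (0 : ℝ) • δ, x) := by
      rw [zero_smul, add_zero]
      exact ((contDiff_affineFamily hμ).differentiable (by simp) (affineOne p, x)).hasFDerivAt
    exact h0.comp_hasDerivAt (0 : ℝ) hline
  have e : ∀ t : ℝ, affineFamily μ (affineOne p + t • δ, x) = μ (x + t • (-seField w x)) := by
    intro t
    have h2 : Matrix.of (affineOne p + t • δ).1 = 1 + t • (-w.1.1) := rfl
    have h3 : (affineOne p + t • δ).2 = t • (-w.2) := by simp [hδ, affineOne]
    change μ (Matrix.of (affineOne p + t • δ).1 *ᵥ x + (affineOne p + t • δ).2) = _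
    rw [h2, h3, Matrix.add_mulVec, Matrix.one_mulVec, Matrix.smul_mulVec, Matrix.neg_mulVec,
      seField, neg_add, smul_add, add_assoc]
  simp only [e] at h1
  have h4 : HasDerivAt (fun t : ℝ => x + t • (-seField w x)) (-seField w x) 0 := by
    simpa using ((hasDerivAt_id (0 : ℝ)).smul_const (-seField w x)).const_add x
  have h5 : HasDerivAt (fun t : ℝ => μ (x + t • (-seField w x)))
      (fderiv ℝ μ x (-seField w x)) 0 := by
    have h0 : HasFDerivAt μ (fderiv ℝ μ x) (x + (0 : ℝ) • (-seField w x)) := by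
      rw [zero_smul, add_zero]
      exact (hμ.differentiable (by simp) x).hasFDerivAt
    exact h0.comp_hasDerivAt (0 : ℝ) h4
  rw [h1.unique h5, map_neg]
  rfl

lemma so_apply (Ω : so p) (i j : Fin p) : Ω.1 j i = -Ω.1 i j :=
  congrFun (congrFun ((LieAlgebra.Orthogonal.mem_so (Fin p) ℝ Ω.1).1 Ω.2) i) j

/-- The derivative of the cocycle at the identity. -/
lemma hasDerivAt_ptMom_act (hp : 2 ≤ p) {μ : Pt p → R3} (hμ : UnitField μ) (v w : se p)
    {γ : ℝ → SE p} (hγ : IsTangentCurve γ w) :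
    HasDerivAt (fun ε => ptMom (act (γ ε) μ) v) (-Sigma2 μ v w) 0 := by
  obtain ⟨e, K, hK, he⟩ := affineFamily_const hμ
  obtain ⟨L, hL, hL'⟩ := hasFDerivAt_ptMom hp (contDiff_affineFamily hμ.smooth)
    (Filter.Eventually.of_forall fun θ x => hμ.unit _) hK he v
  -- The curve of inverses, because a motion acts on fields by composition with its inverse; its
  -- velocity is therefore minus that of `γ`.
  let κ : ℝ → (Fin p → Fin p → ℝ) × Pt p := fun ε =>
    (fun i j => ((γ ε)⁻¹).rot.1 i j, ((γ ε)⁻¹).trans)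
  have hκ0 : κ 0 = affineOne p := by
    simp only [κ, hγ.at_zero, inv_one]
    rfl
  have hrot : ∀ i j, HasDerivAt (fun ε => ((γ ε)⁻¹).rot.1 i j) ((-w.1.1) i j) 0 := fun i j => by
    have h := hγ.rot j i
    rw [so_apply] at h
    exact h
  have hκ : HasDerivAt κ (fun i j => -w.1.1 i j, -w.2) 0 := by
    refine HasDerivAt.prodMk ?_ ?_
    · exact hasDerivAt_pi.2 fun i => hasDerivAt_pi.2 fun j => hrot i j
    · have h := (hasDerivAt_mulVec_zero hrot hγ.trans).fun_neg
      refine h.congr_deriv ?_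
      simp only [hγ.at_zero, inv_one, SE.one_rot, SE.one_trans, SO.one_val, Matrix.mulVec_zero,
        Matrix.one_mulVec, zero_add]
  have h := HasFDerivAt.comp_hasDerivAt (0 : ℝ) (f := κ) (hκ0 ▸ hL) hκ
  refine h.congr_deriv ?_
  rw [hL', Sigma2, neg_neg]
  congr 1; funext x
  simp only [fderiv_affineFamily hμ.smooth, affineFamily_one, dotProduct_neg]
  simp only [dot3, cross3_0, cross3_1, cross3_2]
  ring

/-! ### Symmetric fields -/

lemma grad_mulVec {n : Pt p → R3} (hn : Differentiable ℝ n) (R : SO 3) (u x : Pt p) :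
    grad (fun y => R.1 *ᵥ n y) u x = R.1 *ᵥ grad n u x := by
  have h : HasFDerivAt (fun y => R.1 *ᵥ n y) _ x :=
    ((Matrix.mulVecLin R.1).toContinuousLinearMap.hasFDerivAt).comp x (hn x).hasFDerivAt
  rw [grad, h.fderiv]
  rfl

lemma ptMom_mulVec {n : Pt p → R3} (hn : Differentiable ℝ n) (R : SO 3) (v : se p) :
    ptMom (fun y => R.1 *ᵥ n y) v = ptMom n v := by
  simp only [ptMom, PTrot, PT, grad_mulVec hn, SO.triple_mulVec]

lemma exp_mem_SO (Ω : so p) : NormedSpace.exp Ω.1 ∈ Matrix.specialOrthogonalGroup (Fin p) ℝ := by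
  have horth : ∀ Ω : so p, NormedSpace.exp Ω.1 * (NormedSpace.exp Ω.1)ᵀ = 1 := fun Ω => by
    rw [← Matrix.exp_transpose, (LieAlgebra.Orthogonal.mem_so (Fin p) ℝ Ω.1).1 Ω.2,
      ← Matrix.exp_add_of_commute _ _ (Commute.refl Ω.1).neg_right, add_neg_cancel,
      NormedSpace.exp_zero]
  rw [Matrix.mem_specialOrthogonalGroup_iff, Matrix.mem_orthogonalGroup_iff]
  refine ⟨horth Ω, ?_⟩
  -- The determinant of `exp Ω` is the square of that of `exp (Ω/2)`, hence one; orthogonality alone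
  -- would leave the sign open.
  have h1 := congrArg Matrix.det (horth ((1 / 2 : ℝ) • Ω))
  rw [Matrix.det_mul, Matrix.det_transpose, Matrix.det_one, ← Matrix.det_mul,
    ← Matrix.exp_add_of_commute _ _ (Commute.refl _)] at h1
  rw [← h1]
  congr 2
  have e : ((1 / 2 : ℝ) • Ω).1 = (1 / 2 : ℝ) • Ω.1 := rfl
  rw [e, ← add_smul]
  norm_num

lemma isTangentCurve_exp (Ω : so p) :
    IsTangentCurve (fun ε => ⟨⟨NormedSpace.exp (ε • Ω).1, exp_mem_SO (ε • Ω)⟩, 0⟩ : ℝ → SE p)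
      (Ω, 0) := by
  refine ⟨?_, fun i j => hasDerivAt_exp_smul_entry Ω.1 i j, hasDerivAt_const _ _⟩
  ext1
  · refine Subtype.ext ?_
    change NormedSpace.exp ((0 : ℝ) • Ω.1) = 1
    rw [zero_smul, NormedSpace.exp_zero]
  · rfl

/-- Rotating a symmetric `μ` only applies a constant rotation to its values, which leaves `ptMom`
unchanged. Its derivative along `exp (ε Ω)` is therefore zero, and that derivative is minus this
value of `Sigma2`. -/
lemma Sigma2_rot_eq_zero (hp : 2 ≤ p) {μ : Pt p → R3} (hμ : UnitField μ)
    (hs : IsSphericallySymmetric μ) (v : se p) (Ω : so p) : Sigma2 μ v (Ω, 0) = 0 := by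
  have h := hasDerivAt_ptMom_act hp hμ v (Ω, 0) (isTangentCurve_exp Ω)
  have hconst : ∀ U : SO p, ptMom (act ⟨U, 0⟩ μ) v = ptMom μ v := by
    intro U
    obtain ⟨R, hR⟩ := hs U⁻¹
    have e : act ⟨U, 0⟩ μ = fun y => R.1 *ᵥ μ y := by
      funext y
      rw [← hR]
      change μ ((U⁻¹).1 *ᵥ y + -((U⁻¹).1 *ᵥ 0)) = _
      rw [Matrix.mulVec_zero, neg_zero, add_zero]
    rw [e, ptMom_mulVec hμ.differentiable]
  simp only [hconst] at h
  have := h.unique (hasDerivAt_const (0 : ℝ) (ptMom μ v))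
  linarith

lemma Sigma2_antisymm (μ : Pt p → R3) (v w : se p) : Sigma2 μ v w = -Sigma2 μ w v := by
  rw [Sigma2, Sigma2, neg_neg, ← integral_neg]
  congr 1; funext x
  rw [← dotProduct_neg, cross_anticomm]

lemma seField_split (v : se p) (x : Pt p) :
    seField v x = seField (v.1, 0) x + seField (0, v.2) x := by
  simp [seField]

lemma Sigma2_split {μ : Pt p → R3} (hμ : UnitField μ) (v w : se p) :
    Sigma2 μ v w = Sigma2 μ v (w.1, 0) + Sigma2 μ v (0, w.2) := by
  simp only [Sigma2]
  rw [← neg_add, ← integral_add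
    (hμ.integrable_triple (continuous_seField v) (continuous_seField _))
    (hμ.integrable_triple (continuous_seField v) (continuous_seField _))]
  congr 2; funext x
  rw [seField_split w, ← dotProduct_add, ← map_add]
  simp only [grad, map_add]

/-- The cocycle of a spherically symmetric field only involves translations. -/
lemma Sigma2_of_symmetric (hp : 2 ≤ p) {μ : Pt p → R3} (hμ : UnitField μ)
    (hs : IsSphericallySymmetric μ) (v w : se p) :
    Sigma2 μ v w = -∫ x, μ x ⬝ᵥ (grad μ v.2 x ⨯₃ grad μ w.2 x) := by
  rw [Sigma2_split hμ, Sigma2_rot_eq_zero hp hμ hs, zero_add, Sigma2_antisymm, Sigma2_split hμ,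
    Sigma2_rot_eq_zero hp hμ hs, zero_add, ← Sigma2_antisymm, Sigma2]
  simp [seField]

/-- The rotation by `π` in the plane of the coordinates `i` and `j`. -/
lemma exists_flip {i j : Fin p} (hij : i ≠ j) :
    ∃ U : SO p, U.1 *ᵥ Pi.single i 1 = -Pi.single i 1 := by
  let d : Fin p → ℝ := fun k => if k = i then -1 else if k = j then -1 else 1
  have hd : ∀ k, d k * d k = 1 := fun k => by
    simp only [d]; split_ifs <;> norm_num
  refine ⟨⟨Matrix.diagonal d, ?_⟩, ?_⟩
  · rw [Matrix.mem_specialOrthogonalGroup_iff, Matrix.mem_orthogonalGroup_iff]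
    constructor
    · change Matrix.diagonal d * (Matrix.diagonal d)ᵀ = 1
      rw [Matrix.diagonal_transpose, Matrix.diagonal_mul_diagonal, ← Matrix.diagonal_one]
      congr 1; funext k; exact hd k
    · rw [Matrix.det_diagonal, ← Finset.mul_prod_erase _ _ (Finset.mem_univ i),
        ← Finset.mul_prod_erase _ _ (Finset.mem_erase.2 ⟨hij.symm, Finset.mem_univ j⟩),
        Finset.prod_eq_one]
      · simp [d, hij.symm]
      · intro k hk
        simp only [Finset.mem_erase] at hk
        simp [d, hk.1, hk.2.1]
  · ext k
    simp only [Matrix.mulVec_diagonal, Pi.neg_apply, Pi.single_apply, d]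
    split_ifs <;> simp

/-- A half turn reversing `e_i` makes the integrand odd, because the rotation of values drops out of
the triple product. The second axis of the half turn needs `2 ≤ p`. -/
lemma PT_of_symmetric (hp : 2 ≤ p) {μ : Pt p → R3} (hμ : UnitField μ)
    (hs : IsSphericallySymmetric μ) (i : Fin p) : PT i μ = 0 := by
  obtain ⟨j, hij⟩ : ∃ j : Fin p, i ≠ j := by
    have : Nontrivial (Fin p) := Fin.nontrivial_iff_two_le.2 hp
    obtain ⟨j, hj⟩ := exists_ne i
    exact ⟨j, hj.symm⟩
  obtain ⟨U, hU⟩ := exists_flip hij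
  obtain ⟨R, hR⟩ := hs U
  let h : SE p := ⟨U, 0⟩
  have hact : ∀ x, h • x = U.1 *ᵥ x := fun x => by rw [SE.smul_def]; exact add_zero _
  have hgrad : ∀ u x, grad μ (U.1 *ᵥ u) (h • x) = R.1 *ᵥ grad μ u x := by
    intro u x
    rw [← grad_mulVec hμ.differentiable]
    have e : (fun y => R.1 *ᵥ μ y) = fun y => μ (h • y) := by
      funext y; rw [hact, hR]
    rw [e]
    exact (fderiv_comp_smul hμ.differentiable h x u).symm
  let f : Pt p → ℝ := fun x => μ x ⬝ᵥ (grad μ (Pi.single i 1) x ⨯₃ grad μ x x)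
  have hf : ∀ x, f (h • x) = -f x := by
    intro x
    have h1 : grad μ (Pi.single i 1) (h • x) = R.1 *ᵥ (-grad μ (Pi.single i 1) x) := by
      have : (Pi.single i 1 : Pt p) = U.1 *ᵥ (-Pi.single i 1) := by
        rw [Matrix.mulVec_neg, hU, neg_neg]
      conv_lhs => rw [this]
      rw [hgrad, grad, map_neg]
      rfl
    have h2 : grad μ (h • x) (h • x) = R.1 *ᵥ grad μ x x := by
      conv_lhs => rw [show grad μ (h • x) (h • x) = grad μ (U.1 *ᵥ x) (h • x) by rw [hact]]
      exact hgrad x x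
    have h3 : μ (h • x) = R.1 *ᵥ μ x := by rw [hact, hR]
    simp only [f, h1, h2, h3, SO.triple_mulVec, map_neg, LinearMap.neg_apply, dotProduct_neg]
  have hinteg := integral_smul h f
  simp only [hf, integral_neg] at hinteg
  have h0 : ∫ x, f x = 0 := by linarith
  change 1 / ((p : ℝ) - 1) * ∫ x, f x = 0
  rw [h0, mul_zero]

lemma IsRadial.isSphericallySymmetric {μ : Pt p → R3} (h : IsRadial μ) :
    IsSphericallySymmetric μ := by
  obtain ⟨f, hf⟩ := h
  refine fun U => ⟨1, fun x => ?_⟩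
  rw [SO.one_val, Matrix.one_mulVec, hf, hf, SO.dot_mulVec]

/-- A radial field is constant along the orbits of `exp (ε Ω)`, so its derivative along `Ω x`
vanishes. -/
lemma PTrot_of_radial {μ : Pt p → R3} (hμ : UnitField μ) (h : IsRadial μ) (Ω : so p) :
    PTrot Ω μ = 0 := by
  obtain ⟨f, hf⟩ := h
  have hg : ∀ x, grad μ (Ω.1 *ᵥ x) x = 0 := by
    intro x
    have h1 := hasDerivAt_comp_seCurveInv (hμ.differentiable x) ((Ω, 0) : se p)
    have e : ∀ ε : ℝ, μ (seCurveInv ((Ω, 0) : se p) ε x) = μ x := by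
      intro ε
      have h2 : seCurveInv ((Ω, 0) : se p) ε x =
          (⟨NormedSpace.exp (-(ε • Ω)).1, exp_mem_SO _⟩ : SO p).1 *ᵥ x := by
        simp [seCurveInv]
      rw [h2, hf, hf, SO.dot_mulVec]
    simp only [e] at h1
    have h3 := h1.unique (hasDerivAt_const (0 : ℝ) (μ x))
    rw [neg_eq_zero] at h3
    simpa [seField, grad] using h3
  simp [PTrot, hg]

/-! ### The planar case -/

lemma grad_planar (n : Pt 2 → R3) (a x : Pt 2) :
    grad n a x = a 0 • grad n (Pi.single 0 1) x + a 1 • grad n (Pi.single 1 1) x := by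
  rw [grad_eq_sum, Fin.sum_univ_two]

lemma integral_planar (n : Pt 2 → R3) (a b : Pt 2) :
    ∫ x, n x ⬝ᵥ (grad n a x ⨯₃ grad n b x) = 4 * Real.pi * omega0 a b * deg n := by
  have h : ∀ x, n x ⬝ᵥ (grad n a x ⨯₃ grad n b x) = omega0 a b *
      (n x ⬝ᵥ (grad n (Pi.single 0 1) x ⨯₃ grad n (Pi.single 1 1) x)) := by
    intro x
    have ho : omega0 a b = a 0 * b 1 - a 1 * b 0 := by
      simp [omega0, Matrix.mulVec, dotProduct, Fin.sum_univ_two]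
      ring
    rw [grad_planar n a, grad_planar n b, ho]
    simp only [dot3, cross3_0, cross3_1, cross3_2, Pi.add_apply, Pi.smul_apply, smul_eq_mul]
    ring
  simp only [h]
  rw [integral_const_mul, deg]
  have := Real.pi_ne_zero
  field_simp

lemma omega0_single : omega0 (Pi.single 0 1) (Pi.single 1 1) = 1 := by
  simp [omega0]

lemma seField_translation (a x : Pt p) : seField ((0, a) : se p) x = a := by simp [seField]

/-- Translations commute, so the bracket formula says that the integral of `dα` over the plane
vanishes, and this integral is `4π (deg n + deg μ)`. -/
lemma deg_eq_neg {μ : DualField 2} (hμ : UnitField μ.1) {n : Pt 2 → R3}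
    (hn : n ∈ reducedSpace μ) : deg n = -deg μ.1 := by
  obtain ⟨q, hq, rfl⟩ := hn
  have h := integral_momForm_seBracket hμ hq (0, Pi.single 0 1) (0, Pi.single 1 1)
  have h0 : ∀ x, seField (seBracket ((0, Pi.single 0 1) : se 2) (0, Pi.single 1 1)) x = 0 := by
    intro x
    rw [seField_seBracket, seField_translation, seField_translation]
    change -((0 : Matrix (Fin 2) (Fin 2) ℝ) *ᵥ _ - (0 : Matrix (Fin 2) (Fin 2) ℝ) *ᵥ _) = 0
    rw [Matrix.zero_mulVec, Matrix.zero_mulVec, sub_zero, neg_zero]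
  simp only [h0, momForm_zero, integral_zero, seField_translation, integral_planar,
    omega0_single] at h
  have := Real.pi_pos
  have h2 : 4 * Real.pi * (deg q.mom.1 + deg μ.1) = 0 := by linarith
  rcases mul_eq_zero.1 h2 with h3 | h3
  · linarith
  · linarith

lemma ptMom_translation (n : Pt p → R3) (i : Fin p) :
    ptMom n (0, Pi.single i 1) = PT i n := by
  have h : PTrot (0 : so p) n = 0 := by simp [PTrot, grad]
  simp [ptMom, h, Pi.single_apply]

end LandauLifshitz

/-! ### Assembly of the theorem -/

theorem mainTheorem3 :
    (∀ (p : ℕ) (μ : DualField p), IsUnitField μ →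
      -- the momentum map restricted to the Lie algebra of `G` is `J^G`
      (∀ (q : Phase p) (X : LieElt p), X.eucl = 0 → momentum X q = pairing (JG q) X.fld) ∧
      -- the residual group
      (∀ g : Gtilde p, g ∈ Hmu μ ↔ ∀ x, (g.left.1 x).1 *ᵥ μ.1 (g.right⁻¹ • x) = μ.1 x) ∧
      GmuTilde μ = (SemidirectProduct.inl : Gp p →* Gtilde p).range ⊓ Hmu μ ∧
      (∃ _ : ((GmuTilde μ).subgroupOf (Hmu μ)).Normal,
        ∃ e : (Hmu μ ⧸ (GmuTilde μ).subgroupOf (Hmu μ)) ≃* SE p,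
          ∀ g : Hmu μ, e (QuotientGroup.mk g) = g.1.right) ∧
      -- the reduced space as a space of fields, and the residual action on it
      (∀ q r : Phase p, JG q = μ → JG r = μ →
        (q.mom = r.mom ↔ ∃ g ∈ GmuTilde μ, g • q = r)) ∧
      (∀ q : Phase p, JG q = μ → ∀ g ∈ Hmu μ, (g • q).mom.1 = act g.right q.mom.1) ∧
      (∀ n ∈ reducedSpace μ, ∀ h : SE p, act h n ∈ reducedSpace μ) ∧
      -- the Lie algebra of `H_μ` and the lift of `se(p)` to it
      (∀ X : LieElt p, InLieHmu μ X ↔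
        ∀ x, X.fld x ⨯₃ μ.1 x = grad μ.1 (seField X.eucl x) x) ∧
      (∀ v : se p, ∃ X : LieElt p, InLieHmu μ X ∧ X.eucl = v ∧
        ∀ x, X.fld x = μ.1 x ⨯₃ grad μ.1 (seField v x) x)) ∧
    (∀ (p : ℕ) (μ : DualField p), 2 ≤ p → IsUnitField μ →
      -- the reduced momentum map exists, generates the action, and has the cocycle `Σ`
      (∃ J, IsReducedMomentum μ J) ∧
      (∀ J, IsReducedMomentum μ J →
        (∀ v, Generates (reducedSpace μ) (fun n => J n v) v) ∧
        (∀ n ∈ reducedSpace μ, ∀ n' ∈ reducedSpace μ, ∀ h v, sigma J n h v = sigma J n' h v) ∧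
        (∀ n ∈ reducedSpace μ, ∀ (v w : se p) (γ : ℝ → SE p), IsTangentCurve γ w →
          HasDerivAt (fun ε => sigma J n (γ ε) v) (Sigma2 μ.1 v w) 0) ∧
        (∀ n ∈ reducedSpace μ, ∀ v w : se p,
          HasPoissonBracket (reducedSpace μ) (fun m => J m v) (fun m => J m w) n
            (J n (seBracket v w) + Sigma2 μ.1 v w)) ∧
        -- comparison with the Papanicolaou–Tomaras momentum
        (∀ n ∈ reducedSpace μ, ∀ v : se p, J n v =
          (PTrot v.1 n + ∑ i, v.2 i * PT i n) + (PTrot v.1 μ.1 + ∑ i, v.2 i * PT i μ.1)) ∧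
        (IsSphericallySymmetric μ.1 → ∀ n ∈ reducedSpace μ, ∀ i,
          J n (0, Pi.single i 1) = PT i n) ∧
        (IsRadial μ.1 → ∀ n ∈ reducedSpace μ, ∀ v : se p,
          J n v = PTrot v.1 n + ∑ i, v.2 i * PT i n)) ∧
      -- the cocycle of a spherically symmetric field
      (IsSphericallySymmetric μ.1 → ∀ v w : se p, Sigma2 μ.1 v w =
        -∫ x, μ.1 x ⬝ᵥ (grad μ.1 v.2 x ⨯₃ grad μ.1 w.2 x))) ∧
    -- the planar case
    (∀ μ : DualField 2, IsUnitField μ →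
      (IsSphericallySymmetric μ.1 → ∀ v w : se 2,
        Sigma2 μ.1 v w = -(4 * Real.pi) * omega0 v.2 w.2 * deg μ.1) ∧
      (∀ n ∈ reducedSpace μ, deg n = -deg μ.1) ∧
      (∀ n ∈ reducedSpace μ,
        HasPoissonBracket (reducedSpace μ) (PT 0) (PT 1) n (4 * Real.pi * deg n))) := by
  refine ⟨fun p μ hμ => ⟨fun q X hX => momentum_of_eucl_eq_zero q X hX, mem_Hmu_iff μ,
    GmuTilde_eq μ, exists_quotient_equiv hμ, fun q r hq hr => mom_eq_iff hq hr,
    fun q _ g _ => rfl, fun n hn h => act_mem_reducedSpace hμ hn h, inLieHmu_iff μ,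
    exists_lieElt hμ⟩, fun p μ hp hμ => ⟨exists_isReducedMomentum hp hμ, fun J hJ => ?_,
    fun hs v w => Sigma2_of_symmetric hp hμ.unitField hs v w⟩, fun μ hμ => ⟨?_, ?_, ?_⟩⟩
  · have hS : ∀ n ∈ reducedSpace μ, UnitField n :=
      fun n hn => unitField_of_mem_reducedSpace hμ.unitField hn
    have hJm : ∀ v, ∀ n ∈ reducedSpace μ, J n v = ptMom n v + ptMom μ.1 v :=
      fun v n hn => hJ.eq_ptMom hp hμ hn v
    refine ⟨fun v n hn => ⟨_, (hasFunctionalDeriv_ptMom hp hS hn v).congr_add (hJm v),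
      fun x => ?_⟩, fun n hn n' hn' h v => ?_, fun n hn v w γ hγ => ?_, fun n hn v w => ?_,
      fun n hn v => hJm v n hn, fun hs n hn i => ?_, fun hr n hn v => ?_⟩
    · rw [unit_cross_cross ((hS n hn).unit x) ((hS n hn).grad_dot _ x)]
    · rw [sigma_eq hp hμ hJ hn, sigma_eq hp hμ hJ hn']
    · simp only [sigma_eq hp hμ hJ hn]
      -- Two signs cancel: the cocycle contains `-M(hμ)`, and the derivative of `M(hμ)` is
      -- `-Sigma2`.
      simpa using (hasDerivAt_ptMom_act hp hμ.unitField v w hγ).const_sub (ptMom μ.1 v)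
    · have h := hasPoissonBracket_of_ptMom hp hμ hn (hJm v) (hJm w)
      obtain ⟨q, hq, rfl⟩ := hn
      rwa [hJ.eq_integral hμ hq, integral_momForm_seBracket hμ.unitField hq, Sigma2,
        add_neg_cancel_right]
    · rw [hJm _ n hn, ptMom_translation, ptMom_translation,
        PT_of_symmetric hp hμ.unitField hs, add_zero]
    · have h0 : ptMom μ.1 v = 0 := by
        simp [ptMom, PTrot_of_radial hμ.unitField hr,
          PT_of_symmetric hp hμ.unitField hr.isSphericallySymmetric]
      rw [hJm v n hn, h0, add_zero]
      rfl
  · intro hs v w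
    rw [Sigma2_of_symmetric le_rfl hμ.unitField hs, integral_planar]
    ring
  · exact fun n hn => deg_eq_neg hμ.unitField hn
  · intro n hn
    -- The functionals `P_x`, `P_y` are `ptMom` for the coordinate translations, so their bracket
    -- needs no symmetry of `μ`.
    have h := hasPoissonBracket_of_ptMom (F := PT 0) (K := PT 1) (v := (0, Pi.single 0 1))
      (w := (0, Pi.single 1 1)) (C := 0) (C' := 0) le_rfl hμ hn
      (fun m _ => by rw [ptMom_translation, add_zero])
      (fun m _ => by rw [ptMom_translation, add_zero])
    simpa only [seField_translation, integral_planar, omega0_single, mul_one] using h
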